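/- For a topological space $X$, the metric geodesic cover number of $X$ is the infimal number $n$ for which there is a metric on $X$ inducing its topology such that $X$ is a union of $n$ geodesics (isometric images of compact intervals). A cover $\Gamma$ of $X$ by geodesics is retracted if no $\alpha\in\Gamma$ has an endpoint with a neighborhood contained in the union of the other members of $\Gamma$; it is optimal if its size is the cover number of $X$. Regard a finite graph as a topological space in the usual way. Then the metric geodesic cover numbers of $K_5$, $K_{3,3}$, $K_4$ and $K_{2,3}$ are $$4,\qquad 4,\qquad 4,\qquad 3,$$ respectively. Moreover, up to homeomorphisms of $K_5$ (equivalently, up to automorphisms of the graph and the position of endpoints inside edges), $K_5$ has exactly three optimal retracted covers. If $0,1,2,3,4$ are the vertices of $K_5$ and $\overline{ij}$ is the midpoint of the edge $ij$, they are represented by the following pairwise inequivalent covers, each consisting of four paths that run along edges: 1. $\overline{13}\,1\,0\,2\,\overline{24}$, $\ \overline{23}\,3\,0\,4\,\overline{14}$, $\ \overline{13}\,3\,4\,\overline{24}$, $\ \overline{14}\,1\,2\,\overline{23}$; 2. $\overline{12}\,1\,0\,3\,\overline{34}$, $\ \overline{12}\,2\,0\,4\,\overline{34}$, $\ \overline{14}\,1\,3\,\overline{23}$,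 $\ \overline{23}\,2\,4\,\overline{14}$; 3. $\overline{12}\,1\,0\,3\,\overline{34}$, $\ \overline{12}\,2\,0\,4\,\overline{34}$, $\ \overline{24}\,2\,3\,\overline{13}$, $\ \overline{13}\,1\,4\,\overline{24}$. -/

import Mathlib

open Set

noncomputable section

namespace GeodesicCover

/-- The topological graph of a finite simple graph `G`: the geometric realization of `G`, that is,
the points of the standard simplex on the vertex set that are supported on a vertex or on an edge.
The vertex `v` is the point `Pi.single v 1`, and the closed edge joining `u` and `v` is the segment
between `Pi.single u 1` and `Pi.single v 1`. Two edges meet exactly in their common endpoints. It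
carries the subspace topology of `V → ℝ`. -/
abbrev GraphSpace {V : Type*} [Fintype V] (G : SimpleGraph V) : Type _ :=
  {x : V → ℝ // x ∈ stdSimplex ℝ V ∧
    ∃ u v : V, (u = v ∨ G.Adj u v) ∧ ∀ w : V, x w ≠ 0 → w = u ∨ w = v}

section Covers

variable {X : Type*}

/-- The metric `m` induces the topology `t` of `X`. -/
def IsCompatible (t : TopologicalSpace X) (m : MetricSpace X) : Prop :=
  m.toPseudoMetricSpace.toUniformSpace.toTopologicalSpace = t

/-- `S` is a geodesic of the metric `m` with endpoints `p` and `q`: it is the image of a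
distance-preserving map of a compact interval `[0, L]` that sends `0` to `p` and `L` to `q`. -/
def IsGeodesicBetween (m : MetricSpace X) (S : Set X) (p q : X) : Prop :=
  ∃ (L : ℝ) (γ : ℝ → X), 0 ≤ L ∧
    (∀ s ∈ Icc 0 L, ∀ t ∈ Icc 0 L, m.dist (γ s) (γ t) = |s - t|) ∧
    γ '' Icc 0 L = S ∧ γ 0 = p ∧ γ L = q

/-- `S` is a geodesic of the metric `m`. -/
def IsGeodesic (m : MetricSpace X) (S : Set X) : Prop :=
  ∃ p q : X, IsGeodesicBetween m S p q

/-- `Γ` is a finite cover of `X` by geodesics of the metric `m`. -/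
def IsGeodesicCover (m : MetricSpace X) (Γ : Set (Set X)) : Prop :=
  Γ.Finite ∧ (∀ S ∈ Γ, IsGeodesic m S) ∧ ⋃₀ Γ = univ

/-- The metric geodesic cover number of `X`: the infimal number of geodesics in a cover of `X` by
geodesics of some metric that induces the topology of `X` (it is `⊤` if there is no such cover). -/
def coverNumber (X : Type*) [t : TopologicalSpace X] : ℕ∞ :=
  sInf {n : ℕ∞ | ∃ m : MetricSpace X, IsCompatible t m ∧
    ∃ Γ : Set (Set X), IsGeodesicCover m Γ ∧ Γ.encard = n}

/-- The geodesic `S` is retractable in `Γ`: some neighborhood (in `X`) of an endpoint of `S` is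
contained in the union of the other members of `Γ`. -/
def IsRetractable (t : TopologicalSpace X) (m : MetricSpace X) (Γ : Set (Set X)) (S : Set X) :
    Prop :=
  ∃ p q : X, IsGeodesicBetween m S p q ∧
    ((∃ U ∈ @nhds X t p, U ⊆ ⋃₀ (Γ \ {S})) ∨ (∃ U ∈ @nhds X t q, U ⊆ ⋃₀ (Γ \ {S})))

/-- `Γ` is an optimal retracted cover of `X`: for some metric that induces the topology of `X` it
is a cover by geodesics without retractable members, and its size is the cover number of `X`. -/
def IsOptimalRetractedCover [t : TopologicalSpace X] (Γ : Set (Set X)) : Prop :=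
  (∃ m : MetricSpace X, IsCompatible t m ∧ IsGeodesicCover m Γ ∧ ∀ S ∈ Γ, ¬ IsRetractable t m Γ S) ∧
    Γ.encard = coverNumber X

/-- Two families of subsets are equivalent if a homeomorphism of `X` onto itself carries one onto
the other. -/
def CoverEquiv [TopologicalSpace X] (Γ Γ' : Set (Set X)) : Prop :=
  ∃ h : X ≃ₜ X, (fun S : Set X => h '' S) '' Γ = Γ'

theorem CoverEquiv.rfl' [TopologicalSpace X] (Γ : Set (Set X)) : CoverEquiv Γ Γ :=
  ⟨Homeomorph.refl X, by simp⟩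

theorem CoverEquiv.symm' [TopologicalSpace X] {Γ Γ' : Set (Set X)} (h : CoverEquiv Γ Γ') :
    CoverEquiv Γ' Γ := by
  obtain ⟨f, rfl⟩ := h
  refine ⟨f.symm, ?_⟩
  simp [Set.image_image]

theorem CoverEquiv.trans' [TopologicalSpace X] {Γ₁ Γ₂ Γ₃ : Set (Set X)}
    (h : CoverEquiv Γ₁ Γ₂) (h' : CoverEquiv Γ₂ Γ₃) : CoverEquiv Γ₁ Γ₃ := by
  obtain ⟨f, rfl⟩ := h
  obtain ⟨g, rfl⟩ := h'
  refine ⟨f.trans g, ?_⟩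
  rw [Set.image_image]
  refine Set.image_congr fun S _ => ?_
  rw [Set.image_image]
  exact Set.image_congr fun _ _ => rfl

/-- Equivalence under homeomorphisms of `X`, on the optimal retracted covers of `X`. -/
def coverSetoid (X : Type*) [TopologicalSpace X] :
    Setoid {Γ : Set (Set X) // IsOptimalRetractedCover Γ} where
  r Γ Γ' := CoverEquiv Γ.1 Γ'.1
  iseqv := ⟨fun Γ => CoverEquiv.rfl' Γ.1, fun h => h.symm', fun h h' => h.trans' h'⟩

end Covers

/-- The broken line through the points of a list. -/
def polyline {V : Type*} : List (V → ℝ) → Set (V → ℝ)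
  | a :: b :: l => segment ℝ a b ∪ polyline (b :: l)
  | _ => ∅

/-- The path in the topological graph of `G` that runs through a list of vertices (`(v, v)` stands
for the vertex `v`) and midpoints of edges (`(u, v)` stands for the midpoint of the edge `uv`). -/
def graphPath {V : Type*} [Fintype V] [DecidableEq V] (G : SimpleGraph V) (l : List (V × V)) :
    Set (GraphSpace G) :=
  Subtype.val ⁻¹' polyline
    (l.map fun p => midpoint ℝ (Pi.single p.1 (1 : ℝ)) (Pi.single p.2 (1 : ℝ)))

/-- Three families of four paths in `K₅`. In each of them the vertex `0` is interior to two paths,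
and the eight endpoints of paths are the midpoints of four edges, each taken twice. -/
def k5Cover : Fin 3 → Set (Set (GraphSpace (⊤ : SimpleGraph (Fin 5)))) :=
  ![{graphPath ⊤ [(1, 3), (1, 1), (0, 0), (2, 2), (2, 4)],
     graphPath ⊤ [(2, 3), (3, 3), (0, 0), (4, 4), (1, 4)],
     graphPath ⊤ [(1, 3), (3, 3), (4, 4), (2, 4)],
     graphPath ⊤ [(1, 4), (1, 1), (2, 2), (2, 3)]},
    {graphPath ⊤ [(1, 2), (1, 1), (0, 0), (3, 3), (3, 4)],
     graphPath ⊤ [(1, 2), (2, 2), (0, 0), (4, 4), (3, 4)],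
     graphPath ⊤ [(1, 4), (1, 1), (3, 3), (2, 3)],
     graphPath ⊤ [(2, 3), (2, 2), (4, 4), (1, 4)]},
    {graphPath ⊤ [(1, 2), (1, 1), (0, 0), (3, 3), (3, 4)],
     graphPath ⊤ [(1, 2), (2, 2), (0, 0), (4, 4), (3, 4)],
     graphPath ⊤ [(2, 4), (2, 2), (3, 3), (1, 3)],
     graphPath ⊤ [(1, 3), (1, 1), (4, 4), (2, 4)]}]

end GeodesicCover

end

/-! Lower bounds. A geodesic is an injective path, so it runs through distinct, successively
adjacent vertices and may continue into one more edge at both ends, or else it lies inside one edge.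
Because an open edge is connected, a finite cover by geodesics treats an edge `uv` in one of three
ways (`edge_cases`): some geodesic contains it, some geodesic lies inside it, or a geodesic that
comes out of `u` and one that comes out of `v` share an interior point. A point chosen on each edge
of the last kind turns the cover into finite data (`exists_paths`): lists of vertices and edge
points, each in the order of a geodesic. A geodesic inside an edge may be replaced by the whole
edge, since two points impose no betweenness.

Metric betweenness obeys transitivity laws that come from the triangle inequality. `Search`
enumerates the possible families of lists and closes every branch in which these laws yield a
contradiction; `select_sound` and the lemmas around it show that the data of an actual cover survive
in some branch. Nothing survives for two paths in `K₂,₃` and for three paths in `K₄` or `K₃,₃`. For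
four paths in `K₅`, after a longest one is moved to the first vertices, only relabelings of three
families survive (`k5_paths`). Each of these consists of four different paths, so three geodesics
cannot cover `K₅` either.

From the data back to sets. Suppose that no member is retractable. Then a geodesic whose path is
prolonged at both ends cannot run past the chosen points there, because beyond such a point the
geodesic from the other side would cover a neighborhood of its endpoint
(`Param.exists_nhds_subset`). Hence it is the broken line through its list
(`Param.IsPath.eq_polyline`). A homeomorphism that permutes the vertices and bends the edges moves
the midpoints of the edges to the chosen points (`exists_homeomorph_image`), so the cover is
equivalent to one of the three.

Existence. Take one function for each path, affine on the halves of edges and given by an integer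
table, and pull back the maximum norm. If the function of a path increases on every half edge of the
path at least as fast as any other function changes there, the path is a geodesic
(`calibrated_polyline`, `Calibrated.isGeodesicBetween`). The tables are checked by evaluation.
Finally, the three covers of `K₅` are told apart by which of their members intersect
(`eq_of_coverEquiv`). -/

namespace GeodesicCover

namespace Search

/-! ### A search over families of paths with betweenness constraints

The points are natural numbers below `16`: the vertices of a graph, and labels for points in the
interior of its edges. A bit mask `R` records facts "`b` lies between `a` and `c`". The functions
are written with recursors, so that the kernel evaluates them fast. -/

/-- Evaluate `n` before passing it on. -/
def force (n : ℕ) (f : ℕ → Bool) : Bool :=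
  -- The recursor makes the kernel reduce `n` to a numeral first; both branches then apply `f` to
  -- the value of `n`.
  Nat.rec (motive := fun _ => Bool) (f 0) (fun m _ => f (Nat.succ m)) n

def bit (R i : ℕ) : Bool :=
  Nat.beq (Nat.land (Nat.shiftRight R i) (nat_lit 1)) (nat_lit 1)

def pw (i : ℕ) : ℕ := Nat.shiftLeft (nat_lit 1) i

def code2 (a b : ℕ) : ℕ := Nat.add (Nat.mul a (nat_lit 16)) b

def code (a b c : ℕ) : ℕ := code2 (code2 a b) c

/-- The bits that say that `b` lies between `a` and `c`. -/
def fact (a b c : ℕ) : ℕ :=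
  Nat.lor (Nat.lor (pw (code a b c)) (pw (code c b a)))
    -- The second block, from bit `4096 = 16 ^ 3` on, stores the middle point last, so that a row of
    -- 16 bits lists all points known to lie between two given ones.
    (Nat.lor (pw (Nat.add (nat_lit 4096) (code a c b))) (pw (Nat.add (nat_lit 4096) (code c a b))))

/-- The bits that contradict `b` lying between `a` and `c`. -/
def conf (a b c : ℕ) : ℕ := Nat.lor (pw (code b a c)) (pw (code b c a))

def masks2 (g : ℕ → ℕ → ℕ → ℕ) (a b : ℕ) (l : List ℕ) : ℕ :=
  List.rec (motive := fun _ => ℕ) (nat_lit 0) (fun c _ ih => Nat.lor (g a b c) ih) l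

def masks1 (g : ℕ → ℕ → ℕ → ℕ) (a : ℕ) (l : List ℕ) : ℕ :=
  List.rec (motive := fun _ => ℕ) (nat_lit 0) (fun b l ih => Nat.lor (masks2 g a b l) ih) l

/-- The union of the masks of the triples of a list. -/
def masks (g : ℕ → ℕ → ℕ → ℕ) (l : List ℕ) : ℕ :=
  List.rec (motive := fun _ => ℕ) (nat_lit 0) (fun a l ih => Nat.lor (masks1 g a l) ih) l

/-- The mask of the ordered pairs of consecutive members of a list. -/
def emask : List ℕ → ℕ
  | a :: b :: l => Nat.lor (Nat.lor (pw (code2 a b)) (pw (code2 b a))) (emask (b :: l))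
  | _ => 0

/-- A list of vertices with the masks of its edges, its facts and their contradictions. -/
structure Core where
  l : List ℕ
  E : ℕ
  F : ℕ
  X : ℕ

def Core.of (l : List ℕ) : Core := ⟨l, emask l, masks fact l, masks conf l⟩

/-- In continuation-passing style, so that each mask is a numeral before it is stored and is not
recomputed at every use. -/
def mkCore (l : List ℕ) (k : Core → Bool) : Bool :=
  force (emask l) fun E => force (masks fact l) fun F => force (masks conf l) fun X => k ⟨l, E, F, X⟩

def mkCores (k : List Core → Bool) (ls : List (List ℕ)) : List Core → Bool :=
  List.rec (motive := fun _ => List Core → Bool) k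
    (fun l _ ih acc => mkCore l fun c => ih (c :: acc)) ls

/-- A path through the vertices `core` that may continue to one more point at both ends. -/
structure Arc where
  pre : List ℕ
  core : List ℕ
  post : List ℕ

def Arc.pts (a : Arc) : List ℕ := a.pre ++ a.core ++ a.post

def headIs (u : ℕ) (l : List ℕ) : Bool :=
  List.rec (motive := fun _ => Bool) false (fun a _ _ => Nat.beq a u) l

def lastIs (u : ℕ) (l : List ℕ) : Bool := headIs u l.reverse

def emp (l : List ℕ) : Bool := List.rec (motive := fun _ => Bool) true (fun _ _ _ => false) l

/-- Add facts, unless they contradict known ones. -/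
def addF (R F X : ℕ) (k : ℕ → Bool) : Bool :=
  -- Throughout the search the value `true` means that a branch is closed by a contradiction or
  -- accepted at its end; contradictory facts close it here.
  cond (Nat.beq (Nat.land R X) (nat_lit 0)) (force (Nat.lor R F) k) true

/-- Continue one of the paths with end `u` to the point `e`, in all possible ways. -/
def attach (u e : ℕ) (k : List Arc → ℕ → Bool) (R : ℕ) (done as : List Arc) : Bool :=
  List.rec (motive := fun _ => List Arc → Bool) (fun _ => true)
    (fun a as ih done =>
      -- The beginning of the path may be used if it is free or already leads to `e`, and if the
      -- other end does not lead to `e`, since a path has no repeated point. The end of the path is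
      -- treated likewise, and the conjunction runs over all possibilities.
      cond (cond (cond (headIs u a.core) (cond (cond (emp a.pre) true (headIs e a.pre))
            (cond (headIs e a.post) false true) false) false)
          (addF R (masks1 fact e (a.core ++ a.post)) (masks1 conf e (a.core ++ a.post))
            (k (done.reverseAux (⟨[e], a.core, a.post⟩ :: as)))) true)
        (cond (cond (cond (lastIs u a.core) (cond (cond (emp a.post) true (headIs e a.post))
              (cond (headIs e a.pre) false true) false) false)
            (addF R (masks1 fact e (a.core.reverse ++ a.pre))
              (masks1 conf e (a.core.reverse ++ a.pre))
              (k (done.reverseAux (⟨a.pre, a.core, [e]⟩ :: as)))) true)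
          (ih (a :: done)) false) false) as done

/-- For every edge `(u, v, e)` outside of the mask `M`, continue paths from `u` and from `v` to
the point `e`. -/
def assign (fin : List ℕ → List Arc → ℕ → Bool) (M : ℕ) (es : List (ℕ × ℕ × ℕ)) :
    List ℕ → List Arc → ℕ → Bool :=
  List.rec (motive := fun _ => List ℕ → List Arc → ℕ → Bool) fin
    (fun t _ ih P as R => cond (bit M (code2 t.1 t.2.1)) (ih P as R)
      (attach t.1 t.2.2 (fun as' R' => attach t.2.1 t.2.2 (ih (t.2.2 :: P)) R' [] as') R [] as)) es

/-- Cores whose facts do not contradict the known ones. -/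
def compat (R : ℕ) (cs : List Core) : List Core :=
  List.rec (motive := fun _ => List Core) []
    (fun c _ ih => cond (Nat.beq (Nat.land R c.X) (nat_lit 0)) (c :: ih) ih) cs

def row (R i : ℕ) : ℕ := Nat.land (Nat.shiftRight R (Nat.mul i (nat_lit 16))) (nat_lit 65535)

/-- A contradiction that follows from `b` lying between `a` and `c` and from two known facts. -/
def quick1 (R a b c : ℕ) : Bool :=
  -- The left row lists the `d` with `c` between `a` and `d`; then `a, b, c, d` lie in this order.
  -- The right rows list the `d` for which `a` is between `b` and `d`, `b` between `c` and `d`, `d`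
  -- between `a` and `b`, or `d` between `b` and `c`, each of which contradicts that order.
  cond (Nat.beq (Nat.land (row R (code2 a c))
    (Nat.lor (Nat.lor (row R (code2 b a)) (row R (code2 c b)))
      (Nat.lor (row R (Nat.add (nat_lit 256) (code2 a b)))
        (row R (Nat.add (nat_lit 256) (code2 b c)))))) (nat_lit 0)) false true

def quickL2 (R a b : ℕ) (l : List ℕ) : Bool :=
  List.rec (motive := fun _ => Bool) false
    (fun c _ ih => cond (quick1 R a b c) true (cond (quick1 R c b a) true ih)) l

def quickL1 (R a : ℕ) (l : List ℕ) : Bool :=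
  List.rec (motive := fun _ => Bool) false (fun b l ih => cond (quickL2 R a b l) true ih) l

def quickL (R : ℕ) (l : List ℕ) : Bool :=
  List.rec (motive := fun _ => Bool) false (fun a l ih => cond (quickL1 R a l) true ih) l

/-- A search for a contradiction that involves three facts. -/
def quick (R : ℕ) (as : List Arc) : Bool :=
  List.rec (motive := fun _ => Bool) false (fun a _ ih => cond (quickL R a.pts) true ih) as

def add1 (R a b c : ℕ) (k : ℕ → Bool) : Bool :=
  cond (bit R (code a b c)) (k R) (addF R (fact a b c) (conf a b c) k)

/-- If `b` is between `a` and `c`, and `c` between `a` and `d`, then `b` is between `a` and `d`, and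
`c` between `b` and `d`. The cases `d = a` and `d = b` are contradictions themselves. -/
def loopD (a b c : ℕ) (k : ℕ → Bool) (l : List ℕ) : ℕ → Bool :=
  List.rec (motive := fun _ => ℕ → Bool) k
    (fun d _ ih R => cond (bit R (code a c d))
      (cond (cond (Nat.beq a d) true (Nat.beq b d)) true
        (add1 R a b d fun R' => add1 R' b c d ih)) (ih R)) l

def loopC (P : List ℕ) (a b : ℕ) (k : ℕ → Bool) (l : List ℕ) : ℕ → Bool :=
  List.rec (motive := fun _ => ℕ → Bool) k
    (fun c _ ih R => cond (bit R (code a b c)) (loopD a b c ih P R) (ih R)) l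

def loopB (P : List ℕ) (a : ℕ) (k : ℕ → Bool) (l : List ℕ) : ℕ → Bool :=
  List.rec (motive := fun _ => ℕ → Bool) k
    (fun b _ ih R => cond (Nat.beq (row R (code2 a b)) (nat_lit 0)) (ih R) (loopC P a b ih P R)) l

def loopA (P : List ℕ) (k : ℕ → Bool) (l : List ℕ) : ℕ → Bool :=
  List.rec (motive := fun _ => ℕ → Bool) k (fun a _ ih R => loopB P a ih P R) l

/-- Close the facts under transitivity, in `n` rounds, until there is a contradiction. -/
def rounds (P : List ℕ) : ℕ → ℕ → Bool
  | 0, _ => false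
  | n + 1, R => loopA P (rounds P n) P R

def popc (x : ℕ) : ℕ :=
  Nat.add (Nat.add (Nat.add (Nat.land x (nat_lit 1)) (Nat.land (Nat.shiftRight x (nat_lit 1)) (nat_lit 1)))
    (Nat.add (Nat.land (Nat.shiftRight x (nat_lit 2)) (nat_lit 1))
      (Nat.land (Nat.shiftRight x (nat_lit 3)) (nat_lit 1))))
    (Nat.add (Nat.land (Nat.shiftRight x (nat_lit 4)) (nat_lit 1))
      (Nat.land (Nat.shiftRight x (nat_lit 5)) (nat_lit 1)))

/-- The ends of a path, counted in the hexadecimal digits of a number. -/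
def endSum (l : List ℕ) : ℕ :=
  List.rec (motive := fun _ => ℕ) (nat_lit 0)
    (fun a l _ => Nat.add (pw (Nat.mul (nat_lit 4) a)) (pw (Nat.mul (nat_lit 4) (l.getLastD a)))) l

def endSums (as : List Arc) : ℕ :=
  List.rec (motive := fun _ => ℕ) (nat_lit 0) (fun a _ ih => Nat.add (endSum a.core) ih) as

/-- Can the vertices `u` have enough ends of paths, when `k` paths are still to be chosen? -/
def enough (us : List (ℕ × ℕ)) (k M : ℕ) (as : List Arc) (r : Bool) : Bool :=
  force (endSums as) fun V => List.rec (motive := fun _ => Bool) r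
    -- The `xor` removes the neighbors that a chosen core already joins to `u`. Each remaining edge
    -- at `u` needs an end at `u` of a chosen path, or a path still to be chosen, which uses at most
    -- two edges at `u`.
    (fun u _ ih => cond (Nat.ble (popc (Nat.xor u.2 (Nat.land u.2 (row M u.1))))
      (Nat.add (Nat.land (Nat.shiftRight V (Nat.mul (nat_lit 4) u.1)) (nat_lit 15))
        (Nat.mul (nat_lit 2) k))) ih true) us

/-- Choose `k` cores. -/
def select (us : List (ℕ × ℕ)) (leaf : List Arc → ℕ → ℕ → Bool) :
    ℕ → List Core → List Arc → ℕ → ℕ → Bool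
  | 0, _, as, M, R => enough us 0 M as (leaf as M R)
  | k + 1, cs, as, M, R =>
    enough us (k + 1) M as (List.rec (motive := fun _ => Bool) true
      (fun c cs ih =>
        cond (force (Nat.lor M c.E) fun M' => force (Nat.lor R c.F) fun R' =>
          -- The candidate `c` stays available, since several geodesics may have the same vertices;
          -- earlier candidates do not, so that the order of the paths is not counted.
          select us leaf k (compat R' (c :: cs)) (⟨[], c.l, []⟩ :: as) M' R') ih false)
      (compat R cs))

/-- A graph: its vertices with the masks of their neighbors, its edges with their labels. -/
structure Graph where
  V : List (ℕ × ℕ)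
  E : List (ℕ × ℕ × ℕ)

/-- The number of rounds only bounds the effort: when they run out without a contradiction, the
decision is left to `good`. -/
def finish (good : List Arc → Bool) (P : List ℕ) (as : List Arc) (R : ℕ) : Bool :=
  cond (quick R as) true (cond (rounds P 6 R) true (good as))

def leaf (G : Graph) (P : List ℕ) (good : List Arc → Bool) (as : List Arc) (M R : ℕ) : Bool :=
  cond (quick R as) true (assign (finish good) M G.E P as R)

/-- Paths with `k` vertices. -/
def pathsOf (G : Graph) : ℕ → List (List ℕ)
  | 0 => [[]]
  | k + 1 => (pathsOf G k).flatMap fun p =>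
      (G.V.filter fun u => !p.contains u.1 && (p.isEmpty || bit u.2 (p.headD 0))).map (·.1 :: p)

/-- Paths with at most `k` vertices, one of each pair of a path and its reversal. -/
def candidates (G : Graph) : ℕ → List (List ℕ)
  | 0 => []
  | k + 1 => (pathsOf G (k + 1)).filter (fun p => Nat.ble (p.headD 0) (p.getLastD 0)) ++
      candidates G k

def search (G : Graph) (n : ℕ) (good : List Arc → Bool) : Bool :=
  mkCores (fun cs => select G.V (leaf G (G.V.map (·.1)) good) n cs [] 0 0)
    (candidates G G.V.length) []

/-- The search when one of the longest paths runs through the vertices `0, …, m - 1`. -/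
def searchFrom (G : Graph) (n m : ℕ) (good : List Arc → Bool) : Bool :=
  mkCores (fun cs => mkCore (List.range m) fun c =>
    select G.V (leaf G (G.V.map (·.1)) good) n cs [⟨[], c.l, []⟩] c.E c.F) (candidates G m) []

/-- The complete graph on five vertices. -/
def K5 : Graph where
  V := [(0, 30), (1, 29), (2, 27), (3, 23), (4, 15)]
  E := [(0, 1, 5), (0, 2, 6), (0, 3, 7), (0, 4, 8), (1, 2, 9), (1, 3, 10), (1, 4, 11), (2, 3, 12),
    (2, 4, 13), (3, 4, 14)]

def K33 : Graph where
  V := [(0, 56), (1, 56), (2, 56), (3, 7), (4, 7), (5, 7)]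
  E := [(0, 3, 6), (0, 4, 7), (0, 5, 8), (1, 3, 9), (1, 4, 10), (1, 5, 11), (2, 3, 12), (2, 4, 13),
    (2, 5, 14)]

def K4 : Graph where
  V := [(0, 14), (1, 13), (2, 11), (3, 7)]
  E := [(0, 1, 4), (0, 2, 5), (0, 3, 6), (1, 2, 7), (1, 3, 8), (2, 3, 9)]

def K23 : Graph where
  V := [(0, 28), (1, 28), (2, 3), (3, 3), (4, 3)]
  E := [(0, 2, 5), (0, 3, 6), (0, 4, 7), (1, 2, 8), (1, 3, 9), (1, 4, 10)]

end Search

/-! ### Masks of betweenness facts and their soundness. -/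

namespace Search

/-- The laws of metric betweenness of distinct points that the search uses. -/
structure IsBetweenness (B : ℕ → ℕ → ℕ → Prop) : Prop where
  symm : ∀ {a b c}, B a b c → B c b a
  ne : ∀ {a b}, ¬ B a b a
  not_swap : ∀ {a b c}, B a b c → ¬ B b a c
  left : ∀ {a b c d}, B a b c → B a c d → B a b d
  right : ∀ {a b c d}, B a b c → B a c d → B b c d
  lt : ∀ {a b c}, B a b c → a < 16 ∧ b < 16 ∧ c < 16

theorem IsBetweenness.not_swap' {B : ℕ → ℕ → ℕ → Prop} (hB : IsBetweenness B) {a b c : ℕ}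
    (h : B a b c) : ¬ B a c b :=
  fun h' => hB.not_swap (hB.symm h) (hB.symm h')

theorem force_eq (n : ℕ) (f : ℕ → Bool) : force n f = f n := by
  cases n <;> rfl

theorem bit_eq (R i : ℕ) : bit R i = R.testBit i := by
  have h : bit R i = Nat.beq ((R >>> i) &&& 1) 1 := rfl
  rw [h, Nat.testBit, Nat.and_comm 1, Nat.and_one_is_mod]
  rcases Nat.mod_two_eq_zero_or_one (R >>> i) with h | h <;> rw [h] <;> rfl

theorem testBit_pw (i j : ℕ) : (pw i).testBit j = decide (i = j) := by
  have h : pw i = 2 ^ i := by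
    change (1 : ℕ) <<< i = _
    simp [Nat.shiftLeft_eq]
  rw [h, Nat.testBit_two_pow]

theorem testBit_lor (x y i : ℕ) : (Nat.lor x y).testBit i = (x.testBit i || y.testBit i) :=
  Nat.testBit_or x y i

theorem testBit_row (R i d : ℕ) :
    (row R i).testBit d = (decide (d < 16) && R.testBit (code2 i d)) := by
  have h : row R i = (R >>> (i * 16)) &&& (2 ^ 16 - 1) := rfl
  rw [h, Nat.testBit_and, Nat.testBit_shiftRight, Nat.testBit_two_pow_sub_one, Bool.and_comm]
  rfl

theorem code_eq (a b c : ℕ) : code a b c = (a * 16 + b) * 16 + c := rfl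

theorem code2_eq (a b : ℕ) : code2 a b = a * 16 + b := rfl

theorem land_eq_zero {x y : ℕ} : Nat.beq (Nat.land x y) (nat_lit 0) = true ↔
    ∀ i, x.testBit i = true → y.testBit i = true → False := by
  rw [Nat.beq_eq]
  constructor
  · intro h i hx hy
    have h' : (x &&& y).testBit i = true := by simp [hx, hy]
    rw [show x &&& y = 0 from h] at h'
    simp at h'
  · intro h
    refine Nat.eq_of_testBit_eq fun i => ?_
    change (x &&& y).testBit i = (0 : ℕ).testBit i
    rw [Nat.testBit_and, Nat.zero_testBit]
    by_contra h'
    simp only [Bool.not_eq_false, Bool.and_eq_true] at h'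
    exact h i h'.1 h'.2

variable {B : ℕ → ℕ → ℕ → Prop}

/-- All facts of the mask `R` hold. -/
def Holds (B : ℕ → ℕ → ℕ → Prop) (R : ℕ) : Prop :=
  ∀ a b c, a < 16 → b < 16 → c < 16 → (R.testBit (code a b c) = true → B a b c) ∧
    (R.testBit (4096 + code a c b) = true → B a b c)

theorem holds_zero : Holds B 0 := by
  intro a b c _ _ _
  simp

theorem Holds.lor {R R' : ℕ} (h : Holds B R) (h' : Holds B R') : Holds B (Nat.lor R R') := by
  intro a b c ha hb hc
  simp only [testBit_lor, Bool.or_eq_true]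
  exact ⟨fun hh => hh.elim (h a b c ha hb hc).1 (h' a b c ha hb hc).1,
    fun hh => hh.elim (h a b c ha hb hc).2 (h' a b c ha hb hc).2⟩

theorem holds_fact (hB : IsBetweenness B) {a b c : ℕ} (h : B a b c) : Holds B (fact a b c) := by
  intro x y z hx hy hz
  obtain ⟨ha, hb, hc⟩ := hB.lt h
  simp only [fact, testBit_lor, testBit_pw, Bool.or_eq_true, decide_eq_true_eq, Nat.add_eq, code_eq]
  constructor
  · rintro ((h1 | h1) | (h1 | h1))
    · obtain ⟨rfl, rfl, rfl⟩ : a = x ∧ b = y ∧ c = z := by omega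
      exact h
    · obtain ⟨rfl, rfl, rfl⟩ : c = x ∧ b = y ∧ a = z := by omega
      exact hB.symm h
    · omega
    · omega
  · rintro ((h1 | h1) | (h1 | h1))
    · omega
    · omega
    · obtain ⟨rfl, rfl, rfl⟩ : a = x ∧ b = y ∧ c = z := by omega
      exact h
    · obtain ⟨rfl, rfl, rfl⟩ : c = x ∧ b = y ∧ a = z := by omega
      exact hB.symm h

/-- A mask of facts that do not hold. -/
def Fails (B : ℕ → ℕ → ℕ → Prop) (X : ℕ) : Prop :=
  ∀ i, X.testBit i = true → ∃ a b c, a < 16 ∧ b < 16 ∧ c < 16 ∧ i = code a b c ∧ ¬ B a b c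

theorem fails_zero : Fails B 0 := by
  intro i
  simp

theorem Fails.lor {R R' : ℕ} (h : Fails B R) (h' : Fails B R') : Fails B (Nat.lor R R') := by
  intro i hi
  rw [testBit_lor, Bool.or_eq_true] at hi
  exact hi.elim (h i) (h' i)

theorem fails_conf (hB : IsBetweenness B) {a b c : ℕ} (h : B a b c) : Fails B (conf a b c) := by
  intro i hi
  obtain ⟨ha, hb, hc⟩ := hB.lt h
  simp only [conf, testBit_lor, testBit_pw, Bool.or_eq_true, decide_eq_true_eq] at hi
  rcases hi with rfl | rfl
  · exact ⟨b, a, c, hb, ha, hc, rfl, hB.not_swap h⟩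
  · exact ⟨b, c, a, hb, hc, ha, rfl, hB.not_swap (hB.symm h)⟩

theorem Holds.land {R X : ℕ} (h : Holds B R) (h' : Fails B X) :
    Nat.beq (Nat.land R X) (nat_lit 0) = true := by
  rw [land_eq_zero]
  intro i hR hX
  obtain ⟨a, b, c, ha, hb, hc, rfl, hn⟩ := h' i hX
  exact hn ((h a b c ha hb hc).1 hR)

/-- Facts that hold never meet a contradiction to facts that hold, so the closing branch is not
taken and the value `true` comes from the continuation. All soundness lemmas have this shape: some
continuation was called on a mask of true facts. -/
theorem addF_sound {R F X : ℕ} {k : ℕ → Bool} (hR : Holds B R) (hF : Holds B F) (hX : Fails B X)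
    (h : addF R F X k = true) : ∃ R', Holds B R' ∧ k R' = true := by
  rw [addF, hR.land hX, cond_true, force_eq] at h
  exact ⟨_, hR.lor hF, h⟩

/-- The points of a list lie in this order. -/
def Ordered (B : ℕ → ℕ → ℕ → Prop) (l : List ℕ) : Prop :=
  ∀ a b c, [a, b, c].Sublist l → B a b c

theorem Ordered.sublist {l l' : List ℕ} (h : Ordered B l) (h' : l'.Sublist l) : Ordered B l' :=
  fun a b c hs => h a b c (hs.trans h')

theorem Ordered.reverse (hB : IsBetweenness B) {l : List ℕ} (h : Ordered B l) :
    Ordered B l.reverse := by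
  intro a b c hs
  refine hB.symm (h c b a ?_)
  have := hs.reverse
  simpa using this

/-- Masks are unions over triples, so a property that is stable under unions passes to them; used
for both `Holds` and `Fails`. -/
theorem masks2_ind {g : ℕ → ℕ → ℕ → ℕ} {Q : ℕ → Prop} (h0 : Q 0)
    (hl : ∀ x y, Q x → Q y → Q (Nat.lor x y)) (a b : ℕ) (l : List ℕ)
    (h : ∀ c ∈ l, Q (g a b c)) : Q (masks2 g a b l) := by
  induction l with
  | nil => exact h0
  | cons c l ih => exact hl _ _ (h c (by simp)) (ih fun c' hc' => h c' (by simp [hc']))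

theorem masks1_ind {g : ℕ → ℕ → ℕ → ℕ} {Q : ℕ → Prop} (h0 : Q 0)
    (hl : ∀ x y, Q x → Q y → Q (Nat.lor x y)) (a : ℕ) (l : List ℕ)
    (h : ∀ b c, [b, c].Sublist l → Q (g a b c)) : Q (masks1 g a l) := by
  induction l with
  | nil => exact h0
  | cons b l ih =>
    refine hl _ _ (masks2_ind h0 hl a b l fun c hc => h b c ?_) (ih fun b' c' hs => h b' c' (hs.cons b))
    exact List.Sublist.cons_cons b (by simpa using hc)

theorem masks_ind {g : ℕ → ℕ → ℕ → ℕ} {Q : ℕ → Prop} (h0 : Q 0)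
    (hl : ∀ x y, Q x → Q y → Q (Nat.lor x y)) (l : List ℕ)
    (h : ∀ a b c, [a, b, c].Sublist l → Q (g a b c)) : Q (masks g l) := by
  induction l with
  | nil => exact h0
  | cons a l ih =>
    exact hl _ _ (masks1_ind h0 hl a l fun b c hs => h a b c (hs.cons_cons a))
      (ih fun a' b' c' hs => h a' b' c' (hs.cons a))

theorem holds_masks (hB : IsBetweenness B) {l : List ℕ} (h : Ordered B l) :
    Holds B (masks fact l) :=
  masks_ind holds_zero (fun _ _ => Holds.lor) l fun a b c hs => holds_fact hB (h a b c hs)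

theorem fails_masks (hB : IsBetweenness B) {l : List ℕ} (h : Ordered B l) :
    Fails B (masks conf l) :=
  masks_ind fails_zero (fun _ _ => Fails.lor) l fun a b c hs => fails_conf hB (h a b c hs)

theorem holds_masks1 (hB : IsBetweenness B) {a : ℕ} {l : List ℕ} (h : Ordered B (a :: l)) :
    Holds B (masks1 fact a l) :=
  masks1_ind holds_zero (fun _ _ => Holds.lor) a l fun b c hs =>
    holds_fact hB (h a b c (hs.cons_cons a))

theorem fails_masks1 (hB : IsBetweenness B) {a : ℕ} {l : List ℕ} (h : Ordered B (a :: l)) :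
    Fails B (masks1 conf a l) :=
  masks1_ind fails_zero (fun _ _ => Fails.lor) a l fun b c hs =>
    fails_conf hB (h a b c (hs.cons_cons a))

/-! ### Contradictions -/

theorem quick1_sound (hB : IsBetweenness B) {R a b c : ℕ} (hR : Holds B R) (h : B a b c) :
    quick1 R a b c = false := by
  obtain ⟨ha, hb, hc⟩ := hB.lt h
  rw [quick1, land_eq_zero.2 fun d h1 h2 => ?_, cond_true]
  simp only [testBit_lor, testBit_row, Bool.and_eq_true, decide_eq_true_eq, Bool.or_eq_true] at h1 h2
  obtain ⟨hd, h1⟩ := h1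
  have hacd : B a c d := (hR a c d ha hc hd).1 h1
  have habd := hB.left h hacd
  have hbcd := hB.right h hacd
  -- A row has 16 bits, so row `256` begins at bit `4096`, where the second block starts.
  have e1 : ∀ x y z, code2 (Nat.add (nat_lit 256) (code2 x y)) z = 4096 + code x y z := by
    intro x y z
    simp only [code2_eq, code_eq, Nat.add_eq]
    omega
  rw [e1, e1] at h2
  rcases h2 with (⟨-, h2⟩ | ⟨-, h2⟩) | (⟨-, h2⟩ | ⟨-, h2⟩)
  · exact hB.not_swap habd ((hR b a d hb ha hd).1 h2)
  · exact hB.not_swap hbcd ((hR c b d hc hb hd).1 h2)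
  · exact hB.not_swap' habd ((hR a d b ha hd hb).2 h2)
  · exact hB.not_swap' hbcd ((hR b d c hb hd hc).2 h2)

theorem quickL_sound (hB : IsBetweenness B) {R : ℕ} (hR : Holds B R) {l : List ℕ}
    (h : Ordered B l) : quickL R l = false := by
  have h2 : ∀ a b (l : List ℕ), (∀ c ∈ l, B a b c) → quickL2 R a b l = false := by
    intro a b l hl
    induction l with
    | nil => rfl
    | cons c l ih =>
      have hc := hl c (by simp)
      change cond (quick1 R a b c) true (cond (quick1 R c b a) true (quickL2 R a b l)) = false
      rw [quick1_sound hB hR hc, quick1_sound hB hR (hB.symm hc), ih fun c hc => hl c (by simp [hc])]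
      rfl
  have h1 : ∀ a (l : List ℕ), (∀ b c, [b, c].Sublist l → B a b c) → quickL1 R a l = false := by
    intro a l hl
    induction l with
    | nil => rfl
    | cons b l ih =>
      change cond (quickL2 R a b l) true (quickL1 R a l) = false
      rw [h2 a b l fun c hc => hl b c (List.Sublist.cons_cons b (by simpa using hc)),
        ih fun b' c' hs => hl b' c' (hs.cons b)]
      rfl
  induction l with
  | nil => rfl
  | cons a l ih =>
    change cond (quickL1 R a l) true (quickL R l) = false
    rw [h1 a l fun b c hs => h a b c (hs.cons_cons a), ih (h.sublist (List.sublist_cons_self a l))]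
    rfl

theorem quick_sound (hB : IsBetweenness B) {R : ℕ} (hR : Holds B R) {as : List Arc}
    (h : ∀ a ∈ as, Ordered B a.pts) : quick R as = false := by
  induction as with
  | nil => rfl
  | cons a as ih =>
    change cond (quickL R a.pts) true (quick R as) = false
    rw [quickL_sound hB hR (h a (by simp)), ih fun a ha => h a (by simp [ha])]
    rfl

theorem add1_sound (hB : IsBetweenness B) {R a b c : ℕ} {k : ℕ → Bool} (hR : Holds B R)
    (h : B a b c) (hk : add1 R a b c k = true) : ∃ R', Holds B R' ∧ k R' = true := by
  unfold add1 at hk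
  cases hb : bit R (code a b c) <;> rw [hb] at hk
  · exact addF_sound hR (holds_fact hB h) (fails_conf hB h) hk
  · exact ⟨R, hR, hk⟩

theorem loopD_sound (hB : IsBetweenness B) {a b c : ℕ} (h : B a b c) {k : ℕ → Bool} {l : List ℕ}
    (hl : ∀ d ∈ l, d < 16) : ∀ {R : ℕ}, Holds B R → loopD a b c k l R = true →
      ∃ R', Holds B R' ∧ k R' = true := by
  induction l with
  | nil => exact fun {R} hR hk => ⟨R, hR, hk⟩
  | cons d l ih =>
    intro R hR hk
    have ih' := fun {R} => @ih (fun d hd => hl d (by simp [hd])) R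
    change cond (bit R (code a c d)) (cond (cond (Nat.beq a d) true (Nat.beq b d)) true
      (add1 R a b d fun R' => add1 R' b c d (loopD a b c k l))) (loopD a b c k l R) = true at hk
    cases hb : bit R (code a c d) <;> rw [hb] at hk
    · exact ih' hR hk
    · rw [bit_eq] at hb
      obtain ⟨ha, hb', hc⟩ := hB.lt h
      have hacd : B a c d := (hR a c d ha hc (hl d (by simp))).1 hb
      have h1 : Nat.beq a d = false := by
        by_contra h'
        rw [Bool.not_eq_false, Nat.beq_eq] at h'
        subst h'
        exact hB.ne hacd
      have h2 : Nat.beq b d = false := by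
        by_contra h'
        rw [Bool.not_eq_false, Nat.beq_eq] at h'
        subst h'
        exact hB.not_swap' h hacd
      rw [h1, h2, cond_true, cond_false, cond_false] at hk
      obtain ⟨R', hR', hk⟩ := add1_sound hB hR (hB.left h hacd) hk
      obtain ⟨R'', hR'', hk⟩ := add1_sound hB hR' (hB.right h hacd) hk
      exact ih' hR'' hk

theorem loopC_sound (hB : IsBetweenness B) {P : List ℕ} (hP : ∀ d ∈ P, d < 16) {a b : ℕ}
    (ha : a < 16) (hb : b < 16) {k : ℕ → Bool} {l : List ℕ} (hl : ∀ d ∈ l, d < 16) :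
    ∀ {R : ℕ}, Holds B R → loopC P a b k l R = true → ∃ R', Holds B R' ∧ k R' = true := by
  induction l with
  | nil => exact fun {R} hR hk => ⟨R, hR, hk⟩
  | cons c l ih =>
    intro R hR hk
    have ih' := fun {R} => @ih (fun d hd => hl d (by simp [hd])) R
    change cond (bit R (code a b c)) (loopD a b c (loopC P a b k l) P R) (loopC P a b k l R) = true
      at hk
    cases h : bit R (code a b c) <;> rw [h] at hk
    · exact ih' hR hk
    · rw [bit_eq] at h
      obtain ⟨R', hR', hk⟩ := loopD_sound hB ((hR a b c ha hb (hl c (by simp))).1 h) hP hR hk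
      exact ih' hR' hk

theorem loopB_sound (hB : IsBetweenness B) {P : List ℕ} (hP : ∀ d ∈ P, d < 16) {a : ℕ}
    (ha : a < 16) {k : ℕ → Bool} {l : List ℕ} (hl : ∀ d ∈ l, d < 16) :
    ∀ {R : ℕ}, Holds B R → loopB P a k l R = true → ∃ R', Holds B R' ∧ k R' = true := by
  induction l with
  | nil => exact fun {R} hR hk => ⟨R, hR, hk⟩
  | cons b l ih =>
    intro R hR hk
    have ih' := fun {R} => @ih (fun d hd => hl d (by simp [hd])) R
    change cond (Nat.beq (row R (code2 a b)) (nat_lit 0)) (loopB P a k l R)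
      (loopC P a b (loopB P a k l) P R) = true at hk
    cases h : Nat.beq (row R (code2 a b)) (nat_lit 0) <;> rw [h] at hk
    · obtain ⟨R', hR', hk⟩ := loopC_sound hB hP ha (hl b (by simp)) hP hR hk
      exact ih' hR' hk
    · exact ih' hR hk

theorem loopA_sound (hB : IsBetweenness B) {P : List ℕ} (hP : ∀ d ∈ P, d < 16) {k : ℕ → Bool}
    {l : List ℕ} (hl : ∀ d ∈ l, d < 16) :
    ∀ {R : ℕ}, Holds B R → loopA P k l R = true → ∃ R', Holds B R' ∧ k R' = true := by
  induction l with
  | nil => exact fun {R} hR hk => ⟨R, hR, hk⟩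
  | cons a l ih =>
    intro R hR hk
    obtain ⟨R', hR', hk⟩ := loopB_sound hB hP (hl a (by simp)) hP hR hk
    exact ih (fun d hd => hl d (by simp [hd])) hR' hk

/-- Running out of rounds gives `false`, so `true` could only come from a contradiction, and facts
that hold produce none. -/
theorem rounds_sound (hB : IsBetweenness B) {P : List ℕ} (hP : ∀ d ∈ P, d < 16) (n : ℕ) :
    ∀ {R : ℕ}, Holds B R → rounds P n R = false := by
  induction n with
  | zero => exact fun _ => rfl
  | succ n ih =>
    intro R hR
    by_contra h
    rw [Bool.not_eq_false] at h
    obtain ⟨R', hR', h'⟩ := loopA_sound hB hP hP hR h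
    rw [ih hR'] at h'
    exact Bool.false_ne_true h'

end Search

/-! ### Distribution of the ends of paths over the edges. -/

namespace Search

/-- `u` and `v` are consecutive in the list `l`. -/
def Consec (u v : ℕ) (l : List ℕ) : Prop := [u, v] <:+: l ∨ [v, u] <:+: l

/-- The path `t` continues from its end `u` to the point `e`. -/
def Arc.EndAt (t : Arc) (u e : ℕ) : Prop :=
  (t.core.head? = some u ∧ t.pre = [e]) ∨ (t.core.getLast? = some u ∧ t.post = [e])

/-- The path `s` is the path `t` without some of the points outside of the core. -/
def Arc.Le (s t : Arc) : Prop :=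
  s.core = t.core ∧ (s.pre = [] ∨ s.pre = t.pre) ∧ (s.post = [] ∨ s.post = t.post)

/-- The points of the path `t` lie in this order. -/
structure Arc.Valid (B : ℕ → ℕ → ℕ → Prop) (t : Arc) : Prop where
  ordered : Ordered B t.pts
  nodup : t.pts.Nodup
  pre_le : t.pre.length ≤ 1
  post_le : t.post.length ≤ 1

theorem Arc.Le.sublist {s t : Arc} (h : s.Le t) : s.pts.Sublist t.pts := by
  obtain ⟨h1, h2, h3⟩ := h
  refine List.Sublist.append (List.Sublist.append ?_ (h1 ▸ List.Sublist.refl _)) ?_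
  · rcases h2 with h | h <;> simp [h]
  · rcases h3 with h | h <;> simp [h]

theorem headIs_iff {u : ℕ} {l : List ℕ} : headIs u l = true ↔ l.head? = some u := by
  cases l with
  | nil => simp [headIs]
  | cons a l =>
    change Nat.beq a u = true ↔ _
    simp

theorem lastIs_iff {u : ℕ} {l : List ℕ} : lastIs u l = true ↔ l.getLast? = some u := by
  rw [lastIs, headIs_iff, List.head?_reverse]

variable {B : ℕ → ℕ → ℕ → Prop}

/-- `attach` walks along the paths with a reversed prefix; the correspondence with the actual paths
has to survive when the two parts are joined again. -/
theorem forall₂_reverseAux {α β : Type*} {r : α → β → Prop} {d : List α} {D : List β}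
    (h : List.Forall₂ r d D) : ∀ {l : List α} {L : List β}, List.Forall₂ r l L →
      List.Forall₂ r (d.reverseAux l) (D.reverseAux L) := by
  induction h with
  | nil => exact fun h => h
  | cons h _ ih => exact fun h' => ih (.cons h h')

theorem exists_of_forall₂ {α β : Type*} {r : α → β → Prop} {l : List α} {L : List β}
    (h : List.Forall₂ r l L) {a : α} (ha : a ∈ l) : ∃ b ∈ L, r a b := by
  induction h with
  | nil => simp at ha
  | @cons a' b l L h _ ih =>
    rcases List.mem_cons.1 ha with rfl | ha
    · exact ⟨b, by simp, h⟩
    · obtain ⟨c, hc, hac⟩ := ih ha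
      exact ⟨c, by simp [hc], hac⟩

/-- The state `as` is a shadow of the actual paths, in which some ends are still unknown. As the
actual path `t` continues from `u` to `e`, prolonging its shadow is one of the possibilities that
are tried, and it adds only true facts. All possibilities have to succeed, so this one does. -/
theorem attach_sound (hB : IsBetweenness B) {u e : ℕ} {k : List Arc → ℕ → Bool} {R : ℕ}
    (hR : Holds B R) {t : Arc} (ht : t.EndAt u e) {as Ls : List Arc}
    (hs : List.Forall₂ Arc.Le as Ls) : ∀ {done Ds : List Arc}, List.Forall₂ Arc.Le done Ds →
      t ∈ Ls → (∀ t ∈ Ls, t.Valid B) → attach u e k R done as = true →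
      ∃ as' R', List.Forall₂ Arc.Le as' (Ds.reverseAux Ls) ∧ Holds B R' ∧ k as' R' = true := by
  induction hs with
  | nil => intro done Ds _ h; simp at h
  | @cons s t' as Ls hst hs ih =>
    intro done Ds hd htL hv hk
    change cond (cond (cond (headIs u s.core) (cond (cond (emp s.pre) true (headIs e s.pre))
          (cond (headIs e s.post) false true) false) false)
          (addF R (masks1 fact e (s.core ++ s.post)) (masks1 conf e (s.core ++ s.post))
            (k (done.reverseAux (⟨[e], s.core, s.post⟩ :: as)))) true)
        (cond (cond (cond (lastIs u s.core) (cond (cond (emp s.post) true (headIs e s.post))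
              (cond (headIs e s.pre) false true) false) false)
            (addF R (masks1 fact e (s.core.reverse ++ s.pre))
              (masks1 conf e (s.core.reverse ++ s.pre))
              (k (done.reverseAux (⟨s.pre, s.core, [e]⟩ :: as)))) true)
          (attach u e k R (s :: done) as) false) false = true at hk
    simp only [Bool.cond_false_right, Bool.and_eq_true] at hk
    obtain ⟨h1, h2, h3⟩ := hk
    rcases List.mem_cons.1 htL with rfl | htL
    · obtain ⟨hc, hpre, hpost⟩ := hst
      have hV := hv t (by simp)
      have hnd := hV.nodup
      rcases ht with ⟨hh, he⟩ | ⟨hh, he⟩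
      · have g1 : headIs u s.core = true := by rw [headIs_iff, hc, hh]
        have g2 : cond (emp s.pre) true (headIs e s.pre) = true := by
          rcases hpre with h | h <;> rw [h]
          · rfl
          · rw [he]
            simp [emp, headIs_iff]
        -- `e` is at the beginning of the actual path, which repeats no point, so it cannot also be
        -- at its end.
        have g3 : headIs e s.post = false := by
          by_contra hne
          rw [Bool.not_eq_false, headIs_iff] at hne
          rcases hpost with h | h <;> rw [h] at hne
          · simp at hne
          · have : e ∈ t.post := List.mem_of_mem_head? (by simp [hne])
            rw [Arc.pts, he] at hnd
            simp [this] at hnd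
        rw [g1, g2, g3] at h1
        have hO : Ordered B (e :: (s.core ++ s.post)) := by
          refine hV.ordered.sublist ?_
          rw [Arc.pts, he, hc]
          simp only [List.cons_append]
          refine List.Sublist.cons_cons _ (List.Sublist.append (List.Sublist.refl _) ?_)
          rcases hpost with h | h <;> simp [h]
        obtain ⟨R', hR', hk⟩ := addF_sound hR (holds_masks1 hB hO) (fails_masks1 hB hO) h1
        refine ⟨_, R', forall₂_reverseAux hd (.cons ?_ hs), hR', hk⟩
        exact ⟨hc, Or.inr he.symm, hpost⟩
      · have g1 : lastIs u s.core = true := by rw [lastIs_iff, hc, hh]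
        have g2 : cond (emp s.post) true (headIs e s.post) = true := by
          rcases hpost with h | h <;> rw [h]
          · rfl
          · rw [he]
            simp [emp, headIs_iff]
        have g3 : headIs e s.pre = false := by
          by_contra hne
          rw [Bool.not_eq_false, headIs_iff] at hne
          rcases hpre with h | h <;> rw [h] at hne
          · simp at hne
          · have : e ∈ t.pre := List.mem_of_mem_head? (by simp [hne])
            rw [Arc.pts, he, List.nodup_append] at hnd
            exact hnd.2.2 e (by simp [this]) e (by simp) rfl
        rw [g1, g2, g3] at h2
        have hO : Ordered B (e :: (s.core.reverse ++ s.pre)) := by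
          refine (hV.ordered.reverse hB).sublist ?_
          rw [Arc.pts, he, hc]
          simp only [List.reverse_append, List.reverse_cons, List.reverse_nil, List.nil_append,
            List.singleton_append]
          refine List.Sublist.cons_cons _ (List.Sublist.append (List.Sublist.refl _) ?_)
          rcases hpre with h | h
          · simp [h]
          · rw [h]
            have := hV.pre_le
            rcases hp : t.pre with _ | ⟨x, _ | ⟨y, l⟩⟩
            · simp
            · simp
            · simp [hp] at this
        obtain ⟨R', hR', hk⟩ := addF_sound hR (holds_masks1 hB hO) (fails_masks1 hB hO) h2
        refine ⟨_, R', forall₂_reverseAux hd (.cons ?_ hs), hR', hk⟩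
        exact ⟨hc, hpre, Or.inr he.symm⟩
    · exact @ih (s :: done) (t' :: Ds) (.cons hst hd) htL (fun t ht => hv t (by simp [ht])) h3

theorem assign_sound (hB : IsBetweenness B) {fin : List ℕ → List Arc → ℕ → Bool} {M : ℕ}
    {Ls : List Arc} (hv : ∀ t ∈ Ls, t.Valid B) {es : List (ℕ × ℕ × ℕ)} :
    ∀ {P : List ℕ} {as : List Arc} {R : ℕ}, (∀ t ∈ es, t.2.2 < 16) →
      (∀ t ∈ es, M.testBit (code2 t.1 t.2.1) = true ∨
        ((∃ a ∈ Ls, a.EndAt t.1 t.2.2) ∧ ∃ a ∈ Ls, a.EndAt t.2.1 t.2.2)) →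
      (∀ x ∈ P, x < 16) → List.Forall₂ Arc.Le as Ls → Holds B R →
      assign fin M es P as R = true →
      ∃ P' as' R', fin P' as' R' = true ∧ (∀ x ∈ P', x < 16) ∧ List.Forall₂ Arc.Le as' Ls ∧
        Holds B R' := by
  induction es with
  | nil => exact fun {P as R} _ _ hP hs hR h => ⟨P, as, R, h, hP, hs, hR⟩
  | cons t es ih =>
    intro P as R he hc hP hs hR h
    have he' : ∀ t ∈ es, t.2.2 < 16 := fun t ht => he t (by simp [ht])
    have hc' := fun t (ht : t ∈ es) => hc t (by simp [ht])
    change cond (bit M (code2 t.1 t.2.1)) (assign fin M es P as R)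
      (attach t.1 t.2.2 (fun as' R' => attach t.2.1 t.2.2 (assign fin M es (t.2.2 :: P)) R' [] as')
        R [] as) = true at h
    cases hb : bit M (code2 t.1 t.2.1) <;> rw [hb] at h
    · rw [bit_eq] at hb
      rw [cond_false] at h
      rcases hc t (by simp) with h' | ⟨⟨a, ha, ha'⟩, b, hb, hb'⟩
      · rw [hb] at h'
        exact absurd h' Bool.false_ne_true
      · obtain ⟨as', R', hs', hR', h⟩ := attach_sound hB hR ha' hs .nil ha hv h
        obtain ⟨as', R', hs', hR', h⟩ := attach_sound hB hR' hb' hs' .nil hb hv h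
        refine ih he' hc' ?_ hs' hR' h
        intro x hx
        rcases List.mem_cons.1 hx with rfl | hx
        exacts [he t (by simp), hP x hx]
    · exact ih he' hc' hP hs hR h

theorem finish_sound (hB : IsBetweenness B) {good : List Arc → Bool} {P : List ℕ} {as Ls : List Arc}
    {R : ℕ} (hP : ∀ x ∈ P, x < 16) (hs : List.Forall₂ Arc.Le as Ls) (hv : ∀ t ∈ Ls, t.Valid B)
    (hR : Holds B R) (h : finish good P as R = true) : good as = true := by
  have hO : ∀ a ∈ as, Ordered B a.pts := by
    intro a ha
    obtain ⟨t, ht, hat⟩ := exists_of_forall₂ hs ha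
    exact (hv t ht).ordered.sublist hat.sublist
  rwa [finish, quick_sound hB hR hO, rounds_sound hB hP 6 hR] at h

theorem leaf_sound (hB : IsBetweenness B) {G : Graph} {good : List Arc → Bool} {P : List ℕ}
    {as Ls : List Arc} {M R : ℕ} (hv : ∀ t ∈ Ls, t.Valid B) (he : ∀ t ∈ G.E, t.2.2 < 16)
    (hc : ∀ t ∈ G.E, M.testBit (code2 t.1 t.2.1) = true ∨
        ((∃ a ∈ Ls, a.EndAt t.1 t.2.2) ∧ ∃ a ∈ Ls, a.EndAt t.2.1 t.2.2))
    (hP : ∀ x ∈ P, x < 16) (hs : List.Forall₂ Arc.Le as Ls) (hR : Holds B R)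
    (h : leaf G P good as M R = true) :
    ∃ as', List.Forall₂ Arc.Le as' Ls ∧ good as' = true := by
  have hO : ∀ a ∈ as, Ordered B a.pts := by
    intro a ha
    obtain ⟨t, ht, hat⟩ := exists_of_forall₂ hs ha
    exact (hv t ht).ordered.sublist hat.sublist
  rw [leaf, quick_sound hB hR hO] at h
  obtain ⟨P', as', R', h, hP', hs', hR'⟩ := assign_sound hB hv he hc hP hs hR h
  exact ⟨as', hs', finish_sound hB hP' hs' hv hR' h⟩

end Search

/-! ### Counting edges and ends of paths at a vertex. -/

namespace Search

variable {B : ℕ → ℕ → ℕ → Prop}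

/-- The members of `l` next to `u`. -/
def around (u : ℕ) : List ℕ → List ℕ
  | x :: y :: l => (if x = u then [y] else []) ++ (if y = u then [x] else []) ++ around u (y :: l)
  | _ => []

theorem around_of_notMem {u : ℕ} : ∀ {l : List ℕ}, u ∉ l → around u l = []
  | [], _ => rfl
  | [_], _ => rfl
  | x :: y :: l, h => by
    have hx : x ≠ u := fun h' => h (by simp [h'])
    have hy : y ≠ u := fun h' => h (by simp [h'])
    rw [around, around_of_notMem (l := y :: l) (fun h' => h (by simp [List.mem_cons.1 h']))]
    simp [hx, hy]

/-- A list without repetitions passes `u` at most once. The bound for lists that start at `u`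
carries the induction. -/
theorem length_around {u : ℕ} : ∀ {l : List ℕ}, l.Nodup →
    (around u l).length ≤ 2 ∧ (l.head? = some u → (around u l).length ≤ 1)
  | [], _ => by simp [around]
  | [_], _ => by simp [around]
  | x :: y :: l, h => by
    obtain ⟨h1, h2⟩ := length_around (u := u) (List.nodup_cons.1 h).2
    by_cases hx : x = u
    · subst hx
      rw [around, around_of_notMem (List.nodup_cons.1 h).1]
      have : y ≠ x := fun h' => by simp [h'] at h
      simp [this]
    · by_cases hy : y = u
      · have := h2 (by simp [hy])
        simp only [around, hx, hy, if_true, if_false, List.length_append]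
        subst hy
        simp at this ⊢
        refine ⟨by omega, fun h => absurd h hx⟩
      · simp [around, hx, hy] at h1 ⊢
        exact h1

theorem mem_around {u x : ℕ} : ∀ {l : List ℕ}, Consec u x l → x ∈ around u l
  | [], h => by simp [Consec] at h
  | [_], h => by
    rcases h with h | h <;> simpa using h.length_le
  | a :: b :: l, h => by
    have key : ∀ p q, [p, q] <:+: a :: b :: l → (p = a ∧ q = b) ∨ [p, q] <:+: b :: l := by
      intro p q hpq
      rcases List.infix_cons_iff.1 hpq with h | h
      · obtain ⟨r, hr⟩ := h
        simp at hr
        exact Or.inl ⟨hr.1, hr.2.1⟩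
      · exact Or.inr h
    simp only [around, List.mem_append]
    rcases h with h | h
    · rcases key _ _ h with ⟨rfl, rfl⟩ | h
      · simp
      · exact Or.inr (mem_around (Or.inl h))
    · rcases key _ _ h with ⟨rfl, rfl⟩ | h
      · simp
      · exact Or.inr (mem_around (Or.inr h))

theorem Consec.mono {u v : ℕ} {l l' : List ℕ} (h : Consec u v l) (h' : l <:+: l') :
    Consec u v l' := h.imp (fun h => h.trans h') fun h => h.trans h'

theorem Arc.core_infix (t : Arc) : t.core <:+: t.pts := ⟨t.pre, t.post, rfl⟩

theorem Arc.EndAt.consec {t : Arc} {u e : ℕ} (h : t.EndAt u e) : Consec u e t.pts := by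
  rcases h with ⟨h1, h2⟩ | ⟨h1, h2⟩
  · obtain ⟨l, hl⟩ := List.head?_eq_some_iff.1 h1
    exact Or.inr ⟨[], l ++ t.post, by simp [Arc.pts, h2, hl]⟩
  · obtain ⟨l, hl⟩ := List.getLast?_eq_some_iff.1 h1
    exact Or.inl ⟨t.pre ++ l, [], by simp [Arc.pts, h2, hl]⟩

/-- The number of ends `u` of a list. -/
def endCount (u : ℕ) (l : List ℕ) : ℕ :=
  (if l.head? = some u then 1 else 0) + if l.getLast? = some u then 1 else 0

/-- The points to which the path `t` continues from its end `u`. -/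
def Arc.beyond (t : Arc) (u : ℕ) : List ℕ :=
  (if t.core.head? = some u then t.pre else []) ++ if t.core.getLast? = some u then t.post else []

theorem Arc.Valid.length_beyond {t : Arc} (h : t.Valid B) (u : ℕ) :
    (t.beyond u).length ≤ endCount u t.core := by
  have := h.pre_le
  have := h.post_le
  rw [Arc.beyond, endCount, List.length_append]
  split_ifs <;> simp <;> omega

theorem Arc.EndAt.mem_beyond {t : Arc} {u e : ℕ} (h : t.EndAt u e) : e ∈ t.beyond u := by
  rcases h with ⟨h1, h2⟩ | ⟨h1, h2⟩ <;> simp [Arc.beyond, h1, h2]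

theorem endSum_eq {l : List ℕ} (h : ∀ x ∈ l, x < 6) :
    endSum l = endCount 0 l + 16 * endCount 1 l + 256 * endCount 2 l + 4096 * endCount 3 l +
      65536 * endCount 4 l + 1048576 * endCount 5 l := by
  rcases List.eq_nil_or_concat l with rfl | ⟨l', b, rfl⟩
  · rfl
  · have hb : b < 6 := h b (by simp)
    have key : ∀ a < 6, ∀ b < 6, Nat.add (pw (Nat.mul (nat_lit 4) a)) (pw (Nat.mul (nat_lit 4) b)) =
        ((if a = 0 then 1 else 0) + if b = 0 then 1 else 0) +
        16 * ((if a = 1 then 1 else 0) + if b = 1 then 1 else 0) +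
        256 * ((if a = 2 then 1 else 0) + if b = 2 then 1 else 0) +
        4096 * ((if a = 3 then 1 else 0) + if b = 3 then 1 else 0) +
        65536 * ((if a = 4 then 1 else 0) + if b = 4 then 1 else 0) +
        1048576 * ((if a = 5 then 1 else 0) + if b = 5 then 1 else 0) := by
      decide
    cases l' with
    | nil => simpa [endSum, endCount] using key b hb b hb
    | cons a l =>
      have ha : a < 6 := h a (by simp)
      have hl : (l ++ [b]).getLastD a = b := by simp [List.getLastD_eq_getLast?]
      have hl' : (a :: (l ++ [b])).getLast? = some b := by
        rw [← List.cons_append, List.getLast?_append]; rfl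
      have e : endSum (a :: (l ++ [b])) = Nat.add (pw (Nat.mul (nat_lit 4) a))
        (pw (Nat.mul (nat_lit 4) ((l ++ [b]).getLastD a))) := rfl
      rw [List.concat_eq_append, List.cons_append]
      simp only [e, hl, key a ha b hb, endCount, hl', List.head?_cons,
        Option.some.injEq]

def endCounts (u : ℕ) (as : List Arc) : ℕ := (as.map fun a => endCount u a.core).sum

theorem endCounts_le (u : ℕ) (as : List Arc) : endCounts u as ≤ 2 * as.length := by
  induction as with
  | nil => simp [endCounts]
  | cons a as ih =>
    have : endCount u a.core ≤ 2 := by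
      rw [endCount]
      split_ifs <;> simp
    simp [endCounts] at ih ⊢
    omega

/-- At most seven paths have at most fourteen ends, so no hexadecimal digit overflows. -/
theorem digit_endSums {as : List Arc} (h : ∀ a ∈ as, ∀ x ∈ a.core, x < 6) (hl : as.length ≤ 7)
    {u : ℕ} (hu : u < 6) :
    Nat.land (Nat.shiftRight (endSums as) (Nat.mul (nat_lit 4) u)) (nat_lit 15) =
      endCounts u as := by
  have key : endSums as = endCounts 0 as + 16 * endCounts 1 as + 256 * endCounts 2 as +
      4096 * endCounts 3 as + 65536 * endCounts 4 as + 1048576 * endCounts 5 as := by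
    clear hl
    induction as with
    | nil => rfl
    | cons a as ih =>
      have h1 := endSum_eq (h a (by simp))
      have h2 := ih fun a ha => h a (by simp [ha])
      have e : endSums (a :: as) = endSum a.core + endSums as := rfl
      simp only [endCounts, List.map_cons, List.sum_cons] at h2 ⊢
      rw [e, h1, h2]
      ring
  have hlt := fun u => endCounts_le u as
  have e : Nat.land (Nat.shiftRight (endSums as) (Nat.mul (nat_lit 4) u)) (nat_lit 15) =
      endSums as / 2 ^ (4 * u) % 16 := by
    rw [← Nat.shiftRight_eq_div_pow]
    exact Nat.and_two_pow_sub_one_eq_mod _ 4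
  rw [e, key]
  have h0 := hlt 0
  have h1 := hlt 1
  have h2 := hlt 2
  have h3 := hlt 3
  have h4 := hlt 4
  have h5 := hlt 5
  interval_cases u <;> norm_num <;> omega

theorem popc_eq (x : ℕ) : popc x = ((Finset.range 6).filter fun v => x.testBit v = true).card := by
  have h : ∀ i, Nat.land (Nat.shiftRight x i) 1 = if x.testBit i = true then 1 else 0 := by
    intro i
    rw [← bit_eq, bit]
    change (x >>> i) &&& 1 = if Nat.beq ((x >>> i) &&& 1) 1 = true then 1 else 0
    rw [Nat.and_one_is_mod]
    rcases Nat.mod_two_eq_zero_or_one (x >>> i) with h | h <;> rw [h] <;> rfl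
  rw [Finset.card_filter]
  simp only [Finset.sum_range_succ, Finset.sum_range_zero, ← h]
  simp only [popc, Nat.add_eq]
  have : Nat.shiftRight x 0 = x := rfl
  rw [this]
  ring

/-- Consistency of the data of a graph. -/
structure Graph.Wf (G : Graph) : Prop where
  lt_vertex : ∀ u ∈ G.V, u.1 < 6
  edge : ∀ u ∈ G.V, ∀ v < 6, u.2.testBit v = true →
    ∃ t ∈ G.E, (t.1 = u.1 ∧ t.2.1 = v) ∨ (t.1 = v ∧ t.2.1 = u.1)
  inj : ∀ t ∈ G.E, ∀ t' ∈ G.E, t.2.2 = t'.2.2 → t = t'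
  -- Labels above `5` cannot be vertices; the alternative serves the graphs with fewer than six
  -- vertices, whose labels may start lower.
  ne : ∀ t ∈ G.E, 5 < t.2.2 ∨ ∀ t' ∈ G.E, t.2.2 ≠ t'.1 ∧ t.2.2 ≠ t'.2.1
  lt : ∀ t ∈ G.E, t.2.2 < 16

/-- Every edge is in the core of a path, or two paths meet in its interior. -/
def Covers (G : Graph) (L : List Arc) : Prop :=
  ∀ t ∈ G.E, (∃ a ∈ L, Consec t.1 t.2.1 a.core) ∨
    ((∃ a ∈ L, a.EndAt t.1 t.2.2) ∧ ∃ a ∈ L, a.EndAt t.2.1 t.2.2)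

/-- Pigeonhole principle: no `x` is related to two members of `D`, so choosing a related `x` for
each member is injective. -/
theorem card_le_of_rel {D : Finset ℕ} {l : List ℕ} (r : ℕ → ℕ → Prop)
    (h : ∀ v ∈ D, ∃ x ∈ l, r v x) (hr : ∀ v ∈ D, ∀ w ∈ D, ∀ x, r v x → r w x → v = w) :
    D.card ≤ l.length := by
  choose! f hf hfr using h
  calc D.card ≤ l.toFinset.card := Finset.card_le_card_of_injOn f
        (fun v hv => by simpa using hf v hv)
        (fun v hv w hw hvw => hr v hv w hw (f v) (hfr v hv) (hvw ▸ hfr w hw))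
    _ ≤ l.length := l.toFinset_card_le

/-- Each edge at `u` outside of the chosen cores is either a part of a remaining path or entered
from `u` by some path. Different edges use different places, and a remaining path has at most two
neighbors of `u`, so the count in `enough` never fails for an actual cover. -/
theorem enough_sound {G : Graph} (hG : G.Wf) {k M : ℕ} {as Lc Lr : List Arc}
    (hs : List.Forall₂ Arc.Le as Lc) (hk : Lr.length = k) (hlen : as.length ≤ 7)
    (hc : ∀ a ∈ Lc, ∀ x ∈ a.core, x < 6) (hv : ∀ t ∈ Lc ++ Lr, t.Valid B)
    (hM : ∀ a ∈ Lc, ∀ u v, Consec u v a.core → M.testBit (code2 u v) = true)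
    (hcov : Covers G (Lc ++ Lr)) {r : Bool} (h : enough G.V k M as r = true) : r = true := by
  rw [enough, force_eq] at h
  have hc' : ∀ a ∈ as, ∀ x ∈ a.core, x < 6 := by
    intro a ha
    obtain ⟨t, ht, hat⟩ := exists_of_forall₂ hs ha
    rw [hat.1]
    exact hc t ht
  have key : ∀ u ∈ G.V, Nat.ble (popc (Nat.xor u.2 (Nat.land u.2 (row M u.1))))
      (Nat.add (Nat.land (Nat.shiftRight (endSums as) (Nat.mul (nat_lit 4) u.1)) (nat_lit 15))
        (Nat.mul (nat_lit 2) k)) = true := by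
    intro u hu
    rw [Nat.ble_eq, digit_endSums hc' hlen (hG.lt_vertex u hu), popc_eq]
    -- The available places at `u`: the points beyond the ends of the chosen paths, and all points
    -- next to `u` on the remaining ones.
    let big : List ℕ := (Lc.flatMap fun t => t.beyond u.1) ++ Lr.flatMap fun t => around u.1 t.pts
    have hbig : big.length ≤ endCounts u.1 as + 2 * k := by
      have h1 : (Lc.flatMap fun t => t.beyond u.1).length ≤ endCounts u.1 as := by
        have hv' : ∀ t ∈ Lc, t.Valid B := fun t ht => hv t (by simp [ht])
        clear h hlen hc hc' hM hcov hv big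
        induction hs with
        | nil => simp
        | @cons s t as Lc hst _ ih =>
          have := ih fun t ht => hv' t (by simp [ht])
          have := (hv' t (by simp)).length_beyond u.1
          rw [← hst.1] at this
          simp [endCounts] at *
          omega
      have h2 : (Lr.flatMap fun t => around u.1 t.pts).length ≤ 2 * k := by
        have hv' : ∀ t ∈ Lr, t.Valid B := fun t ht => hv t (by simp [ht])
        clear h hlen hc hc' hM hcov hv big
        subst hk
        induction Lr with
        | nil => simp
        | cons t Lr ih =>
          have := ih fun t ht => hv' t (by simp [ht])
          have := (length_around (u := u.1) (hv' t (by simp)).nodup).1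
          simp at *
          omega
      simp only [big, List.length_append]
      omega
    -- An edge from `u` to `v` is witnessed by the vertex `v` itself or by the label of the edge.
    -- Labels differ from vertices and from each other, so the witness determines `v`.
    refine le_trans (card_le_of_rel (l := big) (fun v x => x = v ∧ (∃ t ∈ G.E, (t.1 = u.1 ∧ t.2.1 = v) ∨ (t.1 = v ∧ t.2.1 = u.1)) ∨ ∃ t ∈ G.E,
      ((t.1 = u.1 ∧ t.2.1 = v) ∨ (t.1 = v ∧ t.2.1 = u.1)) ∧ t.2.2 = x) ?_ ?_) hbig
    · intro v hv
      simp only [Finset.mem_filter, Finset.mem_range] at hv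
      obtain ⟨hv6, hbit⟩ := hv
      have hbit' : u.2.testBit v = true ∧ M.testBit (code2 u.1 v) = false := by
        have : (u.2 ^^^ (u.2 &&& row M u.1)).testBit v = true := hbit
        rw [Nat.testBit_xor, Nat.testBit_and, testBit_row] at this
        have h16 : v < 16 := by omega
        simp only [h16, decide_true, Bool.true_and] at this
        revert this
        cases u.2.testBit v <;> cases M.testBit (code2 u.1 v) <;> simp
      obtain ⟨t, ht, htu⟩ := hG.edge u hu v hv6 hbit'.1
      have hends : ∀ a ∈ Lc ++ Lr, a.EndAt u.1 t.2.2 → ∃ x ∈ big, x = t.2.2 := by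
        intro a ha hau
        rcases List.mem_append.1 ha with ha | ha
        · exact ⟨t.2.2, List.mem_append_left _ (List.mem_flatMap.2 ⟨a, ha, hau.mem_beyond⟩), rfl⟩
        · exact ⟨t.2.2, List.mem_append_right _
            (List.mem_flatMap.2 ⟨a, ha, mem_around hau.consec⟩), rfl⟩
      have hcons : ∀ a ∈ Lc ++ Lr, Consec u.1 v a.core → ∃ x ∈ big, x = v := by
        intro a ha hau
        rcases List.mem_append.1 ha with ha | ha
        · have := hM a ha _ _ hau
          rw [hbit'.2] at this
          exact absurd this Bool.false_ne_true
        · exact ⟨v, List.mem_append_right _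
            (List.mem_flatMap.2 ⟨a, ha, mem_around (hau.mono a.core_infix)⟩), rfl⟩
      rcases hcov t ht with ⟨a, ha, hau⟩ | ⟨⟨a, ha, ha'⟩, b, hb, hb'⟩
      · have : Consec u.1 v a.core := by
          rcases htu with ⟨h1, h2⟩ | ⟨h1, h2⟩ <;> rw [h1, h2] at hau
          exacts [hau, hau.symm]
        obtain ⟨x, hx, hxv⟩ := hcons a ha this
        exact ⟨x, hx, Or.inl ⟨hxv, t, ht, htu⟩⟩
      · have : ∃ a ∈ Lc ++ Lr, a.EndAt u.1 t.2.2 := by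
          rcases htu with ⟨h1, h2⟩ | ⟨h1, h2⟩
          · exact ⟨a, ha, h1 ▸ ha'⟩
          · exact ⟨b, hb, h2 ▸ hb'⟩
        obtain ⟨c, hc, hcu⟩ := this
        obtain ⟨x, hx, hxv⟩ := hends c hc hcu
        exact ⟨x, hx, Or.inr ⟨t, ht, htu, hxv.symm⟩⟩
    · intro v hv w hw x hx hx'
      simp only [Finset.mem_filter, Finset.mem_range] at hv hw
      rcases hx with ⟨rfl, t, ht, htu⟩ | ⟨t, ht, htu, rfl⟩
      · rcases hx' with ⟨h, -⟩ | ⟨t', ht', -, h⟩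
        · exact h
        · rcases hG.ne t' ht' with h' | h'
          · omega
          · have := h' t ht
            omega
      · rcases hx' with ⟨h, t', ht', htu'⟩ | ⟨t', ht', htu', h⟩
        · rcases hG.ne t ht with h' | h'
          · omega
          · have := h' t' ht'
            omega
        · obtain rfl := hG.inj t' ht' t ht h
          omega
  clear hcov hM hv hc hs
  revert key h
  generalize G.V = us
  intro h key
  induction us with
  | nil => exact h
  | cons u us ih =>
    refine ih ?_ fun u hu => key u (by simp [hu])
    have e := key u (by simp)
    change cond (Nat.ble (popc (Nat.xor u.2 (Nat.land u.2 (row M u.1))))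
      (Nat.add (Nat.land (Nat.shiftRight (endSums as) (Nat.mul (nat_lit 4) u.1)) (nat_lit 15))
        (Nat.mul (nat_lit 2) k))) _ true = true at h
    rwa [e, cond_true] at h

end Search

/-! ### Choice of the vertex lists of the paths. -/

namespace Search

variable {B : ℕ → ℕ → ℕ → Prop}

theorem testBit_emask {u v : ℕ} : ∀ {l : List ℕ}, Consec u v l →
    (emask l).testBit (code2 u v) = true
  | [], h => by simp [Consec] at h
  | [_], h => by
    rcases h with h | h <;> simpa using h.length_le
  | a :: b :: l, h => by
    have key : ∀ p q, [p, q] <:+: a :: b :: l → (p = a ∧ q = b) ∨ [p, q] <:+: b :: l := by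
      intro p q hpq
      rcases List.infix_cons_iff.1 hpq with h | h
      · obtain ⟨r, hr⟩ := h
        simp at hr
        exact Or.inl ⟨hr.1, hr.2.1⟩
      · exact Or.inr h
    rw [emask, testBit_lor, testBit_lor, testBit_pw, testBit_pw]
    rcases h with h | h
    · rcases key _ _ h with ⟨rfl, rfl⟩ | h
      · simp
      · simp [testBit_emask (Or.inl h)]
    · rcases key _ _ h with ⟨rfl, rfl⟩ | h
      · simp
      · simp [testBit_emask (Or.inr h)]

theorem mem_compat {R : ℕ} {cs : List Core} {c : Core} (hc : c ∈ cs)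
    (h : Nat.beq (Nat.land R c.X) (nat_lit 0) = true) : c ∈ compat R cs := by
  induction cs with
  | nil => simp at hc
  | cons c' cs ih =>
    change c ∈ cond (Nat.beq (Nat.land R c'.X) (nat_lit 0)) (c' :: compat R cs) (compat R cs)
    rcases List.mem_cons.1 hc with rfl | hc
    · rw [h, cond_true]
      exact List.mem_cons_self
    · cases Nat.beq (Nat.land R c'.X) (nat_lit 0)
      · exact ih hc
      · exact List.mem_cons_of_mem _ (ih hc)

theorem compat_subset {R : ℕ} {cs : List Core} {c : Core} (hc : c ∈ compat R cs) : c ∈ cs := by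
  induction cs with
  | nil => simp [compat] at hc
  | cons c' cs ih =>
    change c ∈ cond (Nat.beq (Nat.land R c'.X) (nat_lit 0)) (c' :: compat R cs) (compat R cs) at hc
    cases h : Nat.beq (Nat.land R c'.X) (nat_lit 0) <;> rw [h] at hc
    · exact List.mem_cons_of_mem _ (ih hc)
    · rcases List.mem_cons.1 hc with rfl | hc
      · simp
      · exact List.mem_cons_of_mem _ (ih hc)

/-- Of the conjunction over all candidates, only the branch that follows the actual cover is needed.
The search meets the paths in the order of the candidates rather than of the list, hence the
permutation in the conclusion. -/
theorem select_sound (hB : IsBetweenness B) {G : Graph} (hG : G.Wf) {P : List ℕ}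
    (hP : ∀ x ∈ P, x < 16) {good : List Arc → Bool} (k : ℕ) :
    ∀ {cs : List Core} {as Lc Lr : List Arc} {M R : ℕ}, List.Forall₂ Arc.Le as Lc →
      Lr.length = k → as.length + k ≤ 7 →
      (∀ c ∈ cs, c = Core.of c.l) → (∀ t ∈ Lr, Core.of t.core ∈ cs) →
      (∀ t ∈ Lc ++ Lr, t.Valid B ∧ ∀ x ∈ t.core, x < 6) →
      (∀ a ∈ Lc, ∀ u v, Consec u v a.core → M.testBit (code2 u v) = true) →
      Covers G (Lc ++ Lr) → Holds B R →
      select G.V (leaf G P good) k cs as M R = true →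
      ∃ as' Ls, Ls.Perm (Lc ++ Lr) ∧ List.Forall₂ Arc.Le as' Ls ∧ good as' = true := by
  induction k with
  | zero =>
    intro cs as Lc Lr M R hs hk hlen hcs hr hv hM hcov hR h
    rw [List.length_eq_zero_iff] at hk
    subst hk
    rw [select] at h
    have h := enough_sound hG (Lr := []) hs rfl (by omega) (fun a ha => (hv a (by simpa using ha)).2)
      (fun t ht => (hv t ht).1) hM hcov h
    simp only [List.append_nil] at hv hcov ⊢
    obtain ⟨as', hs', hg⟩ := leaf_sound hB (fun t ht => (hv t ht).1) hG.lt
      (fun t ht => (hcov t ht).imp (fun ⟨a, ha, hau⟩ => hM a ha _ _ hau) id) hP hs hR h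
    exact ⟨as', Lc, .refl _, hs', hg⟩
  | succ k ih =>
    intro cs as Lc Lr M R hs hk hlen hcs hr hv hM hcov hR h
    rw [select] at h
    have h := enough_sound hG hs hk (by omega)
      (fun a ha => (hv a (List.mem_append_left _ ha)).2) (fun t ht => (hv t ht).1) hM hcov h
    have hr' : ∀ t ∈ Lr, Core.of t.core ∈ compat R cs := by
      intro t ht
      refine mem_compat (hr t ht) (hR.land ?_)
      have := (hv t (List.mem_append_right _ ht)).1.ordered.sublist t.core_infix.sublist
      exact fails_masks hB this
    have hcs' : ∀ c ∈ compat R cs, c = Core.of c.l := fun c hc => hcs c (compat_subset hc)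
    clear hr hcs
    revert hr' hcs' h
    generalize compat R cs = ds
    intro h hr hcs
    induction ds with
    | nil =>
      obtain ⟨t, ht⟩ := List.exists_mem_of_length_pos (l := Lr) (by omega)
      exact absurd (hr t ht) (by simp)
    | cons c ds ihd =>
      change cond (force (Nat.lor M c.E) fun M' => force (Nat.lor R c.F) fun R' =>
          select G.V (leaf G P good) k (compat R' (c :: ds)) (⟨[], c.l, []⟩ :: as) M' R')
          _ false = true at h
      rw [force_eq, force_eq, Bool.cond_false_right, Bool.and_eq_true] at h
      obtain ⟨h1, h2⟩ := h
      -- The first candidate that is the core of a remaining path is taken. Candidates passed over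
      -- before are cores of none of these paths, so dropping them loses nothing.
      by_cases hex : ∃ t ∈ Lr, t.core = c.l
      · obtain ⟨t, ht, htc⟩ := hex
        obtain ⟨Lr', hperm⟩ : ∃ Lr', Lr.Perm (t :: Lr') := by
          obtain ⟨l1, l2, rfl⟩ := List.append_of_mem ht
          exact ⟨l1 ++ l2, List.perm_middle⟩
        have hc := hcs c (by simp)
        have hO : Ordered B c.l := by
          rw [← htc]
          exact (hv t (List.mem_append_right _ ht)).1.ordered.sublist t.core_infix.sublist
        have hF : Holds B (Nat.lor R c.F) := by
          rw [hc]
          exact hR.lor (holds_masks hB hO)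
        have hp2 : (t :: Lc ++ Lr').Perm (Lc ++ Lr) :=
          List.perm_middle.symm.trans ((List.perm_append_left_iff Lc).2 hperm.symm)
        have key := @ih (compat (Nat.lor R c.F) (c :: ds))
          (⟨[], c.l, []⟩ :: as) (t :: Lc) Lr' (Nat.lor M c.E) (Nat.lor R c.F)
          (.cons ⟨htc.symm, Or.inl rfl, Or.inl rfl⟩ hs)
          (by have := hperm.length_eq; simp at this; omega) (by simp; omega)
          (fun c hc => hcs c (compat_subset hc))
        suffices h' : _ ∧ _ ∧ _ by
          obtain ⟨as', Ls, hLs, hs', hg⟩ := key h'.1 (fun t ht => hv t (hp2.mem_iff.1 ht)) h'.2.1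
            h'.2.2 hF h1
          exact ⟨as', Ls, hLs.trans hp2, hs', hg⟩
        refine ⟨?_, ?_, ?_⟩
        · intro t' ht'
          have ht'' : t' ∈ Lr := hperm.mem_iff.2 (by simp [ht'])
          refine mem_compat (hr t' ht'') (hF.land ?_)
          exact fails_masks hB
            ((hv t' (List.mem_append_right _ ht'')).1.ordered.sublist t'.core_infix.sublist)
        · intro a ha u v hau
          rw [testBit_lor, Bool.or_eq_true]
          rcases List.mem_cons.1 ha with rfl | ha
          · right
            rw [hc]
            exact testBit_emask (htc ▸ hau)
          · exact Or.inl (hM a ha u v hau)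
        · intro e he
          exact (hcov e he).imp (fun ⟨a, ha, h⟩ => ⟨a, hp2.mem_iff.2 ha, h⟩)
            fun ⟨⟨a, ha, h⟩, b, hb, h'⟩ => ⟨⟨a, hp2.mem_iff.2 ha, h⟩, b, hp2.mem_iff.2 hb, h'⟩
      · refine ihd h2 (fun t ht => ?_) fun c hc => hcs c (by simp [hc])
        rcases List.mem_cons.1 (hr t ht) with h | h
        · exact absurd ⟨t, ht, by rw [← h]; rfl⟩ hex
        · exact h

theorem mkCore_eq (l : List ℕ) (k : Core → Bool) : mkCore l k = k (Core.of l) := by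
  rw [mkCore, force_eq, force_eq, force_eq]
  rfl

theorem mkCores_eq {k : List Core → Bool} (ls : List (List ℕ)) :
    ∀ acc, mkCores k ls acc = k ((ls.map Core.of).reverseAux acc) := by
  induction ls with
  | nil => exact fun acc => rfl
  | cons l ls ih =>
    intro acc
    change mkCore l (fun c => mkCores k ls (c :: acc)) = _
    rw [mkCore_eq, ih]
    rfl

theorem search_sound (hB : IsBetweenness B) {G : Graph} (hG : G.Wf) {good : List Arc → Bool}
    {n : ℕ} {L : List Arc} (hn : L.length = n) (hn7 : n ≤ 7)
    (hc : ∀ t ∈ L, t.core ∈ candidates G G.V.length)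
    (hv : ∀ t ∈ L, t.Valid B ∧ ∀ x ∈ t.core, x < 6) (hcov : Covers G L)
    (h : search G n good = true) :
    ∃ as Ls, Ls.Perm L ∧ List.Forall₂ Arc.Le as Ls ∧ good as = true := by
  rw [search, mkCores_eq] at h
  refine select_sound hB hG ?_ n (Lc := []) .nil hn (by simpa using hn7) ?_ ?_ hv (by simp) hcov
    holds_zero h
  · intro x hx
    obtain ⟨u, hu, rfl⟩ := List.mem_map.1 hx
    have := hG.lt_vertex u hu
    omega
  · intro c hc
    simp only [List.reverseAux_eq, List.append_nil, List.mem_reverse, List.mem_map] at hc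
    obtain ⟨l, -, rfl⟩ := hc
    rfl
  · intro t ht
    simp only [List.reverseAux_eq, List.append_nil, List.mem_reverse, List.mem_map]
    exact ⟨_, hc t ht, rfl⟩

theorem searchFrom_sound (hB : IsBetweenness B) {G : Graph} (hG : G.Wf) {good : List Arc → Bool}
    {n m : ℕ} {t : Arc} {L : List Arc} (hn : L.length = n) (hn7 : n ≤ 6)
    (hc : ∀ t ∈ L, t.core ∈ candidates G m) (ht : t.core = List.range m)
    (hv : ∀ t' ∈ t :: L, t'.Valid B ∧ ∀ x ∈ t'.core, x < 6) (hcov : Covers G (t :: L))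
    (h : searchFrom G n m good = true) :
    ∃ as Ls, Ls.Perm (t :: L) ∧ List.Forall₂ Arc.Le as Ls ∧ good as = true := by
  rw [searchFrom, mkCores_eq, mkCore_eq] at h
  refine select_sound hB hG ?_ n (Lc := [t]) (.cons ⟨ht.symm, Or.inl rfl, Or.inl rfl⟩ .nil) hn
    (by simp; omega) ?_ ?_ hv ?_ hcov ?_ h
  · intro x hx
    obtain ⟨u, hu, rfl⟩ := List.mem_map.1 hx
    have := hG.lt_vertex u hu
    omega
  · intro c hc
    simp only [List.reverseAux_eq, List.append_nil, List.mem_reverse, List.mem_map] at hc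
    obtain ⟨l, -, rfl⟩ := hc
    rfl
  · intro t ht
    simp only [List.reverseAux_eq, List.append_nil, List.mem_reverse, List.mem_map]
    exact ⟨_, hc t ht, rfl⟩
  · intro a ha u v hau
    rw [List.mem_singleton] at ha
    subst ha
    exact testBit_emask (ht ▸ hau)
  · refine holds_masks hB ?_
    rw [← ht]
    exact (hv t (by simp)).1.ordered.sublist t.core_infix.sublist

/-! ### Paths -/

theorem mem_pathsOf {G : Graph} {l : List ℕ} (hV : ∀ x ∈ l, ∃ r, (x, r) ∈ G.V)
    (hE : l.IsChain fun a b => ∀ r, (a, r) ∈ G.V → r.testBit b = true) (hl : l.Nodup) :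
    l ∈ pathsOf G l.length := by
  induction l with
  | nil => simp [pathsOf]
  | cons a l ih =>
    have h1 := ih (fun x hx => hV x (by simp [hx])) (List.IsChain.of_cons hE)
      (List.nodup_cons.1 hl).2
    rw [List.length_cons, pathsOf, List.mem_flatMap]
    refine ⟨l, h1, ?_⟩
    obtain ⟨r, hr⟩ := hV a (by simp)
    rw [List.mem_map]
    refine ⟨(a, r), List.mem_filter.2 ⟨hr, ?_⟩, rfl⟩
    have h2 := (List.nodup_cons.1 hl).1
    cases l with
    | nil => simp
    | cons b l =>
      have h3 : r.testBit b = true := (List.isChain_cons_cons.1 hE).1 r hr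
      simp only [List.headD_cons, bit_eq, h3]
      simpa using h2

theorem mem_candidates {G : Graph} {l : List ℕ} (h0 : l ≠ []) (hV : ∀ x ∈ l, ∃ r, (x, r) ∈ G.V)
    (hE : l.IsChain fun a b => ∀ r, (a, r) ∈ G.V → r.testBit b = true) (hl : l.Nodup)
    (hle : l.headD 0 ≤ l.getLastD 0) {m : ℕ} (hm : l.length ≤ m) : l ∈ candidates G m := by
  induction m with
  | zero =>
    have := List.length_pos_iff.2 h0
    omega
  | succ m ih =>
    rw [candidates, List.mem_append]
    rcases Nat.lt_or_eq_of_le hm with h | h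
    · exact Or.inr (ih (by omega))
    · left
      rw [List.mem_filter, ← h]
      exact ⟨mem_pathsOf hV hE hl, by simpa using hle⟩

end Search

/-- The vertex lists of the three families of paths in `K₅`. -/
def k5Lists : Fin 3 → List (List (Fin 5 × Fin 5)) :=
  ![[[(1, 3), (1, 1), (0, 0), (2, 2), (2, 4)], [(2, 3), (3, 3), (0, 0), (4, 4), (1, 4)],
      [(1, 3), (3, 3), (4, 4), (2, 4)], [(1, 4), (1, 1), (2, 2), (2, 3)]],
    [[(1, 2), (1, 1), (0, 0), (3, 3), (3, 4)], [(1, 2), (2, 2), (0, 0), (4, 4), (3, 4)],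
      [(1, 4), (1, 1), (3, 3), (2, 3)], [(2, 3), (2, 2), (4, 4), (1, 4)]],
    [[(1, 2), (1, 1), (0, 0), (3, 3), (3, 4)], [(1, 2), (2, 2), (0, 0), (4, 4), (3, 4)],
      [(2, 4), (2, 2), (3, 3), (1, 3)], [(1, 3), (1, 1), (4, 4), (2, 4)]]]

/-! ### Evaluation of the searches. -/

namespace Search

/-- The label of an edge, in either direction. -/
def Graph.label (G : Graph) (u v : ℕ) : ℕ :=
  ((G.E.find? fun t => (t.1 == u && t.2.1 == v) || (t.1 == v && t.2.1 == u)).map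
    fun t => t.2.2).getD 0

/-- The number of a vertex (if `p.1 = p.2`) or of a point in the interior of an edge. -/
def k5Num (p : Fin 5 × Fin 5) : ℕ := if p.1 = p.2 then p.1 else K5.label p.1 p.2

/-- The relabelings of the three families that occur in the search. -/
def k5Forms : List (Fin 3 × (Fin 5 → Fin 5)) :=
  -- The longest cores of the three families have three vertices with `0` in the middle. The search
  -- places such a core at `0, 1, 2`, so `0` goes to `1`.
  [(1, ![1, 0, 3, 2, 4]), (0, ![1, 0, 2, 3, 4]), (0, ![1, 0, 2, 4, 3]), (1, ![1, 0, 4, 2, 3]),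
    (2, ![1, 0, 4, 2, 3]), (2, ![1, 0, 3, 2, 4])]

def k5Form (f : Fin 3 × (Fin 5 → Fin 5)) : List (List ℕ) :=
  (k5Lists f.1).map fun l => l.map fun p => k5Num (f.2 p.1, f.2 p.2)

/-- Both inclusions are tested, up to reversal of paths, since paths may be repeated; that every
list of the form occurs is what later yields four different geodesics. -/
def k5Good (as : List Arc) : Bool :=
  k5Forms.any fun f =>
    (as.all fun a => (k5Form f).any fun l => a.pts == l || a.pts == l.reverse) &&
    (k5Form f).all fun l => as.any fun a => a.pts == l || a.pts == l.reverse

/-- Nothing is accepted at the end of a branch, so the value `true` says that every branch ends in a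
contradiction. -/
theorem search_K23 : search K23 2 (fun _ => false) = true := by decide +kernel

theorem search_K4 : search K4 3 (fun _ => false) = true := by decide +kernel

/-- One search for each length `m` of a longest core; fixing this core uses up the symmetry of `K₅`
and limits the length of the candidates. -/
theorem searchFrom_K5_of_le_three : ∀ m ∈ [1, 2, 3], searchFrom K5 3 m k5Good = true := by
  decide +kernel

theorem searchFrom_K5_five : searchFrom K5 3 5 k5Good = true := by decide +kernel

end Search

namespace Search

theorem search_K33 : search K33 3 (fun _ => false) = true := by decide +kernel

theorem searchFrom_K5_four : searchFrom K5 3 4 k5Good = true := by decide +kernel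

end Search

/-! ### Metric betweenness and the paths of geodesics. -/

section Metric

variable {X : Type*}

/-- `y` lies strictly between `x` and `z`. -/
def MBtw (m : MetricSpace X) (x y z : X) : Prop :=
  x ≠ y ∧ y ≠ z ∧ x ≠ z ∧ m.dist x y + m.dist y z = m.dist x z

theorem MBtw.symm {m : MetricSpace X} {x y z : X} (h : MBtw m x y z) : MBtw m z y x := by
  obtain ⟨h1, h2, h3, h4⟩ := h
  refine ⟨h2.symm, h1.symm, h3.symm, ?_⟩
  rw [m.dist_comm z y, m.dist_comm y x, m.dist_comm z x]
  linarith

theorem MBtw.not_swap {m : MetricSpace X} {x y z : X} (h : MBtw m x y z) : ¬ MBtw m y x z := by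
  rintro ⟨-, -, -, h'⟩
  obtain ⟨h1, -, -, h4⟩ := h
  have : 0 < m.dist x y := (@dist_pos X m x y).2 h1
  have := m.dist_comm x y
  linarith

/-- The length of the chain `x, y, z, w` is the distance from `x` to `w`, so the triangle
inequalities for `x, y, w` and `y, z, w` are equalities. -/
theorem MBtw.left {m : MetricSpace X} {x y z w : X} (h : MBtw m x y z) (h' : MBtw m x z w) :
    MBtw m x y w ∧ MBtw m y z w := by
  obtain ⟨h1, h2, h3, h4⟩ := h
  obtain ⟨h1', h2', h3', h4'⟩ := h'
  have t1 := m.dist_triangle x y w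
  have t2 := m.dist_triangle y z w
  have p1 : 0 < m.dist z w := (@dist_pos X m z w).2 h2'
  have p2 : 0 < m.dist y z := (@dist_pos X m y z).2 h2
  have e : m.dist y w = m.dist y z + m.dist z w := by linarith
  have hyw : y ≠ w := by
    rintro rfl
    have := m.dist_self y
    linarith
  exact ⟨⟨h1, hyw, h3', by linarith⟩, h2, h2', hyw, by linarith⟩

/-- The points of a list are distinct and lie in this order. -/
def MOrdered (m : MetricSpace X) (l : List X) : Prop :=
  l.Nodup ∧ ∀ x y z, [x, y, z].Sublist l → MBtw m x y z

end Metric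

variable {V X : Type*}

/-- A path through the vertices `core` of a graph that may continue at both ends to a point in
the interior of an edge; this point is recorded by the ends of the edge. -/
structure PArc (V : Type*) where
  pre : List (V × V)
  core : List V
  post : List (V × V)

namespace PArc

def pts (a : PArc V) : List (V × V) := a.pre ++ a.core.map (fun v => (v, v)) ++ a.post

/-- The path `a` continues from its end `u` into the edge `uv`. -/
def EndAt (a : PArc V) (u v : V) : Prop :=
  (a.core.head? = some u ∧ a.pre = [(v, u)]) ∨ (a.core.getLast? = some u ∧ a.post = [(u, v)])

/-- `a` is a path in `G`, whose points lie in order for the metric `m`. -/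
structure Valid (G : SimpleGraph V) (m : MetricSpace X) (pt : V × V → X) (a : PArc V) : Prop where
  core_ne : a.core ≠ []
  chain : a.core.IsChain G.Adj
  nodup : a.core.Nodup
  pre : a.pre = [] ∨ ∃ v w, a.core.head? = some v ∧ G.Adj v w ∧ a.pre = [(w, v)]
  post : a.post = [] ∨ ∃ v w, a.core.getLast? = some v ∧ G.Adj v w ∧ a.post = [(v, w)]
  ordered : MOrdered m (a.pts.map pt)

end PArc

/-- Every edge is in the core of a path, or two paths meet in its interior. -/
def PCovers (G : SimpleGraph V) (L : List (PArc V)) : Prop :=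
  ∀ u v, G.Adj u v → (∃ a ∈ L, [u, v] <:+: a.core ∨ [v, u] <:+: a.core) ∨
    ((∃ a ∈ L, a.EndAt u v) ∧ ∃ a ∈ L, a.EndAt v u)

/-! ### Numbered vertices and edges: from paths to data of the search. -/

namespace Search

theorem Arc.pts_reverse (t : Arc) :
    (Arc.mk t.post.reverse t.core.reverse t.pre.reverse).pts = t.pts.reverse := by
  simp [Arc.pts]

/-- The path `t` or its reversal, so that the number of the first vertex is not larger than the
number of the last one. -/
def Arc.orient (t : Arc) : Arc :=
  if t.core.headD 0 ≤ t.core.getLastD 0 then t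
  else ⟨t.post.reverse, t.core.reverse, t.pre.reverse⟩

variable {B : ℕ → ℕ → ℕ → Prop}

theorem Arc.orient_cases (t : Arc) :
    t.orient = t ∨ t.orient = ⟨t.post.reverse, t.core.reverse, t.pre.reverse⟩ := by
  rw [Arc.orient]
  split_ifs <;> simp

theorem Arc.Valid.orient (hB : IsBetweenness B) {t : Arc} (h : t.Valid B) : t.orient.Valid B := by
  rcases t.orient_cases with e | e <;> rw [e]
  · exact h
  · constructor
    · rw [Arc.pts_reverse]
      exact h.ordered.reverse hB
    · rw [Arc.pts_reverse, List.nodup_reverse]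
      exact h.nodup
    · simpa using h.post_le
    · simpa using h.pre_le

theorem Arc.EndAt.orient {t : Arc} {u e : ℕ} (h : t.EndAt u e) : t.orient.EndAt u e := by
  rcases t.orient_cases with e' | e' <;> rw [e']
  · exact h
  · rcases h with ⟨h1, h2⟩ | ⟨h1, h2⟩
    · exact Or.inr ⟨by simpa using h1, by simp [h2]⟩
    · exact Or.inl ⟨by simpa using h1, by simp [h2]⟩

theorem Consec.orient {t : Arc} {u v : ℕ} (h : Consec u v t.core) : Consec u v t.orient.core := by
  rcases t.orient_cases with e' | e' <;> rw [e']
  · exact h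
  · rcases h with h | h
    · exact Or.inr (by simpa using List.reverse_infix.2 h)
    · exact Or.inl (by simpa using List.reverse_infix.2 h)

theorem Covers.orient {G : Graph} {L : List Arc} (h : Covers G L) : Covers G (L.map Arc.orient) := by
  intro t ht
  refine (h t ht).imp ?_ ?_
  · rintro ⟨a, ha, h⟩
    exact ⟨_, List.mem_map_of_mem ha, h.orient⟩
  · rintro ⟨⟨a, ha, h⟩, b, hb, h'⟩
    exact ⟨⟨_, List.mem_map_of_mem ha, h.orient⟩, _, List.mem_map_of_mem hb, h'.orient⟩

theorem Arc.mem_core_orient {t : Arc} {x : ℕ} : x ∈ t.orient.core ↔ x ∈ t.core := by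
  rcases t.orient_cases with e' | e' <;> simp [e']

/-- The number of a vertex (if `p.1 = p.2`) or of a point in the interior of an edge. -/
def num [DecidableEq V] (K : Graph) (c : V → ℕ) (p : V × V) : ℕ :=
  if p.1 = p.2 then c p.1 else K.label (c p.1) (c p.2)

/-- A numbering of the vertices of `G` that turns `G` into `K`. -/
structure Numbering [DecidableEq V] (G : SimpleGraph V) (K : Graph) (c : V → ℕ) : Prop where
  wf : K.Wf
  mem : ∀ v, ∃ u ∈ K.V, u.1 = c v
  adj : ∀ u ∈ K.V, ∀ v w, u.1 = c v → G.Adj v w → u.2.testBit (c w) = true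
  lt : ∀ p : V × V, (p.1 = p.2 ∨ G.Adj p.1 p.2) → num K c p < 16
  symm : ∀ p : V × V, num K c p = num K c p.swap
  inj : ∀ p : V × V, (p.1 = p.2 ∨ G.Adj p.1 p.2) → ∀ q : V × V, (q.1 = q.2 ∨ G.Adj q.1 q.2) →
    num K c p = num K c q → p = q ∨ p = q.swap
  edge : ∀ t ∈ K.E, ∃ u v, G.Adj u v ∧ t.1 = c u ∧ t.2.1 = c v ∧ t.2.2 = num K c (u, v)

section Numbering

variable [DecidableEq V] {G : SimpleGraph V} {K : Graph} {c : V → ℕ} {m : MetricSpace X}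
  {pt : V × V → X}

/-- The metric betweenness of numbered points. -/
def numB (G : SimpleGraph V) (K : Graph) (c : V → ℕ) (m : MetricSpace X) (pt : V × V → X)
    (a b d : ℕ) : Prop :=
  ∃ p q r : V × V, (p.1 = p.2 ∨ G.Adj p.1 p.2) ∧ (q.1 = q.2 ∨ G.Adj q.1 q.2) ∧
    (r.1 = r.2 ∨ G.Adj r.1 r.2) ∧ num K c p = a ∧ num K c q = b ∧ num K c r = d ∧
    MBtw m (pt p) (pt q) (pt r)

/-- The numbering identifies only the two orientations of an edge, and these have the same point;
thus betweenness of numbers is well defined. -/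
theorem Numbering.pt_eq (hK : Numbering G K c) (hpt : ∀ p : V × V, pt p.swap = pt p) {p q : V × V}
    (hp : p.1 = p.2 ∨ G.Adj p.1 p.2) (hq : q.1 = q.2 ∨ G.Adj q.1 q.2)
    (h : num K c p = num K c q) : pt p = pt q := by
  rcases hK.inj p hp q hq h with rfl | rfl
  · rfl
  · exact hpt q

theorem Numbering.isBetweenness (hK : Numbering G K c) (hpt : ∀ p : V × V, pt p.swap = pt p) :
    IsBetweenness (numB G K c m pt) where
  symm := by
    rintro a b d ⟨p, q, r, hp, hq, hr, h1, h2, h3, h⟩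
    exact ⟨r, q, p, hr, hq, hp, h3, h2, h1, h.symm⟩
  ne := by
    rintro a b ⟨p, q, r, hp, hq, hr, h1, h2, h3, h⟩
    exact h.2.2.1 (hK.pt_eq hpt hp hr (h1.trans h3.symm))
  not_swap := by
    rintro a b d ⟨p, q, r, hp, hq, hr, h1, h2, h3, h⟩ ⟨p', q', r', hp', hq', hr', h1', h2', h3', h'⟩
    rw [← hK.pt_eq hpt hq hp' (h2.trans h1'.symm), ← hK.pt_eq hpt hp hq' (h1.trans h2'.symm),
      ← hK.pt_eq hpt hr hr' (h3.trans h3'.symm)] at h'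
    exact h.not_swap h'
  left := by
    rintro a b d e ⟨p, q, r, hp, hq, hr, h1, h2, h3, h⟩ ⟨p', r', s, hp', hr', hs, h1', h3', h4', h'⟩
    rw [← hK.pt_eq hpt hp hp' (h1.trans h1'.symm), ← hK.pt_eq hpt hr hr' (h3.trans h3'.symm)] at h'
    exact ⟨p, q, s, hp, hq, hs, h1, h2, h4', (h.left h').1⟩
  right := by
    rintro a b d e ⟨p, q, r, hp, hq, hr, h1, h2, h3, h⟩ ⟨p', r', s, hp', hr', hs, h1', h3', h4', h'⟩
    rw [← hK.pt_eq hpt hp hp' (h1.trans h1'.symm), ← hK.pt_eq hpt hr hr' (h3.trans h3'.symm)] at h'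
    exact ⟨q, r, s, hq, hr, hs, h2, h3, h4', (h.left h').2⟩
  lt := by
    rintro a b d ⟨p, q, r, hp, hq, hr, rfl, rfl, rfl, h⟩
    exact ⟨hK.lt p hp, hK.lt q hq, hK.lt r hr⟩

/-- The numbers of the points of a path. -/
def toArc (K : Graph) (c : V → ℕ) (a : PArc V) : Arc :=
  ⟨a.pre.map (num K c), a.core.map c, a.post.map (num K c)⟩

theorem toArc_pts (a : PArc V) : (toArc K c a).pts = a.pts.map (num K c) := by
  simp [toArc, Arc.pts, PArc.pts, num, Function.comp_def]

omit [DecidableEq V] in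
theorem valid_pts {a : PArc V} (h : a.Valid G m pt) : ∀ p ∈ a.pts, p.1 = p.2 ∨ G.Adj p.1 p.2 := by
  intro p hp
  simp only [PArc.pts, List.mem_append, List.mem_map] at hp
  rcases hp with (hp | ⟨v, -, rfl⟩) | hp
  · rcases h.pre with h | ⟨v, w, -, hvw, h⟩ <;> rw [h] at hp
    · simp at hp
    · rw [List.mem_singleton] at hp
      subst hp
      exact Or.inr hvw.symm
  · exact Or.inl rfl
  · rcases h.post with h | ⟨v, w, -, hvw, h⟩ <;> rw [h] at hp
    · simp at hp
    · rw [List.mem_singleton] at hp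
      subst hp
      exact Or.inr hvw

theorem Numbering.valid (hK : Numbering G K c) (hpt : ∀ p : V × V, pt p.swap = pt p) {a : PArc V}
    (h : a.Valid G m pt) : (toArc K c a).Valid (numB G K c m pt) where
  ordered := by
    intro x y z hs
    rw [toArc_pts, List.sublist_map_iff] at hs
    obtain ⟨l, hl, he⟩ := hs
    rcases l with _ | ⟨p, _ | ⟨q, _ | ⟨r, _ | _⟩⟩⟩ <;> simp at he
    obtain ⟨rfl, rfl, rfl⟩ := he
    have hv := valid_pts h
    refine ⟨p, q, r, hv p (hl.subset (by simp)), hv q (hl.subset (by simp)),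
      hv r (hl.subset (by simp)), rfl, rfl, rfl, h.ordered.2 _ _ _ ?_⟩
    exact hl.map pt
  nodup := by
    rw [toArc_pts]
    have h1 := List.Nodup.of_map pt h.ordered.1
    refine List.Nodup.map_on ?_ h1
    intro p hp q hq hpq
    have hv := valid_pts h
    exact List.inj_on_of_nodup_map h.ordered.1 hp hq (hK.pt_eq hpt (hv p hp) (hv q hq) hpq)
  pre_le := by
    rcases h.pre with h | ⟨v, w, -, hvw, h⟩ <;> simp [toArc, h]
  post_le := by
    rcases h.post with h | ⟨v, w, -, hvw, h⟩ <;> simp [toArc, h]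

theorem Numbering.endAt (hK : Numbering G K c) {a : PArc V} {u v : V} (h : a.EndAt u v) :
    (toArc K c a).EndAt (c u) (num K c (u, v)) := by
  rcases h with ⟨h1, h2⟩ | ⟨h1, h2⟩
  · refine Or.inl ⟨by simp [toArc, h1], ?_⟩
    simp only [toArc, h2, List.map_cons, List.map_nil]
    rw [hK.symm]
    rfl
  · exact Or.inr ⟨by simp [toArc, h1], by simp [toArc, h2]⟩

theorem Numbering.covers (hK : Numbering G K c) {L : List (PArc V)} (h : PCovers G L) :
    Covers K (L.map (toArc K c)) := by
  intro t ht
  obtain ⟨u, v, huv, h1, h2, h3⟩ := hK.edge t ht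
  rw [h1, h2, h3]
  refine (h u v huv).imp ?_ ?_
  · rintro ⟨a, ha, h⟩
    refine ⟨_, List.mem_map_of_mem ha, h.imp (fun h => ?_) fun h => ?_⟩
    · simpa [toArc] using h.map c
    · simpa [toArc] using h.map c
  · rintro ⟨⟨a, ha, h⟩, b, hb, h'⟩
    refine ⟨⟨_, List.mem_map_of_mem ha, hK.endAt h⟩, _, List.mem_map_of_mem hb, ?_⟩
    have := hK.endAt h'
    rwa [hK.symm] at this

theorem Numbering.injective (hK : Numbering G K c) : Function.Injective c := by
  intro v w h
  have := hK.inj (v, v) (Or.inl rfl) (w, w) (Or.inl rfl) (by simpa [num] using h)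
  simpa using this

theorem Numbering.lt_six (hK : Numbering G K c) (v : V) : c v < 6 := by
  obtain ⟨u, hu, h⟩ := hK.mem v
  exact h ▸ hK.wf.lt_vertex u hu

theorem Numbering.mem_candidates (hK : Numbering G K c) {a : PArc V} (h : a.Valid G m pt) {n : ℕ}
    (hn : a.core.length ≤ n) : (toArc K c a).orient.core ∈ candidates K n := by
  have hmem : ∀ x ∈ a.core.map c, ∃ r, (x, r) ∈ K.V := by
    intro x hx
    obtain ⟨v, -, rfl⟩ := List.mem_map.1 hx
    obtain ⟨u, hu, h⟩ := hK.mem v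
    exact ⟨u.2, h ▸ hu⟩
  have hch : ∀ l : List V, l.IsChain G.Adj →
      (l.map c).IsChain fun a b => ∀ r, (a, r) ∈ K.V → r.testBit b = true := by
    intro l hl
    rw [List.isChain_map]
    exact hl.imp fun v w hvw r hr => hK.adj _ hr v w rfl hvw
  have hnd : (a.core.map c).Nodup := h.nodup.map hK.injective
  have hne : a.core.map c ≠ [] := by simpa using h.core_ne
  rw [Arc.orient]
  split_ifs with hle
  · exact Search.mem_candidates hne hmem (hch _ h.chain) hnd hle (by simpa [toArc] using hn)
  · refine Search.mem_candidates (by simpa [toArc] using h.core_ne)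
      (fun x hx => hmem x (by simpa [toArc] using hx)) ?_ (by simpa [toArc] using hnd) ?_
      (by simpa [toArc] using hn)
    · have := hch a.core.reverse (by
        rw [List.isChain_reverse]
        exact h.chain.imp fun v w hvw => hvw.symm)
      simpa [toArc] using this
    · have e1 : ∀ l : List ℕ, l.reverse.headD 0 = l.getLastD 0 := fun l => by
        rw [List.headD_eq_head?_getD, List.head?_reverse, List.getLastD_eq_getLast?]
      have e2 : ∀ l : List ℕ, l.reverse.getLastD 0 = l.headD 0 := fun l => by
        rw [← e1, List.reverse_reverse]
      change (toArc K c a).core.reverse.headD 0 ≤ (toArc K c a).core.reverse.getLastD 0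
      rw [e1, e2]
      omega

theorem Numbering.orient_valid (hK : Numbering G K c) (hpt : ∀ p : V × V, pt p.swap = pt p)
    {L : List (PArc V)} (hv : ∀ a ∈ L, a.Valid G m pt) :
    ∀ t ∈ (L.map (toArc K c)).map Arc.orient,
      t.Valid (numB G K c m pt) ∧ ∀ x ∈ t.core, x < 6 := by
  intro t ht
  simp only [List.map_map, List.mem_map, Function.comp_apply] at ht
  obtain ⟨a, ha, rfl⟩ := ht
  refine ⟨(hK.valid hpt (hv a ha)).orient (hK.isBetweenness hpt), fun x hx => ?_⟩
  rw [Arc.mem_core_orient] at hx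
  obtain ⟨v, -, rfl⟩ := List.mem_map.1 hx
  exact hK.lt_six v

theorem Numbering.search_sound [Fintype V] (hK : Numbering G K c)
    (hpt : ∀ p : V × V, pt p.swap = pt p) {good : List Arc → Bool}
    {L : List (PArc V)} {n : ℕ} (hn : L.length = n) (hn7 : n ≤ 7) (hcard : Fintype.card V ≤ K.V.length)
    (hv : ∀ a ∈ L, a.Valid G m pt) (hcov : PCovers G L) (h : search K n good = true) :
    ∃ as, good as = true := by
  have h1 : ∀ t ∈ (L.map (toArc K c)).map Arc.orient, t.core ∈ candidates K K.V.length := by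
    intro t ht
    simp only [List.map_map, List.mem_map, Function.comp_apply] at ht
    obtain ⟨a, ha, rfl⟩ := ht
    exact hK.mem_candidates (hv a ha) (((hv a ha).nodup.length_le_card).trans hcard)
  obtain ⟨as, -, -, -, hg⟩ := Search.search_sound (hK.isBetweenness (m := m) hpt) hK.wf
    (by simpa using hn) hn7 h1 (hK.orient_valid hpt hv) (hK.covers hcov).orient h
  exact ⟨as, hg⟩

end Numbering

end Search

/-! ### Relabeling of paths by automorphisms. -/

variable {V X : Type*}

/-- Relabel the vertices of a path. -/
def PArc.map {W : Type*} (τ : V → W) (a : PArc V) : PArc W :=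
  ⟨a.pre.map (Prod.map τ τ), a.core.map τ, a.post.map (Prod.map τ τ)⟩

theorem PArc.pts_map {W : Type*} (τ : V → W) (a : PArc V) :
    (a.map τ).pts = a.pts.map (Prod.map τ τ) := by
  simp [PArc.pts, PArc.map, Function.comp_def]

theorem PArc.EndAt.map {W : Type*} (τ : V → W) {a : PArc V} {u v : V} (h : a.EndAt u v) :
    (a.map τ).EndAt (τ u) (τ v) := by
  rcases h with ⟨h1, h2⟩ | ⟨h1, h2⟩
  · exact Or.inl ⟨by simp [PArc.map, h1], by simp [PArc.map, h2]⟩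
  · exact Or.inr ⟨by simp [PArc.map, h1], by simp [PArc.map, h2]⟩

theorem PArc.Valid.map {G : SimpleGraph V} {m : MetricSpace X} {pt : V × V → X} {a : PArc V}
    (h : a.Valid G m pt) (τ : G ≃g G) :
    (a.map τ).Valid G m (pt ∘ Prod.map τ.symm τ.symm) where
  core_ne := by simpa [PArc.map] using h.core_ne
  chain := by
    change (a.core.map τ).IsChain G.Adj
    rw [List.isChain_map]
    exact h.chain.imp fun v w hvw => τ.map_adj_iff.2 hvw
  nodup := h.nodup.map τ.injective
  pre := by
    refine h.pre.imp (fun h => by simp [PArc.map, h]) ?_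
    rintro ⟨v, w, h1, h2, h3⟩
    exact ⟨τ v, τ w, by simp [PArc.map, h1], τ.map_adj_iff.2 h2, by simp [PArc.map, h3]⟩
  post := by
    refine h.post.imp (fun h => by simp [PArc.map, h]) ?_
    rintro ⟨v, w, h1, h2, h3⟩
    exact ⟨τ v, τ w, by simp [PArc.map, h1], τ.map_adj_iff.2 h2, by simp [PArc.map, h3]⟩
  ordered := by
    have : (a.map τ).pts.map (pt ∘ Prod.map τ.symm τ.symm) = a.pts.map pt := by
      rw [PArc.pts_map, List.map_map]
      refine List.map_congr_left fun p _ => ?_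
      simp [Prod.map]
    rw [this]
    exact h.ordered

theorem PCovers.map {G : SimpleGraph V} {L : List (PArc V)} (h : PCovers G L) (τ : G ≃g G) :
    PCovers G (L.map (PArc.map τ)) := by
  intro u v huv
  obtain ⟨u, rfl⟩ := τ.surjective u
  obtain ⟨v, rfl⟩ := τ.surjective v
  refine (h u v (τ.map_adj_iff.1 huv)).imp ?_ ?_
  · rintro ⟨a, ha, h⟩
    refine ⟨_, List.mem_map_of_mem ha, h.imp (fun h => ?_) fun h => ?_⟩
    · simpa [PArc.map] using h.map τ
    · simpa [PArc.map] using h.map τ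
  · rintro ⟨⟨a, ha, h⟩, b, hb, h'⟩
    exact ⟨⟨_, List.mem_map_of_mem ha, h.map τ⟩, _, List.mem_map_of_mem hb, h'.map τ⟩

/-! ### Classification of the families of four paths in `K₅`. -/

namespace Search

/-- The symmetric group is multiply transitive. -/
theorem exists_perm_map_eq_range {n : ℕ} {l : List (Fin n)} (hl : l.Nodup) :
    ∃ τ : Equiv.Perm (Fin n), (l.map τ).map Fin.val = List.range l.length := by
  have hln : l.length ≤ n := by simpa using hl.length_le_card
  have := Equiv.Perm.isMultiplyPretransitive (Fin n) l.length
  obtain ⟨τ, hτ⟩ := MulAction.exists_smul_eq (Equiv.Perm (Fin n))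
    (⟨l.get, List.nodup_iff_injective_get.1 hl⟩ : Fin l.length ↪ Fin n) (Fin.castLEEmb hln)
  refine ⟨τ, List.ext_getElem (by simp) fun i h1 h2 => ?_⟩
  have := DFunLike.congr_fun hτ ⟨i, by simpa using h1⟩
  have h3 : τ (l[i]'(by simpa using h1)) = Fin.castLE hln ⟨i, by simpa using h1⟩ := this
  simp [h3]

theorem K5_numbering : Numbering (⊤ : SimpleGraph (Fin 5)) K5 Fin.val where
  wf := ⟨by decide, by decide, by decide, by decide, by decide⟩
  mem := by decide
  adj := by decide
  lt := by decide
  symm := by decide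
  inj := by decide +kernel
  edge := by decide

theorem K4_numbering : Numbering (⊤ : SimpleGraph (Fin 4)) K4 Fin.val where
  wf := ⟨by decide, by decide, by decide, by decide, by decide⟩
  mem := by decide
  adj := by decide
  lt := by decide
  symm := by decide
  inj := by decide +kernel
  edge := by decide

instance {α β : Type*} : DecidableRel (completeBipartiteGraph α β).Adj := fun a b => by
  unfold completeBipartiteGraph
  infer_instance

theorem K33_numbering : Numbering (completeBipartiteGraph (Fin 3) (Fin 3)) K33
    (Sum.elim Fin.val fun i => 3 + i) where
  wf := ⟨by decide, by decide, by decide, by decide, by decide⟩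
  mem := by decide
  adj := by decide
  lt := by decide
  symm := by decide
  inj := by decide +kernel
  edge := by decide +kernel

theorem K23_numbering : Numbering (completeBipartiteGraph (Fin 2) (Fin 3)) K23
    (Sum.elim Fin.val fun i => 2 + i) where
  wf := ⟨by decide, by decide, by decide, by decide, by decide⟩
  mem := by decide
  adj := by decide
  lt := by decide
  symm := by decide
  inj := by decide +kernel
  edge := by decide +kernel

/-- The path `a` runs through the points of the list `l`, relabeled by `σ`, in one of the two
directions. -/
def Same (a : PArc (Fin 5)) (σ : Equiv.Perm (Fin 5)) (l : List (Fin 5 × Fin 5)) : Prop :=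
  a.pre ≠ [] ∧ a.post ≠ [] ∧
    (a.pts.map (fun p => s(p.1, p.2)) = l.map (fun p => s(σ p.1, σ p.2)) ∨
      a.pts.map (fun p => s(p.1, p.2)) = (l.map fun p => s(σ p.1, σ p.2)).reverse)

/-- Vertices of `K₅` have numbers below `5`, so a path that agrees with a form really continues into
an edge at both ends. -/
theorem k5Form_ends : ∀ f ∈ k5Forms, ∀ l ∈ k5Form f, 5 ≤ l.headD 0 ∧ 5 ≤ l.getLastD 0 := by
  have : (k5Forms.all fun f => (k5Form f).all fun l =>
      decide (5 ≤ l.headD 0 ∧ 5 ≤ l.getLastD 0)) = true := by decide +kernel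
  simpa only [List.all_eq_true, decide_eq_true_eq] using this

theorem k5Forms_bijective : ∀ f ∈ k5Forms, Function.Bijective f.2 := by
  have : (k5Forms.all fun f => decide (Function.Injective f.2)) = true := by decide +kernel
  simp only [List.all_eq_true, decide_eq_true_eq] at this
  exact fun f hf => Finite.injective_iff_bijective.1 (this f hf)

theorem searchFrom_K5 {n : ℕ} (h0 : 0 < n) (h5 : n ≤ 5) : searchFrom K5 3 n k5Good = true := by
  interval_cases n
  · exact searchFrom_K5_of_le_three 1 (by simp)
  · exact searchFrom_K5_of_le_three 2 (by simp)
  · exact searchFrom_K5_of_le_three 3 (by simp)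
  · exact searchFrom_K5_four
  · exact searchFrom_K5_five

/-- The state `s` could lack ends of the actual path, but a form begins and ends with edge labels,
so nothing is missing. Undoing the orientation, the numbering and the permutation `τ` then compares
`a` with the list itself. -/
theorem same_of_pts {a : PArc (Fin 5)} (hne : a.core ≠ []) {τ : Equiv.Perm (Fin 5)}
    {s : Arc} (hs : s.Le (toArc K5 Fin.val (a.map τ)).orient) {f : Fin 3 × (Fin 5 → Fin 5)}
    (hf : f ∈ k5Forms) {F : Equiv.Perm (Fin 5)} (hF : ⇑F = f.2)
    {l : List (Fin 5 × Fin 5)} (hl : l ∈ k5Lists f.1)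
    (h : s.pts = (l.map fun p => k5Num (f.2 p.1, f.2 p.2)) ∨
      s.pts = (l.map fun p => k5Num (f.2 p.1, f.2 p.2)).reverse) : Same a (F.trans τ.symm) l := by
  have hends := k5Form_ends f hf _ (List.mem_map_of_mem hl)
  set l' := l.map fun p => k5Num (f.2 p.1, f.2 p.2) with hl'
  have e1 : ∀ l : List ℕ, l.reverse.headD 0 = l.getLastD 0 := fun l => by
    rw [List.headD_eq_head?_getD, List.head?_reverse, List.getLastD_eq_getLast?]
  have e2 : ∀ l : List ℕ, l.reverse.getLastD 0 = l.headD 0 := fun l => by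
    rw [← e1, List.reverse_reverse]
  have hends' : 5 ≤ s.pts.headD 0 ∧ 5 ≤ s.pts.getLastD 0 := by
    rcases h with h | h <;> rw [h]
    · exact hends
    · rw [e1, e2]
      exact hends.symm
  set t := toArc K5 Fin.val (a.map τ) with ht
  have hcore : ∀ x ∈ s.core, x < 5 := by
    intro x hx
    rw [hs.1, Arc.mem_core_orient] at hx
    obtain ⟨v, -, rfl⟩ := List.mem_map.1 hx
    exact v.2
  have hcne : s.core ≠ [] := by
    rw [hs.1]
    rcases t.orient_cases with e | e <;> rw [e] <;> simpa [t, toArc, PArc.map] using hne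
  have hpre : s.pre ≠ [] := by
    intro h0
    obtain ⟨x, c, hc⟩ := List.exists_cons_of_ne_nil hcne
    have := hends'.1
    rw [Arc.pts, h0, hc] at this
    have := hcore x (by simp [hc])
    simp at *
    omega
  have hpost : s.post ≠ [] := by
    intro h0
    obtain ⟨c, x, hc⟩ : ∃ c x, s.core = c ++ [x] :=
      ⟨_, _, (List.dropLast_append_getLast hcne).symm⟩
    have := hends'.2
    rw [Arc.pts, h0, hc, List.append_nil, ← List.append_assoc,
      List.getLastD_eq_getLast?, List.getLast?_append] at this
    have := hcore x (by simp [hc])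
    simp at *
    omega
  have hpts : s.pts = t.orient.pts := by
    obtain ⟨h1, h2, h3⟩ := hs
    rw [Arc.pts, Arc.pts, h1, h2.resolve_left hpre, h3.resolve_left hpost]
  have hpre' : t.orient.pre ≠ [] := hs.2.1.resolve_left hpre ▸ hpre
  have hpost' : t.orient.post ≠ [] := hs.2.2.resolve_left hpost ▸ hpost
  have h1 : t.pre ≠ [] ∧ t.post ≠ [] := by
    rcases t.orient_cases with e | e <;> rw [e] at hpre' hpost'
    · exact ⟨hpre', hpost'⟩
    · exact ⟨by simpa using hpost', by simpa using hpre'⟩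
  have h2 : t.pts = l' ∨ t.pts = l'.reverse := by
    rcases t.orient_cases with e | e <;> rw [e] at hpts
    · rwa [← hpts]
    · rw [Arc.pts_reverse] at hpts
      rw [← List.reverse_reverse t.pts, ← hpts]
      rcases h with h | h <;> rw [h]
      · exact Or.inr rfl
      · exact Or.inl (by simp)
  refine ⟨by simpa [t, toArc, PArc.map] using h1.1, by simpa [t, toArc, PArc.map] using h1.2, ?_⟩
  -- A number determines the unordered pair that it stands for, so the numbering can be inverted at
  -- the level of unordered pairs.
  obtain ⟨g, hg⟩ : ∃ g : ℕ → Sym2 (Fin 5), ∀ p : Fin 5 × Fin 5, g (k5Num p) = s(p.1, p.2) := by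
    have := (Function.factorsThrough_iff (f := k5Num) (fun p : Fin 5 × Fin 5 => s(p.1, p.2))).1 ?_
    · obtain ⟨g, hg⟩ := this
      exact ⟨g, fun p => (congrFun hg p).symm⟩
    · intro p q hpq
      have hval : ∀ p : Fin 5 × Fin 5, p.1 = p.2 ∨ (⊤ : SimpleGraph (Fin 5)).Adj p.1 p.2 :=
        fun p => em _
      rcases K5_numbering.inj p (hval p) q (hval q) hpq with rfl | rfl
      · rfl
      · exact Sym2.eq_swap
  have e3 : t.pts.map (fun x => (g x).map τ.symm) = a.pts.map fun p => s(p.1, p.2) := by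
    rw [ht, toArc_pts, PArc.pts_map, List.map_map, List.map_map]
    refine List.map_congr_left fun p _ => ?_
    have : g (num K5 Fin.val (Prod.map τ τ p)) = s(τ p.1, τ p.2) := hg (Prod.map τ τ p)
    simp [this]
  have e4 : l'.map (fun x => (g x).map τ.symm) =
      l.map fun p => s(F.trans τ.symm p.1, F.trans τ.symm p.2) := by
    rw [hl', List.map_map]
    refine List.map_congr_left fun p _ => ?_
    simp [hg, hF]
  rw [← e3, ← e4, ← List.map_reverse]
  exact h2.imp (fun h => by rw [h]) fun h => by rw [h]

end Search

open Search in
/-- Four paths that cover `K₅` are, up to a permutation of the vertices, the paths of one of the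
three families. -/
theorem k5_paths {m : MetricSpace X} {pt : Fin 5 × Fin 5 → X}
    (hpt : ∀ p : Fin 5 × Fin 5, pt p.swap = pt p) {L : List (PArc (Fin 5))} (hn : L.length = 4)
    (hv : ∀ a ∈ L, a.Valid (⊤ : SimpleGraph (Fin 5)) m pt)
    (hcov : PCovers (⊤ : SimpleGraph (Fin 5)) L) :
    ∃ (k : Fin 3) (σ : Equiv.Perm (Fin 5)), (∀ a ∈ L, ∃ l ∈ k5Lists k, Same a σ l) ∧
      ∀ l ∈ k5Lists k, ∃ a ∈ L, Same a σ l := by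
  -- A path with the largest number of vertices is moved to `0, 1, …`; its length then bounds the
  -- candidates for the other three.
  obtain ⟨a, ha, hmax⟩ := Set.exists_max_image {a | a ∈ L} (fun a => a.core.length)
    (List.finite_toSet L) (List.exists_mem_of_length_pos (by omega))
  obtain ⟨τ, hτ⟩ := exists_perm_map_eq_range (hv a ha).nodup
  obtain ⟨L', hL'⟩ : ∃ L', L.Perm (a :: L') := by
    obtain ⟨l1, l2, rfl⟩ := List.append_of_mem ha
    exact ⟨l1 ++ l2, List.perm_middle⟩
  let τ' : (⊤ : SimpleGraph (Fin 5)) ≃g ⊤ := ⟨τ, by simp⟩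
  let pt' := pt ∘ Prod.map τ'.symm τ'.symm
  have hpt' : ∀ p : Fin 5 × Fin 5, pt' p.swap = pt' p := fun p => hpt (Prod.map τ'.symm τ'.symm p)
  let N : PArc (Fin 5) → Arc := fun a => (toArc K5 Fin.val (a.map τ')).orient
  have hN : ∀ L : List (PArc (Fin 5)),
      ((L.map (PArc.map τ')).map (toArc K5 Fin.val)).map Arc.orient = L.map N := by
    intro L
    simp [N]
  have hB := K5_numbering.isBetweenness (m := m) hpt'
  have hv' : ∀ a ∈ L.map (PArc.map τ'), a.Valid (⊤ : SimpleGraph (Fin 5)) m pt' := by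
    intro b hb
    obtain ⟨a, ha, rfl⟩ := List.mem_map.1 hb
    exact (hv a ha).map τ'
  have hv2 := K5_numbering.orient_valid hpt' hv'
  have hcov2 := (K5_numbering.covers (hcov.map τ')).orient
  rw [hN] at hv2 hcov2
  have hperm : (L.map N).Perm (N a :: L'.map N) := by simpa using hL'.map N
  have hcore : (N a).core = List.range a.core.length := by
    have e : (toArc K5 Fin.val (a.map τ')).core = List.range a.core.length := hτ
    -- The core begins with `0`, so `orient` does not reverse it.
    have : (toArc K5 Fin.val (a.map τ')).core.headD 0 = 0 := by
      rw [e, List.headD_eq_head?_getD, List.head?_range]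
      split_ifs <;> rfl
    change (toArc K5 Fin.val (a.map τ')).orient.core = _
    rw [Arc.orient, if_pos (by omega), e]
  have hcand : ∀ t ∈ L'.map N, t.core ∈ candidates K5 a.core.length := by
    intro t ht
    obtain ⟨b, hb, rfl⟩ := List.mem_map.1 ht
    have hbL : b ∈ L := hL'.mem_iff.2 (by simp [hb])
    refine K5_numbering.mem_candidates ((hv b hbL).map τ') ?_
    simpa [PArc.map] using hmax b hbL
  obtain ⟨as, Ls, hLs, hle, hgood⟩ := searchFrom_sound hB K5_numbering.wf (n := 3)
    (by have := hL'.length_eq; simp at this ⊢; omega) (by norm_num) hcand hcore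
    (fun t ht => hv2 t (hperm.mem_iff.2 ht))
    (fun e he => (hcov2 e he).imp (fun ⟨a, ha, h⟩ => ⟨a, hperm.mem_iff.1 ha, h⟩)
      fun ⟨⟨a, ha, h⟩, b, hb, h'⟩ => ⟨⟨a, hperm.mem_iff.1 ha, h⟩, b, hperm.mem_iff.1 hb, h'⟩)
    (searchFrom_K5 (List.length_pos_iff.2 (hv a ha).core_ne) (by simpa using (hv a ha).nodup.length_le_card))
  have hmem : ∀ t, t ∈ Ls ↔ t ∈ L.map N := fun t => by rw [hLs.mem_iff, hperm.mem_iff]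
  simp only [k5Good, List.any_eq_true, Bool.and_eq_true, List.all_eq_true, Bool.or_eq_true,
    beq_iff_eq] at hgood
  obtain ⟨f, hf, h1, h2⟩ := hgood
  let F := Equiv.ofBijective f.2 (k5Forms_bijective f hf)
  refine ⟨f.1, F.trans τ.symm, ?_, ?_⟩
  · intro b hb
    obtain ⟨s, hs, hst⟩ := exists_of_forall₂ (List.Forall₂.flip hle)
      ((hmem (N b)).2 (List.mem_map_of_mem hb))
    obtain ⟨l', hl', h⟩ := h1 s hs
    obtain ⟨l, hl, rfl⟩ := List.mem_map.1 hl'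
    exact ⟨l, hl, same_of_pts (hv b hb).core_ne hst hf rfl hl h⟩
  · intro l hl
    obtain ⟨s, hs, h⟩ := h2 _ (List.mem_map_of_mem hl)
    obtain ⟨t, ht, hst⟩ := exists_of_forall₂ hle hs
    obtain ⟨b, hb, rfl⟩ := List.mem_map.1 ((hmem t).1 ht)
    exact ⟨b, hb, same_of_pts (hv b hb).core_ne hst hf rfl hl h⟩

/-! ### Vertices, edges and segments of the topological graph. -/

variable {V : Type*} [Fintype V] {G : SimpleGraph V}

namespace GraphSpace

theorem nonneg (x : GraphSpace G) (v : V) : 0 ≤ x.1 v := x.2.1.1 v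

theorem sum_eq_one (x : GraphSpace G) : ∑ v, x.1 v = 1 := x.2.1.2

theorem exists_ne_zero (x : GraphSpace G) : ∃ v, x.1 v ≠ 0 := by
  by_contra! h
  have := sum_eq_one x
  simp [h] at this

/-- A vertex of the support of a point. -/
noncomputable def vert (x : GraphSpace G) : V := (exists_ne_zero x).choose

theorem vert_ne_zero (x : GraphSpace G) : x.1 (vert x) ≠ 0 := (exists_ne_zero x).choose_spec

variable (G) in
/-- The points in the interior of the edge `uv`. -/
def openEdge (u v : V) : Set (GraphSpace G) := {x | x.1 u ≠ 0 ∧ x.1 v ≠ 0}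

variable (G) in
/-- The points of the edge `uv`. -/
def closedEdge (u v : V) : Set (GraphSpace G) := {x | ∀ w, x.1 w ≠ 0 → w = u ∨ w = v}

theorem openEdge_comm (u v : V) : openEdge G u v = openEdge G v u := by
  ext x
  exact and_comm

theorem closedEdge_comm (u v : V) : closedEdge G u v = closedEdge G v u := by
  ext x
  exact forall_congr' fun w => imp_congr_right fun _ => or_comm

theorem continuous_coord (v : V) : Continuous fun x : GraphSpace G => x.1 v :=
  (continuous_apply v).comp continuous_subtype_val

theorem isOpen_openEdge (u v : V) : IsOpen (openEdge G u v) :=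
  (isOpen_ne_fun (continuous_coord u) continuous_const).inter
    (isOpen_ne_fun (continuous_coord v) continuous_const)

theorem isClosed_closedEdge (u v : V) : IsClosed (closedEdge G u v) := by
  have : closedEdge G u v = ⋂ w, ⋂ (_ : ¬ (w = u ∨ w = v)), {x | x.1 w = 0} := by
    ext x
    simp only [closedEdge, mem_ofPred_eq, mem_iInter]
    exact forall_congr' fun w => not_imp_comm
  rw [this]
  exact isClosed_iInter fun w => isClosed_iInter fun _ =>
    isClosed_eq (continuous_coord w) continuous_const

theorem mem_closedEdge_of_mem_openEdge {u v : V} (huv : u ≠ v) {x : GraphSpace G}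
    (hx : x ∈ openEdge G u v) : x ∈ closedEdge G u v ∧ G.Adj u v := by
  obtain ⟨a, b, hab, h⟩ := x.2.2
  have hu := h u hx.1
  have hv := h v hx.2
  have key : (u = a ∧ v = b) ∨ (u = b ∧ v = a) := by
    rcases hu with rfl | rfl <;> rcases hv with rfl | rfl
    exacts [absurd rfl huv, Or.inl ⟨rfl, rfl⟩, Or.inr ⟨rfl, rfl⟩, absurd rfl huv]
  rcases key with ⟨rfl, rfl⟩ | ⟨rfl, rfl⟩
  · exact ⟨h, hab.resolve_left huv⟩
  · exact ⟨fun w hw => (h w hw).symm, (hab.resolve_left huv.symm).symm⟩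

theorem eq_of_mem_openEdge {u v a b : V} (huv : u ≠ v) (hab : a ≠ b) {x : GraphSpace G}
    (hx : x ∈ openEdge G u v) (hx' : x ∈ closedEdge G a b) : (u = a ∧ v = b) ∨ (u = b ∧ v = a) := by
  have hu := hx' u hx.1
  have hv := hx' v hx.2
  rcases hu with rfl | rfl <;> rcases hv with rfl | rfl
  exacts [absurd rfl huv, Or.inl ⟨rfl, rfl⟩, Or.inr ⟨rfl, rfl⟩, absurd rfl huv]

theorem add_eq_one {u v : V} (huv : u ≠ v) {x : GraphSpace G} (hx : x ∈ closedEdge G u v) :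
    x.1 u + x.1 v = 1 := by
  classical
  rw [← sum_eq_one x, ← Finset.sum_pair huv]
  refine Finset.sum_subset (Finset.subset_univ _) fun w _ hw => ?_
  by_contra h
  have := hx w h
  simp at hw
  tauto

theorem ext_of_mem {u v : V} (huv : u ≠ v) {x y : GraphSpace G} (hx : x ∈ closedEdge G u v)
    (hy : y ∈ closedEdge G u v) (h : x.1 v = y.1 v) : x = y := by
  have h1 := add_eq_one huv hx
  have h2 := add_eq_one huv hy
  refine Subtype.ext (funext fun w => ?_)
  by_cases hw : w = u ∨ w = v
  · rcases hw with rfl | rfl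
    · linarith
    · exact h
  · rw [not_imp_comm.1 (hx w) hw, not_imp_comm.1 (hy w) hw]

theorem eq_of_mem_openEdge_left {u v w : V} (hv : u ≠ v) (hw : u ≠ w) {x : GraphSpace G}
    (h : x ∈ openEdge G u v) (h' : x ∈ openEdge G u w) : v = w := by
  rcases eq_of_mem_openEdge hv hw h (mem_closedEdge_of_mem_openEdge hw h').1 with h | h
  · exact h.2
  · exact absurd h.1 hw

section DecEq

variable [DecidableEq V]

variable (G) in
/-- The vertex `v` of the topological graph. -/
def vtx (v : V) : GraphSpace G :=
  ⟨Pi.single v 1, single_mem_stdSimplex ℝ v, v, v, Or.inl rfl, fun w hw => by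
    by_contra h
    simp only [or_self] at h
    exact hw (Pi.single_eq_of_ne h 1)⟩

theorem vtx_apply (v w : V) : (vtx G v).1 w = if w = v then 1 else 0 := Pi.single_apply v 1 w

theorem vtx_self (v : V) : (vtx G v).1 v = 1 := by simp [vtx_apply]

theorem vtx_ne {v w : V} (h : w ≠ v) : (vtx G v).1 w = 0 := by simp [vtx_apply, h]

theorem vtx_injective : Function.Injective (vtx G) := by
  intro v w h
  by_contra hvw
  have := vtx_self (G := G) v
  rw [h, vtx_ne hvw] at this
  exact zero_ne_one this

theorem vert_vtx (v : V) : vert (vtx G v) = v := by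
  by_contra h
  exact vert_ne_zero (vtx G v) (vtx_ne h)

theorem vtx_notMem_openEdge {u v w : V} (huv : u ≠ v) : vtx G w ∉ openEdge G u v := by
  rintro ⟨h1, h2⟩
  rw [vtx_apply] at h1 h2
  simp at h1 h2
  exact huv (h1.trans h2.symm)

theorem vtx_mem_closedEdge_left (u v : V) : vtx G u ∈ closedEdge G u v := by
  intro w hw
  rw [vtx_apply] at hw
  simp at hw
  exact Or.inl hw

theorem vtx_mem_closedEdge_right (u v : V) : vtx G v ∈ closedEdge G u v := by
  rw [closedEdge_comm]
  exact vtx_mem_closedEdge_left v u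

theorem eq_of_vtx_mem_closedEdge {u v w : V} (h : vtx G w ∈ closedEdge G u v) : w = u ∨ w = v :=
  h w (by rw [vtx_self]; exact one_ne_zero)

/-- A point is a vertex or lies in the interior of an edge. -/
theorem vtx_or_openEdge (x : GraphSpace G) :
    (∃ v, x = vtx G v) ∨ ∃ u v, G.Adj u v ∧ x ∈ openEdge G u v := by
  obtain ⟨u, v, huv, h⟩ := x.2.2
  have key : ∀ u, (∀ w, x.1 w ≠ 0 → w = u) → x = vtx G u := by
    intro u hu
    have h1 : x.1 u = 1 := by
      rw [← sum_eq_one x, Finset.sum_eq_single u]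
      · exact fun w _ hw => by_contra fun h => hw (hu w h)
      · simp
    refine Subtype.ext (funext fun w => ?_)
    rw [vtx_apply]
    split_ifs with hw
    · rw [hw, h1]
    · exact by_contra fun h => hw (hu w h)
  by_cases hu : x.1 u = 0
  · exact Or.inl ⟨v, key v fun w hw => (h w hw).resolve_left fun e => hw (e ▸ hu)⟩
  by_cases hv : x.1 v = 0
  · exact Or.inl ⟨u, key u fun w hw => (h w hw).resolve_right fun e => hw (e ▸ hv)⟩
  rcases huv with rfl | huv
  · exact Or.inl ⟨u, key u fun w hw => (h w hw).elim id id⟩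
  · exact Or.inr ⟨u, v, huv, hu, hv⟩

theorem eq_vtx_or_mem_openEdge {u v : V} {x : GraphSpace G} (hx : x ∈ closedEdge G u v) :
    x = vtx G u ∨ x = vtx G v ∨ x ∈ openEdge G u v := by
  rcases vtx_or_openEdge x with ⟨w, rfl⟩ | ⟨a, b, hab, hx'⟩
  · rcases eq_of_vtx_mem_closedEdge hx with rfl | rfl <;> simp
  · by_cases huv : u = v
    · subst huv
      have h1 := hx a hx'.1
      have h2 := hx b hx'.2
      simp at h1 h2
      exact absurd (h1.trans h2.symm) hab.ne
    · rcases eq_of_mem_openEdge hab.ne huv hx' hx with ⟨rfl, rfl⟩ | ⟨rfl, rfl⟩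
      · exact Or.inr (Or.inr hx')
      · exact Or.inr (Or.inr (openEdge_comm a b ▸ hx'))

/-- A preconnected set without vertices lies in one edge. -/
theorem exists_subset_openEdge {K : Set (GraphSpace G)} (hK : IsPreconnected K) (hne : K.Nonempty)
    (h : ∀ v, vtx G v ∉ K) : ∃ u v, G.Adj u v ∧ K ⊆ openEdge G u v := by
  obtain ⟨x, hx⟩ := hne
  rcases vtx_or_openEdge x with ⟨v, rfl⟩ | ⟨u, v, huv, hxe⟩
  · exact absurd hx (h v)
  -- The open edge and the complement of the closed edge are disjoint open sets that together miss
  -- only the two vertices.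
  refine ⟨u, v, huv, hK.subset_left_of_subset_union (isOpen_openEdge u v)
    (isClosed_closedEdge u v).isOpen_compl ?_ ?_ ⟨x, hx, hxe⟩⟩
  · rw [disjoint_compl_right_iff_subset]
    exact fun y hy => (mem_closedEdge_of_mem_openEdge huv.ne hy).1
  · intro y hy
    by_cases hy' : y ∈ closedEdge G u v
    · rcases eq_vtx_or_mem_openEdge hy' with rfl | rfl | hy''
      · exact absurd hy (h u)
      · exact absurd hy (h v)
      · exact Or.inl hy''
    · exact Or.inr hy'

end DecEq

/-- The segment between two points of an edge. -/
def seg (x y : GraphSpace G) : Set (GraphSpace G) := Subtype.val ⁻¹' segment ℝ x.1 y.1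

theorem seg_symm (x y : GraphSpace G) : seg x y = seg y x := by
  rw [seg, segment_symm, seg]

theorem mem_seg_iff {u v : V} (huv : u ≠ v) {x y z : GraphSpace G} (hx : x ∈ closedEdge G u v)
    (hy : y ∈ closedEdge G u v) (hxy : x.1 v ≤ y.1 v) :
    z ∈ seg x y ↔ z ∈ closedEdge G u v ∧ z.1 v ∈ Icc (x.1 v) (y.1 v) := by
  constructor
  · rintro ⟨a, b, ha, hb, hab, h⟩
    have hz : ∀ w, z.1 w = a * x.1 w + b * y.1 w := fun w => by
      rw [← h]; rfl
    refine ⟨fun w hw => ?_, ?_, ?_⟩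
    · by_contra h'
      exact hw (by rw [hz, not_imp_comm.1 (hx w) h', not_imp_comm.1 (hy w) h']; ring)
    · rw [hz, ← sub_nonneg]
      have := mul_nonneg hb (sub_nonneg.2 hxy)
      linear_combination (exp := 1) this - x.1 v * hab
    · rw [hz, ← sub_nonneg]
      have := mul_nonneg ha (sub_nonneg.2 hxy)
      linear_combination (exp := 1) this + y.1 v * hab
  · rintro ⟨hz, h1, h2⟩
    have hseg : z.1 v ∈ segment ℝ (x.1 v) (y.1 v) := by
      rw [segment_eq_Icc hxy]
      exact ⟨h1, h2⟩
    obtain ⟨a, b, ha, hb, hab, h⟩ := hseg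
    refine ⟨a, b, ha, hb, hab, funext fun w => ?_⟩
    have e1 := add_eq_one huv hx
    have e2 := add_eq_one huv hy
    have e3 := add_eq_one huv hz
    simp only [smul_eq_mul] at h
    change a * x.1 w + b * y.1 w = z.1 w
    by_cases hw : w = u ∨ w = v
    · rcases hw with rfl | rfl
      · have : x.1 w = 1 - x.1 v := by linarith
        have h4 : y.1 w = 1 - y.1 v := by linarith
        rw [this, h4]
        linear_combination hab - h - e3
      · exact h
    · rw [not_imp_comm.1 (hx w) hw, not_imp_comm.1 (hy w) hw, not_imp_comm.1 (hz w) hw]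
      ring

theorem left_mem_seg (x y : GraphSpace G) : x ∈ seg x y := left_mem_segment ℝ _ _

theorem right_mem_seg (x y : GraphSpace G) : y ∈ seg x y := right_mem_segment ℝ _ _

/-- The image of an injective path inside an edge is a segment. -/
theorem image_eq_seg {u v : V} (huv : u ≠ v) {γ : ℝ → GraphSpace G} {s t : ℝ} (hst : s ≤ t)
    (hc : ContinuousOn γ (Icc s t)) (hi : InjOn γ (Icc s t))
    (h : MapsTo γ (Icc s t) (closedEdge G u v)) : γ '' Icc s t = seg (γ s) (γ t) := by
  have hs : s ∈ Icc s t := left_mem_Icc.2 hst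
  have ht : t ∈ Icc s t := right_mem_Icc.2 hst
  -- On an edge a point is determined by its coordinate at `v`; along the path this coordinate is
  -- continuous and injective, hence strictly monotone.
  let f : ℝ → ℝ := fun r => (γ r).1 v
  have hfc : ContinuousOn f (Icc s t) := (continuous_coord v).comp_continuousOn hc
  have hfi : InjOn f (Icc s t) := fun a ha b hb hab =>
    hi ha hb (ext_of_mem huv (h ha) (h hb) hab)
  rcases hfc.strictMonoOn_of_injOn_Icc' hst hfi with hm | hm
  · ext z
    rw [mem_seg_iff huv (h hs) (h ht) (hm.monotoneOn hs ht hst)]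
    constructor
    · rintro ⟨r, hr, rfl⟩
      exact ⟨h hr, hm.monotoneOn hs hr hr.1, hm.monotoneOn hr ht hr.2⟩
    · rintro ⟨hz, hz'⟩
      obtain ⟨r, hr, hrz⟩ := intermediate_value_Icc hst hfc hz'
      exact ⟨r, hr, ext_of_mem huv (h hr) hz hrz⟩
  · ext z
    rw [seg_symm, mem_seg_iff huv (h ht) (h hs) (hm.antitoneOn hs ht hst)]
    constructor
    · rintro ⟨r, hr, rfl⟩
      exact ⟨h hr, hm.antitoneOn hr ht hr.2, hm.antitoneOn hs hr hr.1⟩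
    · rintro ⟨hz, hz'⟩
      obtain ⟨r, hr, hrz⟩ := intermediate_value_Icc' hst hfc hz'
      exact ⟨r, hr, ext_of_mem huv (h hr) hz hrz⟩

/-- A path without vertices in its interior stays in one edge. -/
theorem exists_edge [DecidableEq V] {γ : ℝ → GraphSpace G} {s t : ℝ} (hst : s < t)
    (hc : ContinuousOn γ (Icc s t)) (hi : InjOn γ (Icc s t))
    (h : ∀ r ∈ Ioo s t, ∀ v, γ r ≠ vtx G v) :
    ∃ u v, G.Adj u v ∧ MapsTo γ (Icc s t) (closedEdge G u v) ∧
      MapsTo γ (Ioo s t) (openEdge G u v) ∧ γ '' Icc s t = seg (γ s) (γ t) := by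
  obtain ⟨u, v, huv, hK⟩ := exists_subset_openEdge
    (isPreconnected_Ioo.image γ (hc.mono Ioo_subset_Icc_self))
    ((nonempty_Ioo.2 hst).image γ) (by rintro v ⟨r, hr, hrv⟩; exact h r hr v hrv)
  have h1 : MapsTo γ (Ioo s t) (openEdge G u v) := fun r hr => hK (mem_image_of_mem γ hr)
  have h2 : MapsTo γ (Icc s t) (closedEdge G u v) := by
    have : MapsTo γ (Ioo s t) (closedEdge G u v) :=
      fun r hr => (mem_closedEdge_of_mem_openEdge huv.ne (h1 hr)).1
    have h3 := this.closure_of_continuousOn (by rwa [closure_Ioo hst.ne])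
    rwa [closure_Ioo hst.ne, (isClosed_closedEdge u v).closure_eq] at h3
  exact ⟨u, v, huv, h2, h1, image_eq_seg huv.ne hst.le hc hi h2⟩

end GraphSpace

/-! ### Geodesics and the times at which they pass vertices. -/

theorem IsCompatible.continuousOn {X : Type*} {t : TopologicalSpace X} {m : MetricSpace X}
    (h : IsCompatible t m) {γ : ℝ → X} {I : Set ℝ}
    (hγ : ∀ s ∈ I, ∀ t ∈ I, m.dist (γ s) (γ t) = |s - t|) : ContinuousOn γ I := by
  subst h
  rw [Metric.continuousOn_iff]
  intro b hb ε hε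
  refine ⟨ε, hε, fun a ha hab => ?_⟩
  rw [Real.dist_eq] at hab
  exact (hγ a ha b hb).trans_lt hab

theorem _root_.List.IsInfix.of_pairwise_lt {l : List ℝ} {s t : ℝ} (h : [s, t] <:+: l)
    (hp : l.Pairwise (· < ·)) : s ∈ l ∧ t ∈ l ∧ s < t ∧ ∀ r ∈ l, ¬ (s < r ∧ r < t) := by
  obtain ⟨l1, l2, h⟩ := h
  rw [← h] at hp ⊢
  simp only [List.append_assoc, List.cons_append, List.nil_append, List.pairwise_append,
    List.pairwise_cons, List.mem_cons, List.mem_append] at hp ⊢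
  refine ⟨by simp, by simp, hp.2.1.1 t (by simp), ?_⟩
  rintro r (hr | rfl | rfl | hr) ⟨h1, h2⟩
  · exact lt_asymm h1 (hp.2.2 r hr s (by simp))
  · exact lt_irrefl _ h1
  · exact lt_irrefl _ h2
  · exact lt_asymm h2 (hp.2.1.2.1 r hr)

variable {V : Type*} [Fintype V] {G : SimpleGraph V}

/-- A distance-preserving parametrization of a geodesic. -/
structure Param {X : Type*} (m : MetricSpace X) where
  L : ℝ
  γ : ℝ → X
  L_nonneg : 0 ≤ L
  dist_eq : ∀ s ∈ Icc 0 L, ∀ t ∈ Icc 0 L, m.dist (γ s) (γ t) = |s - t|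

namespace Param

section General

variable {X : Type*} {m : MetricSpace X} (c : Param m)

theorem injOn : InjOn c.γ (Icc 0 c.L) := by
  intro s hs t ht h
  have := c.dist_eq s hs t ht
  rw [h, m.dist_self] at this
  exact sub_eq_zero.1 (abs_eq_zero.1 this.symm)

theorem mordered {l : List ℝ} (hl : l.Pairwise (· < ·)) (h : ∀ r ∈ l, r ∈ Icc 0 c.L) :
    MOrdered m (l.map c.γ) := by
  constructor
  · rw [List.Nodup, List.pairwise_map]
    refine hl.imp_of_mem fun {a b} ha hb hab e => hab.ne (c.injOn (h a ha) (h b hb) e)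
  · intro x y z hs
    obtain ⟨l', hl', e⟩ := List.sublist_map_iff.1 hs
    obtain ⟨r, l1, rfl, rfl, e1⟩ := List.map_eq_cons_iff.1 e.symm
    obtain ⟨s, l2, rfl, rfl, e2⟩ := List.map_eq_cons_iff.1 e1
    obtain ⟨t, l3, rfl, rfl, e3⟩ := List.map_eq_cons_iff.1 e2
    obtain rfl := List.map_eq_nil_iff.1 e3
    have hp := hl.sublist hl'
    simp only [List.pairwise_cons, List.mem_cons, List.not_mem_nil, or_false] at hp
    have hr := h r (hl'.subset (by simp))
    have hs := h s (hl'.subset (by simp))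
    have ht := h t (hl'.subset (by simp))
    have rs : r < s := hp.1 s (Or.inl rfl)
    have st : s < t := hp.2.1 t rfl
    refine ⟨fun e => rs.ne (c.injOn hr hs e), fun e => st.ne (c.injOn hs ht e),
      fun e => (rs.trans st).ne (c.injOn hr ht e), ?_⟩
    rw [c.dist_eq r hr s hs, c.dist_eq s hs t ht, c.dist_eq r hr t ht,
      abs_of_neg (sub_neg.2 rs), abs_of_neg (sub_neg.2 st), abs_of_neg (sub_neg.2 (rs.trans st))]
    ring

end General

open GraphSpace

variable {m : MetricSpace (GraphSpace G)} (c : Param m)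

variable [DecidableEq V]

/-- A geodesic is injective and there are finitely many vertices. -/
theorem finite_times : {t | t ∈ Icc 0 c.L ∧ ∃ v, c.γ t = vtx G v}.Finite := by
  refine Set.Finite.of_finite_image (f := c.γ) ((Set.finite_range (vtx G)).subset ?_) ?_
  · rintro _ ⟨t, ⟨-, v, hv⟩, rfl⟩
    exact ⟨v, hv.symm⟩
  · exact c.injOn.mono fun t ht => ht.1

/-- The times at which a geodesic is in a vertex. -/
noncomputable def times : List ℝ := c.finite_times.toFinset.sort

/-- The vertices on a geodesic. -/
noncomputable def core : List V := c.times.map fun t => vert (c.γ t)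

variable {c}

theorem mem_times {t : ℝ} : t ∈ c.times ↔ t ∈ Icc 0 c.L ∧ ∃ v, c.γ t = vtx G v := by
  simp [times]

theorem γ_eq_vtx {t : ℝ} (ht : t ∈ c.times) : c.γ t = vtx G (vert (c.γ t)) := by
  obtain ⟨-, v, hv⟩ := mem_times.1 ht
  rw [hv, vert_vtx]

variable (c) in
theorem times_pairwise : c.times.Pairwise (· < ·) :=
  (Finset.sortedLT_sort _).pairwise

theorem head_le {t r : ℝ} (ht : c.times.head? = some t) (hr : r ∈ c.times) : t ≤ r := by
  have hp := c.times_pairwise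
  cases h : c.times with
  | nil => simp [h] at hr
  | cons a l =>
    simp only [h, List.head?_cons, Option.some.injEq, List.mem_cons, List.pairwise_cons] at ht hr hp
    subst ht
    rcases hr with rfl | hr
    · exact le_rfl
    · exact (hp.1 r hr).le

theorem le_last {t r : ℝ} (ht : c.times.getLast? = some t) (hr : r ∈ c.times) : r ≤ t := by
  have hp := c.times_pairwise
  obtain ⟨l, h⟩ := List.getLast?_eq_some_iff.1 ht
  rw [h] at hr hp
  rw [List.pairwise_append] at hp
  rcases List.mem_append.1 hr with hr | hr
  · exact (hp.2.2 r hr t (by simp)).le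
  · exact (List.mem_singleton.1 hr).le

theorem head_mem {t : ℝ} (ht : c.times.head? = some t) : t ∈ c.times := List.mem_of_head? ht

theorem last_mem {t : ℝ} (ht : c.times.getLast? = some t) : t ∈ c.times := List.mem_of_getLast? ht

theorem head_core {t : ℝ} (ht : c.times.head? = some t) : c.core.head? = some (vert (c.γ t)) := by
  simp [core, ht]

theorem last_core {t : ℝ} (ht : c.times.getLast? = some t) :
    c.core.getLast? = some (vert (c.γ t)) := by
  simp [core, ht]

theorem core_map_vtx : c.core.map (vtx G) = c.times.map c.γ := by
  rw [core, List.map_map]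
  exact List.map_congr_left fun t ht => (γ_eq_vtx ht).symm

section Continuous

variable (hc : ContinuousOn c.γ (Icc 0 c.L))

include hc

/-- Between two successive vertices a geodesic runs through an edge. -/
theorem adj_of_successive {s t : ℝ} (hs : s ∈ c.times) (ht : t ∈ c.times) (hst : s < t)
    (h : ∀ r ∈ c.times, ¬ (s < r ∧ r < t)) :
    G.Adj (vert (c.γ s)) (vert (c.γ t)) := by
  have hs' := (mem_times.1 hs).1
  have ht' := (mem_times.1 ht).1
  have hsub : Icc s t ⊆ Icc 0 c.L := Icc_subset_Icc hs'.1 ht'.2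
  obtain ⟨u, v, huv, h1, -, -⟩ := exists_edge hst (hc.mono hsub) (c.injOn.mono hsub)
    (fun r hr v hv => h r (mem_times.2 ⟨hsub (Ioo_subset_Icc_self hr), v, hv⟩) hr)
  have hs2 := h1 (left_mem_Icc.2 hst.le)
  have ht2 := h1 (right_mem_Icc.2 hst.le)
  have hne : vert (c.γ s) ≠ vert (c.γ t) := fun e => hst.ne <| c.injOn hs' ht' <| by
    rw [γ_eq_vtx hs, γ_eq_vtx ht, e]
  rw [γ_eq_vtx hs] at hs2
  rw [γ_eq_vtx ht] at ht2
  rcases eq_of_vtx_mem_closedEdge hs2 with e | e <;>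
    rcases eq_of_vtx_mem_closedEdge ht2 with e' | e' <;> rw [e, e'] at hne ⊢
  exacts [absurd rfl hne, huv, huv.symm, absurd rfl hne]

/-- A part of a path without vertices that leads to the vertex `v` lies in an edge at `v`. -/
theorem exists_openEdge {K : Set ℝ} (hK : IsPreconnected K) (hne : K.Nonempty)
    (hK' : ∀ r ∈ K, r ∈ Icc 0 c.L ∧ r ∉ c.times) {t : ℝ} (ht : t ∈ c.times) (htK : t ∈ closure K) :
    ∃ w, G.Adj (vert (c.γ t)) w ∧ MapsTo c.γ K (openEdge G (vert (c.γ t)) w) := by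
  have hsub : K ⊆ Icc 0 c.L := fun r hr => (hK' r hr).1
  obtain ⟨u, v, huv, h⟩ := exists_subset_openEdge (hK.image c.γ (hc.mono hsub)) (hne.image _) (by
    rintro v ⟨r, hr, hrv⟩
    exact (hK' r hr).2 (mem_times.2 ⟨hsub hr, v, hrv⟩))
  have h1 : c.γ t ∈ closedEdge G u v := by
    have h2 : c.γ t ∈ closure (c.γ '' K) :=
      ((hc t (mem_times.1 ht).1).mono hsub).mem_closure_image htK
    refine (isClosed_closedEdge u v).closure_subset_iff.2 ?_ h2
    exact fun y hy => (mem_closedEdge_of_mem_openEdge huv.ne (h hy)).1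
  rw [γ_eq_vtx ht] at h1
  rcases eq_of_vtx_mem_closedEdge h1 with e | e <;> rw [e]
  · exact ⟨v, huv, fun r hr => h (mem_image_of_mem _ hr)⟩
  · exact ⟨u, huv.symm, fun r hr => openEdge_comm u v ▸ h (mem_image_of_mem _ hr)⟩

end Continuous

theorem times_infix {s t : ℝ} (h : [s, t] <:+: c.times) :
    s ∈ c.times ∧ t ∈ c.times ∧ s < t ∧ ∀ r ∈ c.times, ¬ (s < r ∧ r < t) :=
  h.of_pairwise_lt c.times_pairwise

theorem core_infix {s t : ℝ} (h : [s, t] <:+: c.times) :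
    [vert (c.γ s), vert (c.γ t)] <:+: c.core :=
  h.map fun t => vert (c.γ t)

theorem _root_.List.exists_infix_of_lt {l : List ℝ} {x a : ℝ} (ha : a ∈ l) (hax : a ≤ x)
    (hx : x ∉ l) (hl : ∀ b ∈ l.getLast?, x < b) : ∃ s t, [s, t] <:+: l ∧ s < x ∧ x < t := by
  induction l generalizing a with
  | nil => simp at ha
  | cons b l ih =>
    cases l with
    | nil =>
      simp only [List.mem_singleton] at ha
      subst ha
      exact absurd (hl a (by simp)) (not_lt.2 hax)
    | cons d l =>
      simp only [List.mem_cons, not_or] at hx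
      have hl' : ∀ b ∈ (d :: l).getLast?, x < b := by simpa using hl
      rcases lt_or_ge x d with h | h
      · rcases List.mem_cons.1 ha with rfl | ha'
        · exact ⟨a, d, ⟨[], l, by simp⟩, hax.lt_of_ne (Ne.symm hx.1), h⟩
        · obtain ⟨s, t, h1, h2⟩ := ih ha' hax (by simp [hx]) hl'
          exact ⟨s, t, h1.trans (List.infix_cons (List.infix_refl _)), h2⟩
      · obtain ⟨s, t, h1, h2⟩ := ih (a := d) (by simp) h (by simp [hx]) hl'
        exact ⟨s, t, h1.trans (List.infix_cons (List.infix_refl _)), h2⟩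

/-- The position of a time with respect to the vertices. -/
theorem time_cases {r : ℝ} (hr : r ∉ c.times) : c.times = [] ∨
    (∃ t, c.times.head? = some t ∧ r < t) ∨ (∃ t, c.times.getLast? = some t ∧ t < r) ∨
      ∃ s t, [s, t] <:+: c.times ∧ s < r ∧ r < t := by
  by_cases h0 : c.times = []
  · exact Or.inl h0
  have h1 : c.times.head? = some (c.times.head h0) := List.head?_eq_some_head h0
  have h2 : c.times.getLast? = some (c.times.getLast h0) := List.getLast?_eq_some_getLast h0
  rcases lt_or_ge r (c.times.head h0) with h | h
  · exact Or.inr (Or.inl ⟨_, h1, h⟩)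
  rcases lt_or_ge r (c.times.getLast h0) with h' | h'
  · exact Or.inr (Or.inr (Or.inr (List.exists_infix_of_lt (head_mem h1) h hr (by simpa [h2]))))
  · exact Or.inr (Or.inr (Or.inl ⟨_, h2, h'.lt_of_ne fun e => hr (e ▸ last_mem h2)⟩))

end Param

/-! ### How geodesics cover an edge. -/

variable {V : Type*} [Fintype V] {G : SimpleGraph V}

namespace GraphSpace

variable [DecidableEq V]

theorem image_openEdge {u v : V} (h : G.Adj u v) :
    Subtype.val '' openEdge G u v = openSegment ℝ (Pi.single u (1 : ℝ)) (Pi.single v 1) := by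
  have huv := h.ne
  ext y
  constructor
  · rintro ⟨x, hx, rfl⟩
    have hx' := (mem_closedEdge_of_mem_openEdge huv hx).1
    refine ⟨x.1 u, x.1 v, (nonneg x u).lt_of_ne' hx.1, (nonneg x v).lt_of_ne' hx.2,
      add_eq_one huv hx', funext fun w => ?_⟩
    simp only [Pi.add_apply, Pi.smul_apply, smul_eq_mul, Pi.single_apply]
    by_cases hu : w = u
    · subst hu
      simp [huv]
    · by_cases hv : w = v
      · subst hv
        simp [hu]
      · simp [hu, hv, not_imp_comm.1 (hx' w)]
  · rintro ⟨a, b, ha, hb, hab, rfl⟩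
    refine ⟨⟨_, (convex_stdSimplex ℝ V).segment_subset (single_mem_stdSimplex ℝ u)
      (single_mem_stdSimplex ℝ v) ⟨a, b, ha.le, hb.le, hab, rfl⟩, u, v, Or.inr h, ?_⟩, ?_, rfl⟩
    · intro w hw
      by_contra h'
      rw [not_or] at h'
      simp [h'] at hw
    · simp [openEdge, huv, huv.symm, ha.ne', hb.ne']

theorem isPreconnected_openEdge {u v : V} (h : G.Adj u v) : IsPreconnected (openEdge G u v) := by
  have hi : Topology.IsInducing (Subtype.val : GraphSpace G → V → ℝ) := ⟨rfl⟩
  rw [← hi.isPreconnected_image, image_openEdge h]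
  exact (convex_openSegment _ _).isPreconnected

theorem vtx_mem_closure_openEdge {u v : V} (h : G.Adj u v) :
    vtx G u ∈ closure (openEdge G u v) := by
  have hi : Topology.IsInducing (Subtype.val : GraphSpace G → V → ℝ) := ⟨rfl⟩
  rw [hi.closure_eq_preimage_closure_image, image_openEdge h, closure_openSegment]
  exact left_mem_segment ℝ _ _

end GraphSpace

open GraphSpace

namespace Param

variable [DecidableEq V] {m : MetricSpace (GraphSpace G)} {c : Param m}

variable (c) in
/-- The times at which the geodesic `c` is beyond its last vertex, which is `u`, or before its
first vertex, which is `u`. -/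
def endTimes (u : V) : Set ℝ :=
  {r | (∃ t, c.times.head? = some t ∧ c.γ t = vtx G u ∧ r ∈ Icc 0 t) ∨
    ∃ t, c.times.getLast? = some t ∧ c.γ t = vtx G u ∧ r ∈ Icc t c.L}

theorem endTimes_subset (u : V) : c.endTimes u ⊆ Icc 0 c.L := by
  rintro r (⟨t, ht, -, hr⟩ | ⟨t, ht, -, hr⟩)
  · exact ⟨hr.1, hr.2.trans (mem_times.1 (head_mem ht)).1.2⟩
  · exact ⟨(mem_times.1 (last_mem ht)).1.1.trans hr.1, hr.2⟩

theorem isCompact_endTimes (u : V) : IsCompact (c.endTimes u) := by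
  refine isCompact_Icc.of_isClosed_subset ?_ (endTimes_subset u)
  have h1 : c.endTimes u =
      (⋃ t ∈ {t | t ∈ c.times ∧ c.times.head? = some t ∧ c.γ t = vtx G u}, Icc 0 t) ∪
      ⋃ t ∈ {t | t ∈ c.times ∧ c.times.getLast? = some t ∧ c.γ t = vtx G u}, Icc t c.L := by
    ext r
    simp only [endTimes, mem_union, mem_iUnion, mem_ofPred_eq, exists_prop]
    refine or_congr (exists_congr fun t => ?_) (exists_congr fun t => ?_)
    · exact ⟨fun h => ⟨⟨head_mem h.1, h.1, h.2.1⟩, h.2.2⟩, fun h => ⟨h.1.2.1, h.1.2.2, h.2⟩⟩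
    · exact ⟨fun h => ⟨⟨last_mem h.1, h.1, h.2.1⟩, h.2.2⟩, fun h => ⟨h.1.2.1, h.1.2.2, h.2⟩⟩
  have hf : {t | t ∈ c.times}.Finite := List.finite_toSet c.times
  rw [h1]
  exact ((hf.subset fun t h => h.1).isClosed_biUnion fun _ _ => isClosed_Icc).union
    ((hf.subset fun t h => h.1).isClosed_biUnion fun _ _ => isClosed_Icc)

/-- The times before the first vertex and after the last one contain no further vertex. -/
theorem eq_of_vtx_mem_endTimes {u v : V} {r : ℝ} (hr : r ∈ c.endTimes u) (h : c.γ r = vtx G v) :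
    u = v := by
  have hr' : r ∈ c.times := mem_times.2 ⟨endTimes_subset u hr, v, h⟩
  rcases hr with ⟨t, ht, htu, hr⟩ | ⟨t, ht, htu, hr⟩
  · obtain rfl := hr.2.antisymm (head_le ht hr')
    exact vtx_injective (htu.symm.trans h)
  · obtain rfl := hr.1.antisymm (le_last ht hr')
    exact vtx_injective (htu.symm.trans h)

/-- The edge `uv` is a part of the geodesic `c`. -/
def Whole (c : Param m) (u v : V) : Prop := [u, v] <:+: c.core ∨ [v, u] <:+: c.core

/-- The geodesic `c` lies in the interior of the edge `uv`. -/
def Inside (c : Param m) (u v : V) : Prop :=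
  c.times = [] ∧ MapsTo c.γ (Icc 0 c.L) (openEdge G u v)

/-- The geodesic `c` leads from the vertex `u`, which is its first or last one, to `x`. -/
def Reaches (c : Param m) (u : V) (x : GraphSpace G) : Prop := x ∈ c.γ '' c.endTimes u

section Continuous

variable (hc : ContinuousOn c.γ (Icc 0 c.L))

include hc

/-- The cases are the positions of the time at which the geodesic is at `x`: there is no vertex time
at all, or the time is before the first, after the last, or between two successive ones. -/
theorem cases_openEdge {u v : V} (huv : G.Adj u v) {x : GraphSpace G} (hx : x ∈ openEdge G u v)
    (hxc : x ∈ c.γ '' Icc 0 c.L) :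
    c.Whole u v ∨ c.Inside u v ∨ c.Reaches u x ∨ c.Reaches v x := by
  obtain ⟨r, hr, rfl⟩ := hxc
  have hrt : r ∉ c.times := fun h => vtx_notMem_openEdge huv.ne (γ_eq_vtx h ▸ hx)
  -- A stretch without vertices through `x` that leads to a vertex lies in an edge at this vertex;
  -- the edge contains `x`, so it is `uv`.
  have key : ∀ {K : Set ℝ}, IsPreconnected K → r ∈ K → (∀ r ∈ K, r ∈ Icc 0 c.L ∧ r ∉ c.times) →
      ∀ {t}, t ∈ c.times → t ∈ closure K → c.γ t = vtx G u ∨ c.γ t = vtx G v := by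
    intro K hK hrK hK' t ht htK
    obtain ⟨w, hw, h⟩ := exists_openEdge hc hK ⟨r, hrK⟩ hK' ht htK
    rw [γ_eq_vtx ht]
    rcases eq_of_mem_openEdge huv.ne hw.ne hx
      (mem_closedEdge_of_mem_openEdge hw.ne (h hrK)).1 with ⟨h1, -⟩ | ⟨-, h1⟩
    · exact Or.inl (congrArg _ h1.symm)
    · exact Or.inr (congrArg _ h1.symm)
  rcases c.time_cases hrt with h | ⟨t, ht, hrt'⟩ | ⟨t, ht, hrt'⟩ | ⟨s, t, hst, h1, h2⟩
  · refine Or.inr (Or.inl ⟨h, ?_⟩)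
    obtain ⟨a, b, hab, h'⟩ := exists_subset_openEdge (isPreconnected_Icc.image c.γ hc)
      ⟨c.γ r, mem_image_of_mem _ hr⟩ (by
        rintro v ⟨r, hr, hrv⟩
        have := mem_times.2 ⟨hr, v, hrv⟩
        simp [h] at this)
    rcases eq_of_mem_openEdge huv.ne hab.ne hx (mem_closedEdge_of_mem_openEdge hab.ne
      (h' (mem_image_of_mem _ hr))).1 with ⟨rfl, rfl⟩ | ⟨rfl, rfl⟩
    · exact fun r hr => h' (mem_image_of_mem _ hr)
    · exact fun r hr => openEdge_comm v u ▸ h' (mem_image_of_mem _ hr)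
  · have := key isPreconnected_Ico ⟨hr.1, hrt'⟩ (fun r hr => ⟨⟨hr.1, hr.2.le.trans
      (mem_times.1 (head_mem ht)).1.2⟩, fun h => (head_le ht h).not_gt hr.2⟩) (head_mem ht)
      (by rw [closure_Ico (hr.1.trans_lt hrt').ne]; exact right_mem_Icc.2 (hr.1.trans hrt'.le))
    refine Or.inr (Or.inr (this.imp (fun h => ?_) fun h => ?_))
    all_goals exact mem_image_of_mem _ (Or.inl ⟨t, ht, h, hr.1, hrt'.le⟩)
  · have := key isPreconnected_Ioc ⟨hrt', hr.2⟩ (fun r hr => ⟨⟨(mem_times.1 (last_mem ht)).1.1.trans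
      hr.1.le, hr.2⟩, fun h => (le_last ht h).not_gt hr.1⟩) (last_mem ht)
      (by rw [closure_Ioc (hrt'.trans_le hr.2).ne]; exact left_mem_Icc.2 (hrt'.le.trans hr.2))
    refine Or.inr (Or.inr (this.imp (fun h => ?_) fun h => ?_))
    all_goals exact mem_image_of_mem _ (Or.inr ⟨t, ht, h, hrt'.le, hr.2⟩)
  · left
    obtain ⟨hs, ht, hst', hn⟩ := times_infix hst
    have hsL := (mem_times.1 hs).1
    have htL := (mem_times.1 ht).1
    have hK : ∀ r ∈ Ioo s t, r ∈ Icc 0 c.L ∧ r ∉ c.times := fun r hr =>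
      ⟨⟨hsL.1.trans hr.1.le, hr.2.le.trans htL.2⟩, fun h => hn r h hr⟩
    have hsc : s ∈ closure (Ioo s t) := by
      rw [closure_Ioo hst'.ne]; exact left_mem_Icc.2 hst'.le
    have htc : t ∈ closure (Ioo s t) := by
      rw [closure_Ioo hst'.ne]; exact right_mem_Icc.2 hst'.le
    have hne : c.γ s ≠ c.γ t := fun e => hst'.ne (c.injOn hsL htL e)
    have hinf := core_infix hst
    rcases key isPreconnected_Ioo ⟨h1, h2⟩ hK hs hsc with e | e <;>
      rcases key isPreconnected_Ioo ⟨h1, h2⟩ hK ht htc with e' | e' <;>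
      rw [e, e'] at hne hinf <;> simp only [vert_vtx] at hinf
    exacts [absurd rfl hne, Or.inl hinf, Or.inr hinf, absurd rfl hne]

end Continuous

end Param

/-- Each edge is contained in a geodesic of a finite cover, or contains one, or there are
geodesics that lead from its ends to a point in its interior. -/
theorem edge_cases [DecidableEq V] {ι : Type*} [Finite ι] {m : MetricSpace (GraphSpace G)}
    (c : ι → Param m) (hc : ∀ i, ContinuousOn (c i).γ (Icc 0 (c i).L))
    (hcov : ∀ x, ∃ i, x ∈ (c i).γ '' Icc 0 (c i).L) {u v : V} (huv : G.Adj u v) :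
    (∃ i, (c i).Whole u v ∨ (c i).Inside u v) ∨
      ∃ x ∈ openEdge G u v, (∃ i, (c i).Reaches u x) ∧ ∃ i, (c i).Reaches v x := by
  by_contra! hcon
  obtain ⟨hcon, hx⟩ := hcon
  -- If no geodesic contains the edge or lies inside it, the finitely many compact pieces that come
  -- out of `u` and of `v` cover it.
  have hclosed : ∀ u, IsClosed (⋃ i, (c i).γ '' (c i).endTimes u) := fun u =>
    isClosed_iUnion_of_finite fun i => ((Param.isCompact_endTimes u).image_of_continuousOn
      ((hc i).mono (Param.endTimes_subset u))).isClosed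
  have hsub : openEdge G u v ⊆
      (⋃ i, (c i).γ '' (c i).endTimes u) ∪ ⋃ i, (c i).γ '' (c i).endTimes v := by
    intro x hx
    obtain ⟨i, hi⟩ := hcov x
    rcases Param.cases_openEdge (hc i) huv hx hi with h | h | h | h
    · exact absurd h (hcon i).1
    · exact absurd h (hcon i).2
    · exact Or.inl (mem_iUnion.2 ⟨i, h⟩)
    · exact Or.inr (mem_iUnion.2 ⟨i, h⟩)
  have hnv : ∀ {u v : V}, u ≠ v → vtx G u ∉ ⋃ i, (c i).γ '' (c i).endTimes v := by
    intro u v huv h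
    obtain ⟨i, r, hr, e⟩ := mem_iUnion.1 h
    exact huv (Param.eq_of_vtx_mem_endTimes hr e).symm
  -- Otherwise the pieces from `v`, which form a closed set, would contain the open edge and thus
  -- also `u` in its closure.
  have hne : ∀ {u v : V}, G.Adj u v → openEdge G u v ⊆
      (⋃ i, (c i).γ '' (c i).endTimes u) ∪ ⋃ i, (c i).γ '' (c i).endTimes v →
      (openEdge G u v ∩ ⋃ i, (c i).γ '' (c i).endTimes u).Nonempty := by
    intro u v huv hsub
    by_contra h
    have h1 : openEdge G u v ⊆ ⋃ i, (c i).γ '' (c i).endTimes v := fun x hx =>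
      (hsub hx).resolve_left fun h' => h ⟨x, hx, h'⟩
    exact hnv huv.ne ((hclosed v).closure_subset_iff.2 h1 (vtx_mem_closure_openEdge huv))
  -- Two closed sets that cover a connected open edge and both meet it have a common point there.
  obtain ⟨x, hx1, hx2, hx3⟩ := isPreconnected_closed_iff.1 (isPreconnected_openEdge huv) _ _
    (hclosed u) (hclosed v) hsub (hne huv hsub) (by
      rw [openEdge_comm]
      exact hne huv.symm (by rwa [openEdge_comm, union_comm]))
  obtain ⟨i, hi⟩ := mem_iUnion.1 hx2
  obtain ⟨j, hj⟩ := mem_iUnion.1 hx3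
  exact hx x hx1 ⟨i, hi⟩ j hj

/-! ### The combinatorial path of a geodesic. -/

variable {V : Type*} [Fintype V] [DecidableEq V] {G : SimpleGraph V}

open GraphSpace

/-- The points that belong to vertices and, by the choice `M` of a point on each edge, to edges. -/
noncomputable def edgePt (M : Sym2 V → GraphSpace G) (p : V × V) : GraphSpace G :=
  if p.1 = p.2 then vtx G p.1 else M s(p.1, p.2)

theorem edgePt_self (M : Sym2 V → GraphSpace G) (v : V) : edgePt M (v, v) = vtx G v := if_pos rfl

theorem edgePt_ne (M : Sym2 V → GraphSpace G) {u v : V} (h : u ≠ v) :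
    edgePt M (u, v) = M s(u, v) := if_neg h

theorem edgePt_swap (M : Sym2 V → GraphSpace G) (p : V × V) : edgePt M p.swap = edgePt M p := by
  obtain ⟨u, v⟩ := p
  by_cases h : u = v
  · subst h
    rfl
  · rw [Prod.swap_prod_mk, edgePt_ne M h, edgePt_ne M (Ne.symm h), Sym2.eq_swap]

namespace Param

variable {m : MetricSpace (GraphSpace G)} {c : Param m}

/-- The times before the first vertex, at time `t`, or after the last vertex, at time `t`. -/
def IsEnd (c : Param m) (K : Set ℝ) (t : ℝ) : Prop :=
  (c.times.head? = some t ∧ K = Ico 0 t) ∨ (c.times.getLast? = some t ∧ K = Ioc t c.L)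

theorem IsEnd.mem {K : Set ℝ} {t : ℝ} (h : c.IsEnd K t) : t ∈ c.times := by
  rcases h with ⟨h, -⟩ | ⟨h, -⟩
  exacts [head_mem h, last_mem h]

theorem IsEnd.subset {K : Set ℝ} {t : ℝ} (h : c.IsEnd K t) {r : ℝ} (hr : r ∈ K) :
    r ∈ Icc 0 c.L ∧ r ∉ c.times := by
  rcases h with ⟨h, rfl⟩ | ⟨h, rfl⟩
  · exact ⟨⟨hr.1, hr.2.le.trans (mem_times.1 (head_mem h)).1.2⟩, fun h' => (head_le h h').not_gt hr.2⟩
  · exact ⟨⟨(mem_times.1 (last_mem h)).1.1.trans hr.1.le, hr.2⟩, fun h' => (le_last h h').not_gt hr.1⟩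

theorem IsEnd.exists_openEdge (hc : ContinuousOn c.γ (Icc 0 c.L)) {K : Set ℝ} {t : ℝ}
    (h : c.IsEnd K t) (hne : K.Nonempty) :
    ∃ w, G.Adj (vert (c.γ t)) w ∧ MapsTo c.γ K (openEdge G (vert (c.γ t)) w) := by
  refine Param.exists_openEdge hc ?_ hne (fun r hr => h.subset hr) h.mem ?_
  · rcases h with ⟨-, rfl⟩ | ⟨-, rfl⟩
    exacts [isPreconnected_Ico, isPreconnected_Ioc]
  · obtain ⟨r, hr⟩ := hne
    rcases h with ⟨-, rfl⟩ | ⟨-, rfl⟩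
    · have := hr.1.trans_lt hr.2
      rw [closure_Ico this.ne]
      exact right_mem_Icc.2 this.le
    · have := hr.1.trans_le hr.2
      rw [closure_Ioc this.ne]
      exact left_mem_Icc.2 this.le

/-- Beyond its last vertex a geodesic stays in one edge, so it meets the chosen point of at most one
edge there; the option records the other end of that edge. -/
theorem IsEnd.exists_option (hc : ContinuousOn c.γ (Icc 0 c.L)) {K : Set ℝ} {t : ℝ}
    (h : c.IsEnd K t) (M : Sym2 V → GraphSpace G) : ∃ o : Option V,
    (∀ w ∈ o, G.Adj (vert (c.γ t)) w ∧ MapsTo c.γ K (openEdge G (vert (c.γ t)) w) ∧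
      M s(vert (c.γ t), w) ∈ c.γ '' K) ∧
    ∀ w, vert (c.γ t) ≠ w → M s(vert (c.γ t), w) ∈ openEdge G (vert (c.γ t)) w →
      M s(vert (c.γ t), w) ∈ c.γ '' K → w ∈ o := by
  by_cases h' : ∃ w, G.Adj (vert (c.γ t)) w ∧ MapsTo c.γ K (openEdge G (vert (c.γ t)) w) ∧
      M s(vert (c.γ t), w) ∈ c.γ '' K
  · obtain ⟨w, h1, h2, h3⟩ := h'
    refine ⟨some w, fun w' hw => ?_, fun w' hw h4 h5 => ?_⟩
    · obtain rfl := Option.some.inj hw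
      exact ⟨h1, h2, h3⟩
    · obtain ⟨r, hr, e⟩ := h5
      rw [← e] at h4
      rw [eq_of_mem_openEdge_left h1.ne hw (h2 hr) h4]
      rfl
  · refine ⟨none, fun w hw => by simp at hw, fun w hw h4 h5 => absurd ?_ h'⟩
    obtain ⟨r, hr, e⟩ := h5
    obtain ⟨w', h1, h2⟩ := h.exists_openEdge hc ⟨r, hr⟩
    rw [← e] at h4
    obtain rfl := eq_of_mem_openEdge_left h1.ne hw (h2 hr) h4
    exact ⟨w', h1, h2, r, hr, e⟩

/-- `a` is the path of the geodesic `c`, if `M` gives the points at which paths end. -/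
structure IsPath (c : Param m) (M : Sym2 V → GraphSpace G) (a : PArc V) : Prop where
  valid : a.Valid G m (edgePt M)
  whole : ∀ u v, u ≠ v → c.Whole u v ∨ c.Inside u v → [u, v] <:+: a.core ∨ [v, u] <:+: a.core
  reaches : ∀ u v, u ≠ v → M s(u, v) ∈ openEdge G u v → c.Reaches u (M s(u, v)) → a.EndAt u v
  -- What is needed to recover the geodesic as a set; all paths of the three families in `K₅` are
  -- prolonged at both ends.
  ends : a.pre ≠ [] → a.post ≠ [] → ∃ s t r r' w w',
    c.times.head? = some s ∧ c.times.getLast? = some t ∧ a.core = c.core ∧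
    a.pre = [(w, vert (c.γ s))] ∧ a.post = [(vert (c.γ t), w')] ∧
    G.Adj (vert (c.γ s)) w ∧ G.Adj (vert (c.γ t)) w' ∧
    r ∈ Ico 0 s ∧ c.γ r = M s(vert (c.γ s), w) ∧
    r' ∈ Ioc t c.L ∧ c.γ r' = M s(vert (c.γ t), w') ∧
    MapsTo c.γ (Ico 0 s) (openEdge G (vert (c.γ s)) w) ∧
    MapsTo c.γ (Ioc t c.L) (openEdge G (vert (c.γ t)) w')

/-- The geodesic is replaced by the path `u, v`. It covers the edge, and there is no betweenness to
verify for two points. -/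
theorem exists_isPath_of_inside (M : Sym2 V → GraphSpace G) {u v : V} (huv : G.Adj u v)
    (h : c.Inside u v) : ∃ a, IsPath c M a := by
  have hcore : c.core = [] := by simp [core, h.1]
  refine ⟨⟨[], [u, v], []⟩, ⟨by simp, by simp [huv], by simp [huv.ne], Or.inl rfl, Or.inl rfl,
    ?_, ?_⟩, ?_, ?_, ?_⟩
  · simp only [PArc.pts, List.map_cons, List.map_nil, List.nil_append, List.append_nil,
      edgePt_self, List.nodup_cons, List.mem_singleton, List.not_mem_nil, not_false_eq_true,
      List.nodup_nil, and_true]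
    exact fun e => huv.ne (vtx_injective e)
  · intro x y z hs
    have := hs.length_le
    simp [PArc.pts] at this
  · rintro a b hab (h' | h')
    · simp [Whole, hcore] at h'
    · have h1 := h.2 (left_mem_Icc.2 c.L_nonneg)
      have h2 := h'.2 (left_mem_Icc.2 c.L_nonneg)
      rcases eq_of_mem_openEdge hab huv.ne h2 (mem_closedEdge_of_mem_openEdge huv.ne h1).1 with
        ⟨rfl, rfl⟩ | ⟨rfl, rfl⟩
      · exact Or.inl (List.infix_refl _)
      · exact Or.inr (List.infix_refl _)
  · rintro a b - - ⟨r, ⟨t, ht, -⟩ | ⟨t, ht, -⟩, -⟩ <;> simp [h.1] at ht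
  · simp

theorem exists_isPath_of_times (hc : ContinuousOn c.γ (Icc 0 c.L)) (M : Sym2 V → GraphSpace G)
    (h : c.times ≠ []) : ∃ a, IsPath c M a := by
  obtain ⟨s, hs⟩ : ∃ s, c.times.head? = some s := ⟨_, List.head?_eq_some_head h⟩
  obtain ⟨t, ht⟩ : ∃ t, c.times.getLast? = some t := ⟨_, List.getLast?_eq_some_getLast h⟩
  have es : c.IsEnd (Ico 0 s) s := Or.inl ⟨hs, rfl⟩
  have et : c.IsEnd (Ioc t c.L) t := Or.inr ⟨ht, rfl⟩
  obtain ⟨o, h1, h2⟩ := es.exists_option hc M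
  obtain ⟨o', h1', h2'⟩ := et.exists_option hc M
  have hcore : c.core ≠ [] := by simpa [core] using h
  have hpre : ∃ l : List ℝ, l.map c.γ = (o.map fun w => (w, vert (c.γ s))).toList.map (edgePt M) ∧
      l.Pairwise (· < ·) ∧ ∀ r ∈ l, r ∈ Ico 0 s := by
    cases o with
    | none => exact ⟨[], by simp⟩
    | some w =>
      obtain ⟨h3, -, r, hr, e⟩ := h1 w rfl
      refine ⟨[r], ?_, by simp, by simpa using hr⟩
      simp [edgePt_ne M h3.ne', e, Sym2.eq_swap (a := w)]
  have hpost : ∃ l : List ℝ, l.map c.γ =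
      (o'.map fun w => (vert (c.γ t), w)).toList.map (edgePt M) ∧
      l.Pairwise (· < ·) ∧ ∀ r ∈ l, r ∈ Ioc t c.L := by
    cases o' with
    | none => exact ⟨[], by simp⟩
    | some w =>
      obtain ⟨h3, -, r, hr, e⟩ := h1' w rfl
      refine ⟨[r], ?_, by simp, by simpa using hr⟩
      simp [edgePt_ne M h3.ne, e]
  obtain ⟨l, e, hl, hl'⟩ := hpre
  obtain ⟨l', e', hp, hp'⟩ := hpost
  have hst : s ≤ t := le_last ht (head_mem hs)
  refine ⟨⟨(o.map fun w => (w, vert (c.γ s))).toList, c.core,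
    (o'.map fun w => (vert (c.γ t), w)).toList⟩, ⟨hcore, ?_, ?_, ?_, ?_, ?_⟩, ?_, ?_, ?_⟩
  · rw [core, List.isChain_map, List.isChain_iff_forall_rel_of_append_cons_cons]
    intro a b l₁ l₂ hl
    have hin : [a, b] <:+: c.times := ⟨l₁, l₂, by simp [hl]⟩
    obtain ⟨ha, hb, hab, hn⟩ := times_infix hin
    exact adj_of_successive hc ha hb hab hn
  · have := (c.mordered c.times_pairwise fun r hr => (mem_times.1 hr).1).1
    rw [← core_map_vtx] at this
    exact this.of_map _
  · cases o with
    | none => exact Or.inl rfl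
    | some w => exact Or.inr ⟨_, w, head_core hs, (h1 w rfl).1, rfl⟩
  · cases o' with
    | none => exact Or.inl rfl
    | some w => exact Or.inr ⟨_, w, last_core ht, (h1' w rfl).1, rfl⟩
  · have e3 : (c.core.map fun v => (v, v)).map (edgePt M) = c.times.map c.γ := by
      rw [List.map_map, ← core_map_vtx]
      exact List.map_congr_left fun v _ => edgePt_self M v
    rw [PArc.pts, List.map_append, List.map_append, ← e, ← e', e3, ← List.map_append,
      ← List.map_append]
    refine c.mordered ?_ ?_
    · rw [List.pairwise_append, List.pairwise_append]
      refine ⟨⟨hl, c.times_pairwise, fun a ha b hb => (hl' a ha).2.trans_le (head_le hs hb)⟩, hp,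
        fun a ha b hb => ?_⟩
      rcases List.mem_append.1 ha with ha | ha
      · exact (hl' a ha).2.trans_le (hst.trans (hp' b hb).1.le)
      · exact (le_last ht ha).trans_lt (hp' b hb).1
    · intro r hr
      rcases List.mem_append.1 hr with hr | hr
      · rcases List.mem_append.1 hr with hr | hr
        · exact (es.subset (hl' r hr)).1
        · exact (mem_times.1 hr).1
      · exact (et.subset (hp' r hr)).1
  · rintro u v - (h' | h')
    · exact h'
    · exact absurd h'.1 h
  · rintro u v huv hM ⟨r, ⟨t', ht', htu, hr⟩ | ⟨t', ht', htu, hr⟩, er⟩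
    · obtain rfl := Option.some.inj (hs.symm.trans ht')
      have hu : vert (c.γ s) = u := by rw [htu, vert_vtx]
      have hr' : r ∈ Ico 0 s := by
        refine ⟨hr.1, hr.2.lt_of_ne ?_⟩
        rintro rfl
        exact vtx_notMem_openEdge huv (w := u) (by rw [← htu, er]; exact hM)
      have := h2 v (by rwa [hu]) (by rwa [hu]) (by rw [hu]; exact ⟨r, hr', er⟩)
      refine Or.inl ⟨by rw [← hu]; exact head_core hs, ?_⟩
      rw [Option.mem_def] at this
      simp [this, hu]
    · obtain rfl := Option.some.inj (ht.symm.trans ht')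
      have hu : vert (c.γ t) = u := by rw [htu, vert_vtx]
      have hr' : r ∈ Ioc t c.L := by
        refine ⟨hr.1.lt_of_ne ?_, hr.2⟩
        rintro rfl
        exact vtx_notMem_openEdge huv (w := u) (by rw [← htu, er]; exact hM)
      have := h2' v (by rwa [hu]) (by rwa [hu]) (by rw [hu]; exact ⟨r, hr', er⟩)
      refine Or.inr ⟨by rw [← hu]; exact last_core ht, ?_⟩
      rw [Option.mem_def] at this
      simp [this, hu]
  · intro h3 h4
    cases o with
    | none => simp at h3
    | some w =>
      cases o' with
      | none => simp at h4
      | some w' =>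
        obtain ⟨a1, a2, r, a3, a4⟩ := h1 w rfl
        obtain ⟨b1, b2, r', b3, b4⟩ := h1' w' rfl
        exact ⟨s, t, r, r', w, w', hs, ht, rfl, rfl, rfl, a1, b1, a3, a4, b3, b4, a2, b2⟩

theorem exists_isPath (hc : ContinuousOn c.γ (Icc 0 c.L)) (M : Sym2 V → GraphSpace G) :
    ∃ a, IsPath c M a := by
  by_cases h : c.times = []
  · obtain ⟨u, v, huv, h'⟩ := exists_subset_openEdge (isPreconnected_Icc.image c.γ hc)
      ⟨c.γ 0, mem_image_of_mem _ (left_mem_Icc.2 c.L_nonneg)⟩ (by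
        rintro v ⟨r, hr, hrv⟩
        have := mem_times.2 ⟨hr, v, hrv⟩
        simp [h] at this)
    exact exists_isPath_of_inside M huv ⟨h, fun r hr => h' (mem_image_of_mem _ hr)⟩
  · exact exists_isPath_of_times hc M h

end Param

/-! ### Ends of geodesics in covers without retractable members. -/

variable {V : Type*} [Fintype V] {G : SimpleGraph V}

open GraphSpace

/-- A path that passes the points at the times of a list and runs straight between them is a
broken line. -/
theorem image_eq_polyline {γ : ℝ → GraphSpace G} {a b : ℝ} {l : List ℝ}
    (hl : (a :: b :: l).Pairwise (· < ·))
    (h : ∀ s t, [s, t] <:+: a :: b :: l → γ '' Icc s t = seg (γ s) (γ t)) :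
    γ '' Icc a ((b :: l).getLast (by simp)) =
      Subtype.val ⁻¹' polyline ((a :: b :: l).map fun r => (γ r).1) := by
  induction l generalizing a b with
  | nil =>
    rw [List.getLast_singleton, h a b (List.infix_refl _)]
    simp [polyline, seg]
  | cons d l ih =>
    have hp := hl.tail
    have hab : a < b := by
      rw [List.pairwise_cons] at hl
      exact hl.1 b (by simp)
    have hbd : b ≤ (d :: l).getLast (by simp) := by
      rw [List.tail_cons, List.pairwise_cons] at hp
      exact (hp.1 _ (List.getLast_mem _)).le
    rw [List.getLast_cons (by simp), ← Icc_union_Icc_eq_Icc hab.le hbd, image_union,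
      h a b ⟨[], d :: l, by simp⟩,
      ih hp fun s t hs => h s t (hs.trans (List.infix_cons (List.infix_refl _)))]
    simp only [List.map_cons, polyline, preimage_union]
    rfl

theorem Param.mapsTo_closedEdge_of_isEnd {m : MetricSpace (GraphSpace G)} {c : Param m} (hc : ContinuousOn c.γ (Icc 0 c.L)) {a b : ℝ}
    (hab : a < b) (hsub : Icc a b ⊆ Icc 0 c.L) {v w : V} (hvw : v ≠ w)
    (h : MapsTo c.γ (Ioo a b) (openEdge G v w)) : MapsTo c.γ (Icc a b) (closedEdge G v w) := by
  have h1 : MapsTo c.γ (Ioo a b) (closedEdge G v w) :=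
    fun r hr => (mem_closedEdge_of_mem_openEdge hvw (h hr)).1
  have h3 := h1.closure_of_continuousOn (by rw [closure_Ioo hab.ne]; exact hc.mono hsub)
  rwa [closure_Ioo hab.ne, (isClosed_closedEdge v w).closure_eq] at h3

variable [DecidableEq V]

namespace Param

variable {m : MetricSpace (GraphSpace G)} {c : Param m}

/-- The part of the edge beyond a point that is reached from the other end belongs to a
geodesic. -/
theorem Reaches.subset (hc : ContinuousOn c.γ (Icc 0 c.L)) {v w : V} (hvw : v ≠ w)
    {x : GraphSpace G} (hx : x ∈ openEdge G v w) (h : c.Reaches w x) {y : GraphSpace G}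
    (hy : y ∈ openEdge G v w) (hxy : x.1 w ≤ y.1 w) : y ∈ c.γ '' Icc 0 c.L := by
  have hx' := (mem_closedEdge_of_mem_openEdge hvw hx).1
  have hy' := (mem_closedEdge_of_mem_openEdge hvw hy).1
  have hle : ∀ z : GraphSpace G, z.1 w ≤ 1 := fun z => by
    rw [← sum_eq_one z]
    exact Finset.single_le_sum (fun v _ => nonneg z v) (Finset.mem_univ w)
  have hmem : y ∈ seg x (vtx G w) := by
    rw [mem_seg_iff hvw hx' (vtx_mem_closedEdge_right v w) (by rw [vtx_self]; exact hle x)]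
    exact ⟨hy', hxy, by rw [vtx_self]; exact hle y⟩
  obtain ⟨r, hr, rfl⟩ := h
  have hrL := endTimes_subset w hr
  have hrt : r ∉ c.times := fun h => vtx_notMem_openEdge hvw (γ_eq_vtx h ▸ hx)
  rcases hr with ⟨t, ht, htw, hr⟩ | ⟨t, ht, htw, hr⟩
  · have hlt : r < t := hr.2.lt_of_ne fun e => hrt (e ▸ head_mem ht)
    have htL := (mem_times.1 (head_mem ht)).1
    have hsub : Icc r t ⊆ Icc 0 c.L := Icc_subset_Icc hr.1 htL.2
    obtain ⟨-, -, -, -, -, e⟩ := exists_edge hlt (hc.mono hsub) (c.injOn.mono hsub)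
      (fun q hq v hv => (head_le ht (mem_times.2 ⟨hsub (Ioo_subset_Icc_self hq), v, hv⟩)).not_gt hq.2)
    rw [← htw, ← e] at hmem
    exact image_mono hsub hmem
  · have hlt : t < r := hr.1.lt_of_ne fun e => hrt (e ▸ last_mem ht)
    have htL := (mem_times.1 (last_mem ht)).1
    have hsub : Icc t r ⊆ Icc 0 c.L := Icc_subset_Icc htL.1 hr.2
    obtain ⟨-, -, -, -, -, e⟩ := exists_edge hlt (hc.mono hsub) (c.injOn.mono hsub)
      (fun q hq v hv => (le_last ht (mem_times.2 ⟨hsub (Ioo_subset_Icc_self hq), v, hv⟩)).not_gt hq.1)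
    rw [seg_symm, ← htw, ← e] at hmem
    exact image_mono hsub hmem

/-- Ensures that the geodesic that reaches a point from the other end of the edge is a different
one. -/
theorem IsEnd.notMem_endTimes {K : Set ℝ} {t r : ℝ} {v w : V} (h : c.IsEnd K t) (hr : r ∈ K)
    (ht : c.γ t = vtx G v) (hvw : v ≠ w) : r ∉ c.endTimes w := by
  have hne : ∀ {t'}, c.γ t' = vtx G w → t ≠ t' := by
    rintro t' ht' rfl
    exact hvw (vtx_injective (ht.symm.trans ht'))
  rintro (⟨t', ht', htw, hr'⟩ | ⟨t', ht', htw, hr'⟩) <;> rcases h with ⟨h, rfl⟩ | ⟨h, rfl⟩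
  · exact hne htw (Option.some.inj (h.symm.trans ht'))
  · exact (hr.1.trans_le (hr'.2.trans (le_last h (head_mem ht')))).false
  · exact (hr.2.trans_le ((le_last ht' (head_mem h)).trans hr'.1)).false
  · exact hne htw (Option.some.inj (h.symm.trans ht'))

/-- The end of a geodesic is retractable if it lies beyond a point that is reached by another
geodesic from the other side. -/
theorem exists_nhds_subset {ι : Type*} {c : ι → Param m}
    (hc : ∀ i, ContinuousOn (c i).γ (Icc 0 (c i).L))
    (hinj : Function.Injective fun i => (c i).γ '' Icc 0 (c i).L) {i : ι} {K : Set ℝ} {t r : ℝ}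
    (h : (c i).IsEnd K t) {v w : V} (ht : (c i).γ t = vtx G v) (hvw : v ≠ w) (hr : r ∈ K)
    (hrx : (c i).γ r ∈ openEdge G v w) (hreach : ∃ j, (c j).Reaches w ((c i).γ r))
    {x : GraphSpace G} (hx : x ∈ openEdge G v w) (hlt : ((c i).γ r).1 w < x.1 w) :
    ∃ U ∈ nhds x, U ⊆ ⋃₀ (range (fun i => (c i).γ '' Icc 0 (c i).L) \
      {(c i).γ '' Icc 0 (c i).L}) := by
  obtain ⟨j, hj⟩ := hreach
  have hij : j ≠ i := by
    rintro rfl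
    obtain ⟨r', hr', e⟩ := hj
    have := (c j).injOn (endTimes_subset w hr') (h.subset hr).1 e
    subst this
    exact h.notMem_endTimes hr ht hvw hr'
  refine ⟨openEdge G v w ∩ {y | ((c i).γ r).1 w < y.1 w}, ?_, ?_⟩
  · exact ((isOpen_openEdge v w).inter
      (isOpen_lt continuous_const (continuous_coord w))).mem_nhds ⟨hx, hlt⟩
  · intro y hy
    exact ⟨_, ⟨⟨j, rfl⟩, fun e => hij (hinj e)⟩, hj.subset (hc j) hvw hrx hy.1 hy.2.le⟩

end Param

theorem _root_.StrictAntiOn.of_injOn_of_lt {f : ℝ → ℝ} {a b : ℝ} (hab : a < b)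
    (hc : ContinuousOn f (Icc a b)) (hi : InjOn f (Icc a b)) (h : f b ≤ f a) :
    StrictAntiOn f (Icc a b) := by
  rcases hc.strictMonoOn_of_injOn_Icc' hab.le hi with hm | hm
  · exact absurd (hm (left_mem_Icc.2 hab.le) (right_mem_Icc.2 hab.le) hab) (not_lt.2 h)
  · exact hm

theorem _root_.StrictMonoOn.of_injOn_of_lt {f : ℝ → ℝ} {a b : ℝ} (hab : a < b)
    (hc : ContinuousOn f (Icc a b)) (hi : InjOn f (Icc a b)) (h : f a ≤ f b) :
    StrictMonoOn f (Icc a b) := by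
  rcases hc.strictMonoOn_of_injOn_Icc' hab.le hi with hm | hm
  · exact hm
  · exact absurd (hm (left_mem_Icc.2 hab.le) (right_mem_Icc.2 hab.le) hab) (not_lt.2 h)

namespace Param

variable {m : MetricSpace (GraphSpace G)}

/-- A geodesic in a cover without retractable members that ends inside two edges is the broken
line through its vertices and the points at which it ends. -/
theorem IsPath.eq_polyline {ι : Type*} {c : ι → Param m}
    (hc : ∀ i, ContinuousOn (c i).γ (Icc 0 (c i).L))
    (hinj : Function.Injective fun i => (c i).γ '' Icc 0 (c i).L)
    {M : Sym2 V → GraphSpace G}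
    (hM : ∀ u v, u ≠ v → M s(u, v) ∈ openEdge G u v → ∃ i, (c i).Reaches v (M s(u, v))) {i : ι}
    (hr : ¬ IsRetractable inferInstance m (range fun i => (c i).γ '' Icc 0 (c i).L)
      ((c i).γ '' Icc 0 (c i).L))
    {a : PArc V} (ha : IsPath (c i) M a) (hpre : a.pre ≠ []) (hpost : a.post ≠ []) :
    (c i).γ '' Icc 0 (c i).L = Subtype.val ⁻¹' polyline (a.pts.map fun p => (edgePt M p).1) ∧
      ∀ p ∈ a.pre ++ a.post, edgePt M p ∈ openEdge G p.1 p.2 := by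
  obtain ⟨s, t, r, r', w, w', hs, ht, ecore, epre, epost, aw, aw', hr0, er, hr1, er', h, h'⟩ :=
    ha.ends hpre hpost
  -- Non-retractability, applied to the ends of the given parametrization.
  have hr := not_exists.1 (not_exists.1 hr ((c i).γ 0)) ((c i).γ (c i).L)
  rw [not_and_or, not_or] at hr
  obtain ⟨hr2, hr3⟩ := hr.resolve_left
    (not_not.2 ⟨(c i).L, (c i).γ, (c i).L_nonneg, (c i).dist_eq, rfl, rfl, rfl⟩)
  have hsm := mem_times.1 (head_mem hs)
  have htm := mem_times.1 (last_mem ht)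
  have es := γ_eq_vtx (head_mem hs)
  have et := γ_eq_vtx (last_mem ht)
  have hM0 : M s(vert ((c i).γ s), w) ∈ openEdge G (vert ((c i).γ s)) w := er ▸ h hr0
  have hM1 : M s(vert ((c i).γ t), w') ∈ openEdge G (vert ((c i).γ t)) w' := er' ▸ h' hr1
  -- If the geodesic ran on beyond the chosen point, its coordinate at `w` would grow towards the
  -- endpoint; then the geodesic that reaches this point from `w` would cover a neighborhood of the
  -- endpoint.
  have z0 : r = 0 := by
    by_contra hne
    have hs0 : 0 < s := hr0.1.trans_lt hr0.2
    have hsub : Icc 0 s ⊆ Icc 0 (c i).L := Icc_subset_Icc le_rfl hsm.1.2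
    have hcl := mapsTo_closedEdge_of_isEnd (hc i) hs0 hsub aw.ne
      fun q hq => h (Ioo_subset_Ico_self hq)
    have hanti := StrictAntiOn.of_injOn_of_lt (f := fun q => ((c i).γ q).1 w) hs0
      ((continuous_coord w).comp_continuousOn ((hc i).mono hsub))
      (fun p hp q hq hpq => (c i).injOn (hsub hp) (hsub hq)
        (ext_of_mem aw.ne (hcl hp) (hcl hq) hpq)) (by
          rw [es, vtx_ne aw.ne']
          exact nonneg _ w)
    refine hr2 (exists_nhds_subset hc hinj (Or.inl ⟨hs, rfl⟩) es aw.ne hr0 (h hr0) ?_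
      (h ⟨le_rfl, hs0⟩) (hanti (left_mem_Icc.2 hs0.le) ⟨hr0.1, hr0.2.le⟩
        (hr0.1.lt_of_ne (Ne.symm hne))))
    rw [er]
    exact hM _ _ aw.ne hM0
  have z1 : r' = (c i).L := by
    by_contra hne
    have ht0 : t < (c i).L := hr1.1.trans_le hr1.2
    have hsub : Icc t (c i).L ⊆ Icc 0 (c i).L := Icc_subset_Icc htm.1.1 le_rfl
    have hcl := mapsTo_closedEdge_of_isEnd (hc i) ht0 hsub aw'.ne
      fun q hq => h' (Ioo_subset_Ioc_self hq)
    have hmono := StrictMonoOn.of_injOn_of_lt (f := fun q => ((c i).γ q).1 w') ht0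
      ((continuous_coord w').comp_continuousOn ((hc i).mono hsub))
      (fun p hp q hq hpq => (c i).injOn (hsub hp) (hsub hq)
        (ext_of_mem aw'.ne (hcl hp) (hcl hq) hpq)) (by
          rw [et, vtx_ne aw'.ne']
          exact nonneg _ w')
    refine hr3 (exists_nhds_subset hc hinj (Or.inr ⟨ht, rfl⟩) et aw'.ne hr1 (h' hr1) ?_
      (h' ⟨ht0, le_rfl⟩) (hmono ⟨hr1.1.le, hr1.2⟩ (right_mem_Icc.2 ht0.le)
        (hr1.2.lt_of_ne hne)))
    rw [er']
    exact hM _ _ aw'.ne hM1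
  subst z0 z1
  refine ⟨?_, ?_⟩
  · have epts : a.pts.map (fun p => (edgePt M p).1) =
        (0 :: ((c i).times ++ [(c i).L])).map fun r => ((c i).γ r).1 := by
      have e3 : (a.core.map fun v => (v, v)).map (fun p => (edgePt M p).1) =
          (c i).times.map fun r => ((c i).γ r).1 := by
        have := congrArg (List.map Subtype.val) (core_map_vtx (c := c i))
        rw [List.map_map, List.map_map] at this
        rw [ecore, List.map_map]
        refine Eq.trans (List.map_congr_left fun v _ => ?_) this
        exact congrArg Subtype.val (edgePt_self M v)
      rw [PArc.pts, List.map_append, List.map_append, e3, epre, epost]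
      simp only [List.map_cons, List.map_nil, edgePt_ne M aw.ne', edgePt_ne M aw'.ne, er, er',
        Sym2.eq_swap (a := w), List.cons_append, List.nil_append, List.map_append]
    have hpw : (0 :: ((c i).times ++ [(c i).L])).Pairwise (· < ·) := by
      rw [List.pairwise_cons, List.pairwise_append]
      refine ⟨fun q hq => ?_, (c i).times_pairwise, List.pairwise_singleton _ _, fun q hq p hp => ?_⟩
      · rcases List.mem_append.1 hq with hq | hq
        · exact hr0.2.trans_le (head_le hs hq)
        · rw [List.mem_singleton.1 hq]
          exact hr0.2.trans_le hsm.1.2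
      · rw [List.mem_singleton.1 hp]
        exact (le_last ht hq).trans_lt hr1.1
    obtain ⟨b, l, el⟩ : ∃ b l, (c i).times ++ [(c i).L] = b :: l := List.exists_cons_of_ne_nil (by simp)
    have hlast : ∀ h, (b :: l).getLast h = (c i).L := by simp [← el]
    have key := image_eq_polyline (γ := (c i).γ) (a := 0) (b := b) (l := l) (el ▸ hpw) (by
      intro p q hpq
      rw [← el] at hpq
      obtain ⟨hp, hq, hlt, hno⟩ := hpq.of_pairwise_lt hpw
      have hall : ∀ p ∈ 0 :: ((c i).times ++ [(c i).L]), p ∈ Icc 0 (c i).L := by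
        intro p hp
        simp only [List.mem_cons, List.mem_append, List.not_mem_nil, or_false] at hp
        rcases hp with rfl | hp | rfl
        exacts [left_mem_Icc.2 (c i).L_nonneg, (mem_times.1 hp).1, right_mem_Icc.2 (c i).L_nonneg]
      have hsub : Icc p q ⊆ Icc 0 (c i).L := Icc_subset_Icc (hall p hp).1 (hall q hq).2
      obtain ⟨-, -, -, -, -, e⟩ := exists_edge hlt ((hc i).mono hsub) ((c i).injOn.mono hsub)
        fun y hy v hv => hno y (by
          simp [mem_times.2 ⟨hsub (Ioo_subset_Icc_self hy), v, hv⟩]) hy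
      exact e)
    rw [hlast] at key
    rw [key, epts, el]
  · intro p hp
    rw [epre, epost] at hp
    simp only [List.mem_append, List.mem_singleton] at hp
    rcases hp with rfl | rfl
    · rw [edgePt_ne M aw.ne', Sym2.eq_swap, openEdge_comm]
      exact hM0
    · rw [edgePt_ne M aw'.ne]
      exact hM1

end Param

/-- The finite combinatorial data of a cover by geodesics. -/
theorem exists_paths {n : ℕ} {m : MetricSpace (GraphSpace G)} (hm : IsCompatible inferInstance m)
    {S : Fin n → Set (GraphSpace G)} (hS : ∀ i, IsGeodesic m (S i)) (hcov : ∀ x, ∃ i, x ∈ S i) :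
    ∃ (M : Sym2 V → GraphSpace G) (a : Fin n → PArc V), (∀ i, (a i).Valid G m (edgePt M)) ∧
      PCovers G (List.ofFn a) ∧ (S.Injective → ∀ i, ¬ IsRetractable inferInstance m (range S) (S i) →
        (a i).pre ≠ [] → (a i).post ≠ [] →
        S i = Subtype.val ⁻¹' polyline ((a i).pts.map fun p => (edgePt M p).1) ∧
        ∀ p ∈ (a i).pre ++ (a i).post, edgePt M p ∈ openEdge G p.1 p.2) := by
  have hpar : ∀ i, ∃ c : Param m, c.γ '' Icc 0 c.L = S i := by
    intro i
    obtain ⟨p, q, L, γ, hL, hd, him, -⟩ := hS i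
    exact ⟨⟨L, γ, hL, hd⟩, him⟩
  choose c hcS using hpar
  obtain rfl : (fun i => (c i).γ '' Icc 0 (c i).L) = S := funext hcS
  have hc : ∀ i, ContinuousOn (c i).γ (Icc 0 (c i).L) := fun i => hm.continuousOn (c i).dist_eq
  have hex : ∀ e : Sym2 V, ∃ x : GraphSpace G, ∀ u v, e = s(u, v) → u ≠ v →
      (x ∈ openEdge G u v → ∃ i, (c i).Reaches v x) ∧
      (G.Adj u v → (∃ i, (c i).Whole u v ∨ (c i).Inside u v) ∨
        x ∈ openEdge G u v ∧ (∃ i, (c i).Reaches u x) ∧ ∃ i, (c i).Reaches v x) := by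
    intro e
    induction e using Sym2.ind with
    | _ u v =>
    by_cases huv : G.Adj u v
    · rcases edge_cases c hc hcov huv with ⟨i, hi⟩ | ⟨x, hx, h1, h2⟩
      -- No point has to be chosen on this edge. A vertex serves as default value: it is not in the
      -- interior of an edge, so the first requirement is empty.
      · refine ⟨vtx G u, fun a b e hab => ⟨fun h => absurd h (vtx_notMem_openEdge hab),
          fun _ => Or.inl ⟨i, ?_⟩⟩⟩
        rcases Sym2.eq_iff.1 e with ⟨rfl, rfl⟩ | ⟨rfl, rfl⟩
        · exact hi
        · refine hi.imp Or.symm fun h => ⟨h.1, ?_⟩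
          rw [openEdge_comm]
          exact h.2
      · refine ⟨x, fun a b e hab => ?_⟩
        rcases Sym2.eq_iff.1 e with ⟨rfl, rfl⟩ | ⟨rfl, rfl⟩
        · exact ⟨fun _ => h2, fun _ => Or.inr ⟨hx, h1, h2⟩⟩
        · exact ⟨fun _ => h1, fun _ => Or.inr ⟨openEdge_comm u v ▸ hx, h2, h1⟩⟩
    · refine ⟨vtx G u, fun a b e hab => ⟨fun h => absurd h (vtx_notMem_openEdge hab),
        fun h => absurd ?_ huv⟩⟩
      rcases Sym2.eq_iff.1 e with ⟨rfl, rfl⟩ | ⟨rfl, rfl⟩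
      exacts [h, h.symm]
  choose M hM using hex
  choose a ha using fun i => Param.exists_isPath (hc i) M
  refine ⟨M, a, fun i => (ha i).valid, fun u v huv => ?_, fun hinj i hr h1 h2 =>
    (ha i).eq_polyline hc hinj
      (fun u v huv h => (hM s(u, v) u v rfl huv).1 h) hr h1 h2⟩
  · simp only [List.mem_ofFn, exists_exists_eq_and]
    rcases (hM s(u, v) u v rfl huv.ne).2 huv with ⟨i, hi⟩ | ⟨h, ⟨i, hi⟩, j, hj⟩
    · exact Or.inl ⟨i, (ha i).whole u v huv.ne hi⟩
    · refine Or.inr ⟨⟨i, (ha i).reaches u v huv.ne h hi⟩, j, ?_⟩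
      rw [Sym2.eq_swap] at h hj
      rw [openEdge_comm] at h
      exact (ha j).reaches v u huv.ne' h hj

theorem polyline_append_pair {V : Type*} (l : List (V → ℝ)) (a b : V → ℝ) :
    polyline (l ++ [a, b]) = polyline (l ++ [a]) ∪ segment ℝ a b := by
  induction l with
  | nil => simp [polyline]
  | cons x l ih =>
    cases l with
    | nil => simp [polyline]
    | cons y l =>
      simp only [List.cons_append, polyline] at ih ⊢
      rw [ih, union_assoc]

theorem polyline_reverse {V : Type*} (l : List (V → ℝ)) : polyline l.reverse = polyline l := by
  induction l with
  | nil => rfl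
  | cons a l ih =>
    cases l with
    | nil => rfl
    | cons b l =>
      rw [List.reverse_cons] at ih
      rw [List.reverse_cons, List.reverse_cons, List.append_assoc, List.singleton_append,
        polyline_append_pair, ih, segment_symm, polyline, union_comm]

/-! ### Lower bounds, and the covers of `K₅` as families of broken lines. -/

variable {V : Type*} [Fintype V] [DecidableEq V] {G : SimpleGraph V}

open GraphSpace

theorem exists_surjective_fin {k n : ℕ} (hk : k ≠ 0) (h : k ≤ n) :
    ∃ f : Fin n → Fin k, f.Surjective :=
  ⟨fun i => ⟨min i (k - 1), by omega⟩, fun j => ⟨⟨j, by omega⟩, Fin.ext (by simp; omega)⟩⟩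

/-- The finite combinatorial data of a cover, with paths repeated up to a given number. -/
theorem IsGeodesicCover.exists_list [Nonempty V] {m : MetricSpace (GraphSpace G)}
    (hm : IsCompatible inferInstance m) {Γ : Set (Set (GraphSpace G))} (hΓ : IsGeodesicCover m Γ)
    {n : ℕ} (hn : Γ.encard ≤ n) :
    ∃ (k : ℕ) (S : Fin k → Set (GraphSpace G)) (M : Sym2 V → GraphSpace G) (a : Fin k → PArc V)
      (L : List (PArc V)), S.Injective ∧ range S = Γ ∧ Γ.encard = k ∧ L.length = n ∧
      (∀ b, b ∈ L ↔ ∃ i, a i = b) ∧ (∀ b ∈ L, b.Valid G m (edgePt M)) ∧ PCovers G L ∧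
      (∀ i, ¬ IsRetractable inferInstance m Γ (S i) → (a i).pre ≠ [] → (a i).post ≠ [] →
        S i = Subtype.val ⁻¹' polyline ((a i).pts.map fun p => (edgePt M p).1) ∧
        ∀ p ∈ (a i).pre ++ (a i).post, edgePt M p ∈ openEdge G p.1 p.2) := by
  obtain ⟨hfin, hgeo, hcov⟩ := hΓ
  obtain ⟨k, S, hS, rfl⟩ := hfin.fin_param
  have hk : (range S).encard = k := by
    rw [← image_univ, hS.encard_image, encard_univ]
    simp
  have hcov' : ∀ x, ∃ i, x ∈ S i := fun x => by
    obtain ⟨_, ⟨i, rfl⟩, h⟩ := mem_sUnion.1 (hcov.symm ▸ mem_univ x)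
    exact ⟨i, h⟩
  have hk0 : k ≠ 0 := by
    rintro rfl
    obtain ⟨i, -⟩ := hcov' (vtx G (Classical.arbitrary V))
    exact i.elim0
  have hkn : k ≤ n := by
    rw [hk] at hn
    exact_mod_cast hn
  obtain ⟨M, a, h1, h2, h3⟩ := exists_paths hm (fun i => hgeo (S i) ⟨i, rfl⟩) hcov'
  obtain ⟨f, hf⟩ := exists_surjective_fin hk0 hkn
  have hL : ∀ b, b ∈ List.ofFn (a ∘ f) ↔ ∃ i, a i = b := by
    intro b
    rw [List.mem_ofFn]
    exact ⟨fun ⟨i, h⟩ => ⟨f i, h⟩, fun ⟨i, h⟩ => let ⟨j, hj⟩ := hf i; ⟨j, by simp [hj, h]⟩⟩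
  refine ⟨k, S, M, a, List.ofFn (a ∘ f), hS, rfl, hk, by simp, hL, ?_, ?_, h3 hS⟩
  · intro b hb
    obtain ⟨i, rfl⟩ := (hL b).1 hb
    exact h1 i
  · have hsub : ∀ {b}, b ∈ List.ofFn a → b ∈ List.ofFn (a ∘ f) := fun {b} hb =>
      (hL b).2 (by simpa [List.mem_ofFn] using hb)
    intro u v huv
    rcases h2 u v huv with ⟨b, hb, h⟩ | ⟨⟨b, hb, h⟩, d, hd, h'⟩
    · exact Or.inl ⟨b, hsub hb, h⟩
    · exact Or.inr ⟨⟨b, hsub hb, h⟩, d, hsub hd, h'⟩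

/-- A lower bound for the cover number. -/
theorem le_coverNumber_of_search {K : Search.Graph} {c : V → ℕ} [Nonempty V] {n : ℕ}
    (hK : Search.Numbering G K c) (hn : n ≤ 7) (hcard : Fintype.card V ≤ K.V.length)
    (h : Search.search K n (fun _ => false) = true) : (n + 1 : ℕ) ≤ coverNumber (GraphSpace G) := by
  refine le_sInf ?_
  rintro _ ⟨m, hm, Γ, hΓ, rfl⟩
  by_contra hlt
  have hle : Γ.encard ≤ n := by
    rw [not_le, Nat.cast_add, Nat.cast_one] at hlt
    exact Order.le_of_lt_add_one hlt
  obtain ⟨k, S, M, a, L, -, -, -, hL, -, hv, hcov, -⟩ := hΓ.exists_list hm hle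
  obtain ⟨as, h'⟩ := hK.search_sound (edgePt_swap M) hL hn hcard hv hcov h
  exact Bool.false_ne_true h'

theorem four_le_coverNumber_K33 :
    4 ≤ coverNumber (GraphSpace (completeBipartiteGraph (Fin 3) (Fin 3))) :=
  le_coverNumber_of_search Search.K33_numbering (by norm_num) (by decide) Search.search_K33

theorem four_le_coverNumber_K4 : 4 ≤ coverNumber (GraphSpace (⊤ : SimpleGraph (Fin 4))) :=
  le_coverNumber_of_search Search.K4_numbering (by norm_num) (by decide) Search.search_K4

theorem three_le_coverNumber_K23 :
    3 ≤ coverNumber (GraphSpace (completeBipartiteGraph (Fin 2) (Fin 3))) :=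
  le_coverNumber_of_search Search.K23_numbering (by norm_num) (by decide) Search.search_K23

/-- The lists of a family differ even up to reversal and orientation of edges, so a path agrees with
at most one of them. -/
theorem k5Lists_nodup : ∀ k, (k5Lists k).Nodup ∧ ∀ l ∈ k5Lists k, ∀ l' ∈ k5Lists k,
    (l.map (fun p => s(p.1, p.2)) = l'.map (fun p => s(p.1, p.2)) ∨
      l.map (fun p => s(p.1, p.2)) = (l'.map fun p => s(p.1, p.2)).reverse) → l = l' := by
  decide +kernel

theorem Search.Same.unique {a : PArc (Fin 5)} {σ : Equiv.Perm (Fin 5)} {k : Fin 3}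
    {l l' : List (Fin 5 × Fin 5)} (hl : l ∈ k5Lists k) (hl' : l' ∈ k5Lists k) (h : Same a σ l)
    (h' : Same a σ l') : l = l' := by
  have hmap : ∀ l : List (Fin 5 × Fin 5), l.map (fun p => s(σ p.1, σ p.2)) =
      (l.map fun p => s(p.1, p.2)).map (Sym2.map σ) := fun l => by simp
  have hinj := List.map_injective_iff.2 (Sym2.map.injective σ.injective)
  obtain ⟨-, -, h⟩ := h
  obtain ⟨-, -, h'⟩ := h'
  rw [hmap] at h h'
  refine (k5Lists_nodup k).2 l hl l' hl' ?_
  rcases h with h | h <;> rcases h' with h' | h' <;> have e := h.symm.trans h'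
  · exact Or.inl (hinj e)
  · exact Or.inr (hinj (by rw [e, List.map_reverse]))
  · exact Or.inr (hinj (by rw [List.map_reverse, ← e, List.reverse_reverse]))
  · exact Or.inl (hinj (List.reverse_injective e))

/-- The broken line through the points that correspond to a list. -/
def edgePath (M : Sym2 V → GraphSpace G) (σ : V → V) (l : List (V × V)) : Set (GraphSpace G) :=
  Subtype.val ⁻¹' polyline (l.map fun p => (edgePt M (σ p.1, σ p.2)).1)

theorem Search.Same.eq_edgePath {a : PArc (Fin 5)} {σ : Equiv.Perm (Fin 5)}
    {l : List (Fin 5 × Fin 5)} (h : Same a σ l)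
    (M : Sym2 (Fin 5) → GraphSpace (⊤ : SimpleGraph (Fin 5))) :
    Subtype.val ⁻¹' polyline (a.pts.map fun p => (edgePt M p).1) = edgePath M σ l := by
  let F : Sym2 (Fin 5) → Fin 5 → ℝ :=
    Sym2.lift ⟨fun u v => (edgePt M (u, v)).1, fun u v =>
      congrArg Subtype.val (edgePt_swap M (v, u))⟩
  have e1 : a.pts.map (fun p => (edgePt M p).1) = (a.pts.map fun p => s(p.1, p.2)).map F := by
    rw [List.map_map]
    rfl
  have e2 : l.map (fun p => (edgePt M (σ p.1, σ p.2)).1) =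
      (l.map fun p => s(σ p.1, σ p.2)).map F := by
    rw [List.map_map]
    rfl
  rw [edgePath, e1, e2]
  rcases h.2.2 with h | h
  · rw [h]
  · rw [h, List.map_reverse, polyline_reverse]

/-- No search with three paths is needed: a smaller cover is padded by repetition to four paths. By
the classification its paths agree with four different lists, so there were at least four geodesics.
-/
theorem four_le_coverNumber_K5 : 4 ≤ coverNumber (GraphSpace (⊤ : SimpleGraph (Fin 5))) := by
  refine le_sInf ?_
  rintro _ ⟨m, hm, Γ, hΓ, rfl⟩
  rcases le_total Γ.encard 4 with hle | hle
  swap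
  · exact hle
  obtain ⟨k, S, M, a, L, -, -, hk, hL, hLa, hv, hcov, -⟩ := hΓ.exists_list hm hle
  obtain ⟨j, σ, -, h⟩ := k5_paths (edgePt_swap M) hL hv hcov
  have h' : ∀ l : {l // l ∈ k5Lists j}, ∃ i, Search.Same (a i) σ l.1 := by
    rintro ⟨l, hl⟩
    obtain ⟨b, hb, hs⟩ := h l hl
    obtain ⟨i, rfl⟩ := (hLa b).1 hb
    exact ⟨i, hs⟩
  choose f hf using h'
  have hinj : f.Injective := fun l l' e => Subtype.ext
    ((hf l).unique l.2 l'.2 (e ▸ hf l'))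
  have hcard := Fintype.card_le_of_injective f hinj
  have h4 : Fintype.card {l // l ∈ k5Lists j} = 4 := by
    rw [Fintype.card_of_subtype (k5Lists j).toFinset fun x => List.mem_toFinset,
      List.toFinset_card_of_nodup (k5Lists_nodup j).1]
    fin_cases j <;> rfl
  rw [h4, Fintype.card_fin] at hcard
  rw [hk]
  exact_mod_cast hcard

/-- The covers of `K₅` by four geodesics without retractable members. -/
theorem exists_edgePath_eq {m : MetricSpace (GraphSpace (⊤ : SimpleGraph (Fin 5)))}
    (hm : IsCompatible inferInstance m) {Γ : Set (Set (GraphSpace (⊤ : SimpleGraph (Fin 5))))}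
    (hΓ : IsGeodesicCover m Γ) (hr : ∀ S ∈ Γ, ¬ IsRetractable inferInstance m Γ S)
    (h4 : Γ.encard = 4) :
    ∃ (k : Fin 3) (σ : Equiv.Perm (Fin 5)) (M : Sym2 (Fin 5) → GraphSpace ⊤),
      (∀ l ∈ k5Lists k, ∀ p ∈ l, p.1 ≠ p.2 → M s(σ p.1, σ p.2) ∈ openEdge ⊤ (σ p.1) (σ p.2)) ∧
      Γ = {S | ∃ l ∈ k5Lists k, S = edgePath M σ l} := by
  obtain ⟨n, S, M, a, L, -, rfl, -, hL, hLa, hv, hcov, hp⟩ := hΓ.exists_list hm h4.le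
  obtain ⟨k, σ, h1, h2⟩ := k5_paths (edgePt_swap M) hL hv hcov
  have hS : ∀ i l, Search.Same (a i) σ l → S i = edgePath M σ l := fun i l h => by
    rw [(hp i (hr _ ⟨i, rfl⟩) h.1 h.2.1).1, h.eq_edgePath]
  refine ⟨k, σ, M, ?_, ?_⟩
  · intro l hl p hpl hne
    obtain ⟨b, hb, hs⟩ := h2 l hl
    obtain ⟨i, rfl⟩ := (hLa b).1 hb
    have h3 := (hp i (hr _ ⟨i, rfl⟩) hs.1 hs.2.1).2
    have hmem : s(σ p.1, σ p.2) ∈ (a i).pts.map fun p => s(p.1, p.2) := by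
      have : s(σ p.1, σ p.2) ∈ l.map fun p => s(σ p.1, σ p.2) := List.mem_map_of_mem hpl
      rcases hs.2.2 with e | e <;> rw [e]
      · exact this
      · exact List.mem_reverse.2 this
    obtain ⟨q, hq, e⟩ := List.mem_map.1 hmem
    have hq' : q.1 ≠ q.2 := by
      intro h
      rcases Sym2.eq_iff.1 e with ⟨e1, e2⟩ | ⟨e1, e2⟩
      · exact hne (σ.injective (by rw [← e1, ← e2, h]))
      · exact hne (σ.injective (by rw [← e1, ← e2, h]))
    have hq2 : q ∈ (a i).pre ++ (a i).post := by
      simp only [PArc.pts, List.mem_append, List.mem_map] at hq ⊢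
      rcases hq with (hq | ⟨v, -, rfl⟩) | hq
      · exact Or.inl hq
      · exact absurd rfl hq'
      · exact Or.inr hq
    have h5 := h3 q hq2
    obtain ⟨u, v⟩ := q
    rw [edgePt_ne M hq'] at h5
    simp only at e h5
    rw [e] at h5
    rcases Sym2.eq_iff.1 e with ⟨e1, e2⟩ | ⟨e1, e2⟩
    · rw [e1, e2] at h5
      exact h5
    · rw [openEdge_comm, e1, e2] at h5
      exact h5
  · ext T
    constructor
    · rintro ⟨i, rfl⟩
      obtain ⟨l, hl, hs⟩ := h1 _ ((hLa _).2 ⟨i, rfl⟩)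
      exact ⟨l, hl, hS i l hs⟩
    · rintro ⟨l, hl, rfl⟩
      obtain ⟨b, hb, hs⟩ := h2 l hl
      obtain ⟨i, rfl⟩ := (hLa b).1 hb
      exact ⟨i, hS i l hs⟩

/-! ### Homeomorphisms that permute the vertices and bend the edges. -/

namespace GraphSpace

variable {V : Type*} [Fintype V] {G : SimpleGraph V}

/-- Compactness makes continuous bijections homeomorphisms and continuous injections embeddings; it
is used for `edgeMap` and for the metrics below. -/
instance compactSpace : CompactSpace (GraphSpace G) := by
  have hi : Topology.IsInducing (Subtype.val : GraphSpace G → V → ℝ) := ⟨rfl⟩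
  have : {x : V → ℝ | x ∈ stdSimplex ℝ V ∧
      ∃ u v : V, (u = v ∨ G.Adj u v) ∧ ∀ w : V, x w ≠ 0 → w = u ∨ w = v} =
      stdSimplex ℝ V ∩ ⋃ p ∈ {p : V × V | p.1 = p.2 ∨ G.Adj p.1 p.2},
        ⋂ w ∈ {w : V | ¬ (w = p.1 ∨ w = p.2)}, {x : V → ℝ | x w = 0} := by
    ext x
    simp only [mem_inter_iff, mem_ofPred_eq, mem_iUnion, mem_iInter, exists_prop, Prod.exists]
    refine and_congr_right fun _ => exists_congr fun u => exists_congr fun v =>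
      and_congr_right fun _ => forall_congr' fun w => not_imp_comm
  have hr : range (Subtype.val : GraphSpace G → V → ℝ) = _ := Subtype.range_coe_subtype.trans this
  refine ⟨hi.isCompact_iff.2 ?_⟩
  rw [image_univ, hr]
  exact (isCompact_stdSimplex ℝ V).inter_right ((Set.toFinite _).isClosed_biUnion fun p _ =>
    isClosed_biInter fun w _ => isClosed_eq (continuous_apply w) continuous_const)

/-- The point of an edge with a given coordinate. -/
theorem exists_mem_closedEdge [DecidableEq V] {u v : V} (h : G.Adj u v) {t : ℝ}
    (ht : t ∈ Icc (0 : ℝ) 1) : ∃ x ∈ closedEdge G u v, x.1 v = t := by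
  refine ⟨⟨(1 - t) • Pi.single u 1 + t • Pi.single v 1,
    (convex_stdSimplex ℝ V).segment_subset (single_mem_stdSimplex ℝ u)
      (single_mem_stdSimplex ℝ v) ⟨1 - t, t, sub_nonneg.2 ht.2, ht.1, by ring, rfl⟩,
      u, v, Or.inr h, ?_⟩, ?_, ?_⟩
  · intro w hw
    by_contra h'
    rw [not_or] at h'
    simp [h'] at hw
  · intro w hw
    by_contra h'
    rw [not_or] at h'
    simp [h'] at hw
  · simp [h.ne']

/-- The coordinates of the image of a point under a map that moves the points inside edges. -/
def shift (c : V → V → ℝ) (x : V → ℝ) (v : V) : ℝ := x v + ∑ w, min (x v) (x w) * c v w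

section Shift

variable {c : V → V → ℝ} (hc : ∀ u v, c u v = -c v u)

theorem shift_eq_zero (x : GraphSpace G) {v : V} (h : x.1 v = 0) : shift c x.1 v = 0 := by
  simp [shift, h, nonneg]

include hc

/-- For a point of the edge `uv`, `min (x v) (x w)` vanishes unless `w` is an end of the edge, and
`c v v = 0` by antisymmetry. -/
theorem shift_apply (x : GraphSpace G) {u v : V} (hx : x ∈ closedEdge G u v) :
    shift c x.1 v = x.1 v + min (x.1 v) (x.1 u) * c v u := by
  classical
  have hcv : ∀ v, c v v = 0 := fun v => by linarith [hc v v]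
  rw [shift, Finset.sum_eq_single u]
  · intro w _ hw
    by_cases hwv : w = v
    · rw [hwv, hcv, mul_zero]
    · rw [not_imp_comm.1 (hx w) (not_or.2 ⟨hw, hwv⟩), min_eq_right (nonneg x v), zero_mul]
  · simp

/-- The corrections are antisymmetric in the two vertices and cancel. -/
theorem sum_shift (x : V → ℝ) : ∑ v, shift c x v = ∑ v, x v := by
  simp only [shift, Finset.sum_add_distrib, add_eq_left]
  have h : ∑ v, ∑ w, min (x v) (x w) * c v w = -∑ v, ∑ w, min (x v) (x w) * c v w := by
    conv_lhs => rw [Finset.sum_comm]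
    rw [← Finset.sum_neg_distrib]
    refine Finset.sum_congr rfl fun v _ => ?_
    rw [← Finset.sum_neg_distrib]
    refine Finset.sum_congr rfl fun w _ => ?_
    rw [min_comm, hc w v]
    ring
  linarith

end Shift

/-- The homeomorphism of an interval to which `shift` restricts on an edge. -/
def bend (c t : ℝ) : ℝ := t + min t (1 - t) * c

/-- `min t (1 - t)` has Lipschitz constant `1`, so its multiple by `c` cannot outweigh the summand
`t`. -/
theorem bend_strictMono {c : ℝ} (hc : |c| < 1) : StrictMono (bend c) := by
  intro s t hst
  obtain ⟨h1, h2⟩ := abs_lt.1 hc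
  have h3 : |min t (1 - t) - min s (1 - s)| ≤ t - s := by
    have := abs_min_sub_min_le_max t (1 - t) s (1 - s)
    have e : (1 - t) - (1 - s) = -(t - s) := by ring
    rw [e, abs_neg, max_self, abs_of_pos (sub_pos.2 hst)] at this
    exact this
  have h4 : |(min t (1 - t) - min s (1 - s)) * c| < t - s := by
    rw [abs_mul]
    have h0 : 0 < t - s := sub_pos.2 hst
    calc _ ≤ (t - s) * |c| := mul_le_mul_of_nonneg_right h3 (abs_nonneg c)
      _ < (t - s) * 1 := mul_lt_mul_of_pos_left hc h0
      _ = t - s := mul_one _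
  have := (abs_lt.1 h4).1
  simp only [bend]
  linarith

theorem bend_continuous (c : ℝ) : Continuous (bend c) := by
  unfold bend
  fun_prop

theorem bend_zero (c : ℝ) : bend c 0 = 0 := by simp [bend]

variable {c : V → V → ℝ} (hc : ∀ u v, c u v = -c v u) (hc' : ∀ u v, |c u v| < 1) (σ : G ≃g G)

/-- The map of the topological graph that permutes the vertices by an automorphism and bends the
edges. -/
def edgeMap (x : GraphSpace G) : GraphSpace G :=
  ⟨fun v => shift c x.1 (σ.symm v), ⟨fun v => by
      obtain ⟨a, b, -, h⟩ := x.2.2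
      by_cases h0 : x.1 (σ.symm v) = 0
      · exact (shift_eq_zero x h0).ge
      obtain ⟨u, hu⟩ : ∃ u, x ∈ closedEdge G u (σ.symm v) := by
        rcases h _ h0 with e | e <;> rw [e]
        exacts [⟨b, fun w hw => (h w hw).symm⟩, ⟨a, h⟩]
      change 0 ≤ shift c x.1 (σ.symm v)
      rw [shift_apply hc x hu]
      have h1 := abs_lt.1 (hc' (σ.symm v) u)
      have h2 : 0 ≤ min (x.1 (σ.symm v)) (x.1 u) := le_min (nonneg x _) (nonneg x _)
      have h3 : min (x.1 (σ.symm v)) (x.1 u) ≤ x.1 (σ.symm v) := min_le_left _ _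
      nlinarith, by
      have := σ.toEquiv.symm.sum_comp (shift c x.1)
      rw [sum_shift hc, sum_eq_one] at this
      exact this⟩, by
    obtain ⟨a, b, hab, h⟩ := x.2.2
    refine ⟨σ a, σ b, hab.imp (congrArg σ) σ.map_adj_iff.2, fun w hw => ?_⟩
    have := h (σ.symm w) fun h0 => hw (shift_eq_zero x h0)
    rcases this with e | e
    · exact Or.inl (by rw [← e, RelIso.apply_symm_apply])
    · exact Or.inr (by rw [← e, RelIso.apply_symm_apply])⟩

theorem continuous_edgeMap : Continuous (edgeMap hc hc' σ) := by
  refine Continuous.subtype_mk (continuous_pi fun v => ?_) _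
  have := fun v => continuous_coord (G := G) v
  exact (this _).add (continuous_finsetSum _ fun w _ => ((this _).min (this w)).mul_const _)

theorem edgeMap_apply (x : GraphSpace G) (v : V) : (edgeMap hc hc' σ x).1 (σ v) = shift c x.1 v := by
  simp [edgeMap]

theorem edgeMap_mem {u v : V} {x : GraphSpace G} (hx : x ∈ closedEdge G u v) :
    edgeMap hc hc' σ x ∈ closedEdge G (σ u) (σ v) := by
  intro w hw
  obtain ⟨w, rfl⟩ := σ.surjective w
  rw [edgeMap_apply] at hw
  exact (hx w fun h => hw (shift_eq_zero x h)).imp (congrArg σ) (congrArg σ)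

theorem edgeMap_apply_of_mem {u v : V} (huv : u ≠ v) {x : GraphSpace G}
    (hx : x ∈ closedEdge G u v) : (edgeMap hc hc' σ x).1 (σ v) = bend (c v u) (x.1 v) := by
  rw [edgeMap_apply, shift_apply hc x hx, bend, ← add_eq_one huv hx, add_sub_cancel_right]

theorem edgeMap_mem_openEdge {u v : V} (huv : u ≠ v) {x : GraphSpace G} :
    edgeMap hc hc' σ x ∈ openEdge G (σ u) (σ v) ↔ x ∈ openEdge G u v := by
  constructor
  · rintro ⟨h1, h2⟩
    rw [edgeMap_apply] at h1 h2
    exact ⟨fun h => h1 (shift_eq_zero x h), fun h => h2 (shift_eq_zero x h)⟩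
  · intro hx
    have hx' := (mem_closedEdge_of_mem_openEdge huv hx).1
    have key : ∀ {u v : V}, u ≠ v → x ∈ closedEdge G u v → x.1 v ≠ 0 →
        (edgeMap hc hc' σ x).1 (σ v) ≠ 0 := by
      intro u v huv hx' hv
      rw [edgeMap_apply_of_mem hc hc' σ huv hx']
      exact fun e => hv ((bend_strictMono (hc' v u)).injective (e.trans (bend_zero _).symm))
    exact ⟨key huv.symm (closedEdge_comm u v ▸ hx') hx.1, key huv hx' hx.2⟩

variable [DecidableEq V]

theorem edgeMap_vtx (v : V) : edgeMap hc hc' σ (vtx G v) = vtx G (σ v) := by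
  refine Subtype.ext (funext fun w => ?_)
  obtain ⟨w, rfl⟩ := σ.surjective w
  rw [edgeMap_apply, vtx_apply]
  by_cases h : w = v
  · subst h
    have hcv : c w w = 0 := by linarith [hc w w]
    rw [shift_apply hc (u := w) _ (vtx_mem_closedEdge_left w w), hcv, vtx_self]
    simp
  · rw [shift_eq_zero _ (vtx_ne h), if_neg fun e => h (σ.injective e)]

/-- Segments in edges are mapped onto segments. -/
theorem image_edgeMap_seg {u v : V} (huv : G.Adj u v) {x y : GraphSpace G}
    (hx : x ∈ closedEdge G u v) (hy : y ∈ closedEdge G u v) :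
    edgeMap hc hc' σ '' seg x y = seg (edgeMap hc hc' σ x) (edgeMap hc hc' σ y) := by
  wlog hxy : x.1 v ≤ y.1 v generalizing x y
  · rw [seg_symm, this hy hx (le_of_not_ge hxy), seg_symm]
  have hσ : σ u ≠ σ v := fun e => huv.ne (σ.injective e)
  have hm := bend_strictMono (hc' v u)
  ext z
  rw [mem_seg_iff hσ (edgeMap_mem hc hc' σ hx) (edgeMap_mem hc hc' σ hy) (by
    rw [edgeMap_apply_of_mem hc hc' σ huv.ne hx, edgeMap_apply_of_mem hc hc' σ huv.ne hy]
    exact hm.monotone hxy), edgeMap_apply_of_mem hc hc' σ huv.ne hx,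
    edgeMap_apply_of_mem hc hc' σ huv.ne hy]
  constructor
  · rintro ⟨w, hw, rfl⟩
    rw [mem_seg_iff huv.ne hx hy hxy] at hw
    refine ⟨edgeMap_mem hc hc' σ hw.1, ?_⟩
    rw [edgeMap_apply_of_mem hc hc' σ huv.ne hw.1]
    exact ⟨hm.monotone hw.2.1, hm.monotone hw.2.2⟩
  · rintro ⟨hz, hz'⟩
    obtain ⟨t, ht, e⟩ := intermediate_value_Icc hxy (bend_continuous _).continuousOn hz'
    have hy1 : y.1 v ≤ 1 := by
      rw [← add_eq_one huv.ne hy]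
      linarith [nonneg y u]
    obtain ⟨w, hw, rfl⟩ := exists_mem_closedEdge huv ⟨(nonneg x v).trans ht.1, ht.2.trans hy1⟩
    refine ⟨w, (mem_seg_iff huv.ne hx hy hxy).2 ⟨hw, ht⟩, ?_⟩
    refine ext_of_mem hσ (edgeMap_mem hc hc' σ hw) hz ?_
    rw [edgeMap_apply_of_mem hc hc' σ huv.ne hw, e]

theorem edgeMap_surjective : Function.Surjective (edgeMap hc hc' σ) := by
  intro z
  rcases vtx_or_openEdge z with ⟨v, rfl⟩ | ⟨u, v, huv, hz⟩
  · obtain ⟨v, rfl⟩ := σ.surjective v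
    exact ⟨_, edgeMap_vtx hc hc' σ v⟩
  · obtain ⟨u, rfl⟩ := σ.surjective u
    obtain ⟨v, rfl⟩ := σ.surjective v
    have h := image_edgeMap_seg hc hc' σ (σ.map_adj_iff.1 huv) (vtx_mem_closedEdge_left u v)
      (vtx_mem_closedEdge_right u v)
    have hz' := (mem_closedEdge_of_mem_openEdge huv.ne hz).1
    have : z ∈ seg (edgeMap hc hc' σ (vtx G u)) (edgeMap hc hc' σ (vtx G v)) := by
      rw [edgeMap_vtx, edgeMap_vtx, mem_seg_iff huv.ne (vtx_mem_closedEdge_left _ _)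
        (vtx_mem_closedEdge_right _ _) (by simp [vtx_apply, huv.ne'])]
      refine ⟨hz', ?_, ?_⟩
      · rw [vtx_ne huv.ne']
        exact nonneg _ _
      · rw [vtx_self, ← add_eq_one huv.ne hz']
        linarith [nonneg z (σ u)]
    rw [← h] at this
    obtain ⟨x, -, e⟩ := this
    exact ⟨x, e⟩

theorem edgeMap_injective : Function.Injective (edgeMap hc hc' σ) := by
  intro x y h
  rcases vtx_or_openEdge x with ⟨u, rfl⟩ | ⟨u, v, huv, hx⟩
  · rcases vtx_or_openEdge y with ⟨v, rfl⟩ | ⟨a, b, hab, hy⟩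
    · rw [edgeMap_vtx, edgeMap_vtx] at h
      rw [σ.injective (vtx_injective h)]
    · rw [← edgeMap_mem_openEdge hc hc' σ hab.ne, ← h, edgeMap_vtx] at hy
      exact absurd hy (vtx_notMem_openEdge fun e => hab.ne (σ.injective e))
  · have hy : y ∈ openEdge G u v := by
      rwa [← edgeMap_mem_openEdge hc hc' σ huv.ne, ← h, edgeMap_mem_openEdge hc hc' σ huv.ne]
    have hx' := (mem_closedEdge_of_mem_openEdge huv.ne hx).1
    have hy' := (mem_closedEdge_of_mem_openEdge huv.ne hy).1
    refine ext_of_mem huv.ne hx' hy' ((bend_strictMono (hc' v u)).injective ?_)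
    rw [← edgeMap_apply_of_mem hc hc' σ huv.ne hx', ← edgeMap_apply_of_mem hc hc' σ huv.ne hy', h]

/-- `edgeMap` is a homeomorphism. -/
theorem exists_homeomorph : ∃ h : GraphSpace G ≃ₜ GraphSpace G, ⇑h = edgeMap hc hc' σ := by
  have : IsHomeomorph (edgeMap hc hc' σ) :=
    isHomeomorph_iff_continuous_bijective.2 ⟨continuous_edgeMap hc hc' σ,
      edgeMap_injective hc hc' σ, edgeMap_surjective hc hc' σ⟩
  exact ⟨this.homeomorph, rfl⟩

theorem image_edgeMap_polyline {l : List (GraphSpace G)}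
    (hl : l.IsChain fun x y => ∃ u v, G.Adj u v ∧ x ∈ closedEdge G u v ∧ y ∈ closedEdge G u v) :
    edgeMap hc hc' σ '' (Subtype.val ⁻¹' polyline (l.map Subtype.val)) =
      Subtype.val ⁻¹' polyline ((l.map (edgeMap hc hc' σ)).map Subtype.val) := by
  induction l with
  | nil => simp [polyline]
  | cons x l ih =>
    cases l with
    | nil => simp [polyline]
    | cons y l =>
      rw [List.isChain_cons_cons] at hl
      obtain ⟨⟨u, v, huv, hx, hy⟩, hl⟩ := hl
      have h1 := image_edgeMap_seg hc hc' σ huv hx hy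
      simp only [List.map_cons, polyline, preimage_union, image_union] at ih ⊢
      rw [ih hl]
      exact congrArg (· ∪ _) h1

end GraphSpace

/-! ### Moving the chosen points to the midpoints of edges. -/

open GraphSpace

theorem k5Cover_eq (k : Fin 3) : k5Cover k = {S | ∃ l ∈ k5Lists k, S = graphPath ⊤ l} := by
  ext S
  fin_cases k <;> simp [k5Cover, k5Lists]

variable {V : Type*} [DecidableEq V]

/-- The midpoint of two vertices of the standard simplex. -/
noncomputable def edgeCenter (u v : V) : V → ℝ := midpoint ℝ (Pi.single u 1) (Pi.single v 1)

theorem edgeCenter_apply (u v w : V) :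
    edgeCenter u v w =
      ((if w = u then 1 else 0) + if w = v then 1 else 0) / 2 := by
  rw [edgeCenter, midpoint_eq_smul_add]
  simp only [Pi.smul_apply, Pi.add_apply, Pi.single_apply, smul_eq_mul, invOf_eq_inv]
  ring

variable [Fintype V]

theorem exists_midpoint (G : SimpleGraph V) (e : Sym2 V) : ∃ x : GraphSpace G, ∀ u v, e = s(u, v) →
    u = v ∨ G.Adj u v → x.1 = edgeCenter u v := by
  induction e using Sym2.ind with
  | _ u v =>
  by_cases huv : u = v ∨ G.Adj u v
  swap
  · refine ⟨vtx G u, fun a b e hab => absurd ?_ huv⟩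
    rcases Sym2.eq_iff.1 e with ⟨rfl, rfl⟩ | ⟨rfl, rfl⟩
    exacts [hab, hab.imp Eq.symm fun h => h.symm]
  refine ⟨⟨edgeCenter u v, (convex_stdSimplex ℝ V).segment_subset (single_mem_stdSimplex ℝ u)
      (single_mem_stdSimplex ℝ v) (midpoint_mem_segment _ _), u, v, huv, ?_⟩, ?_⟩
  · intro w hw
    by_contra h
    rw [not_or] at h
    rw [edgeCenter_apply, if_neg h.1, if_neg h.2] at hw
    norm_num at hw
  · intro a b e _
    rcases Sym2.eq_iff.1 e with ⟨rfl, rfl⟩ | ⟨rfl, rfl⟩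
    · rfl
    · exact midpoint_comm _ _

/-- The midpoint of an edge. -/
noncomputable def edgeMid (G : SimpleGraph V) (e : Sym2 V) : GraphSpace G :=
  (exists_midpoint G e).choose

variable {G : SimpleGraph V}

theorem edgeMid_coe {u v : V} (h : G.Adj u v) : (edgeMid G s(u, v)).1 = edgeCenter u v :=
  (exists_midpoint G s(u, v)).choose_spec u v rfl (Or.inr h)

theorem edgePt_edgeMid {p : V × V} (hp : p.1 = p.2 ∨ G.Adj p.1 p.2) :
    (edgePt (edgeMid G) p).1 = edgeCenter p.1 p.2 := by
  obtain ⟨u, v⟩ := p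
  by_cases h : u = v
  · subst h
    rw [edgePt_self, edgeCenter, midpoint_self]
    rfl
  · rw [edgePt_ne _ h, edgeMid_coe (hp.resolve_left h)]

theorem edgePt_edgeMid_mem {p : V × V} (hp : p.1 = p.2 ∨ G.Adj p.1 p.2) {u v : V}
    (h1 : p.1 = u ∨ p.1 = v) (h2 : p.2 = u ∨ p.2 = v) :
    edgePt (edgeMid G) p ∈ closedEdge G u v := by
  intro w hw
  by_contra h
  rw [not_or] at h
  have h3 : w ≠ p.1 := fun e => h1.elim (fun h' => h.1 (e.trans h')) fun h' => h.2 (e.trans h')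
  have h4 : w ≠ p.2 := fun e => h2.elim (fun h' => h.1 (e.trans h')) fun h' => h.2 (e.trans h')
  rw [edgePt_edgeMid hp, edgeCenter_apply, if_neg h3, if_neg h4] at hw
  norm_num at hw

theorem graphPath_eq_edgePath {l : List (V × V)} (hl : ∀ p ∈ l, p.1 = p.2 ∨ G.Adj p.1 p.2) :
    graphPath G l = Subtype.val ⁻¹' polyline ((l.map (edgePt (edgeMid G))).map Subtype.val) := by
  rw [graphPath, List.map_map]
  congr 2
  exact List.map_congr_left fun p hp => (edgePt_edgeMid (hl p hp)).symm

/-- Successive points of a list lie in an edge. -/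
def Linked (p q : V × V) : Prop :=
  ∃ u v, u ≠ v ∧ (p.1 = u ∨ p.1 = v) ∧ (p.2 = u ∨ p.2 = v) ∧ (q.1 = u ∨ q.1 = v) ∧
    (q.2 = u ∨ q.2 = v)

instance : DecidableRel (Linked : V × V → V × V → Prop) := fun _ _ => by
  unfold Linked
  infer_instance

/-- A homeomorphism of the topological complete graph that moves the midpoints of edges to given
points. -/
theorem exists_homeomorph_image (σ : Equiv.Perm V) (M : Sym2 V → GraphSpace (⊤ : SimpleGraph V)) :
    ∃ h : GraphSpace (⊤ : SimpleGraph V) ≃ₜ GraphSpace (⊤ : SimpleGraph V),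
      ∀ l : List (V × V), l.IsChain Linked →
        (∀ p ∈ l, p.1 ≠ p.2 → M s(σ p.1, σ p.2) ∈ openEdge ⊤ (σ p.1) (σ p.2)) →
        h '' graphPath ⊤ l = edgePath M σ l := by
  classical
  let P : V → V → Prop := fun u v => u ≠ v ∧ M s(σ u, σ v) ∈ openEdge ⊤ (σ u) (σ v)
  have hP : ∀ {u v}, P u v → P v u := fun {u v} h =>
    ⟨h.1.symm, by rw [Sym2.eq_swap, openEdge_comm]; exact h.2⟩
  have hadd : ∀ {u v}, P u v → (M s(σ u, σ v)).1 (σ u) + (M s(σ u, σ v)).1 (σ v) = 1 :=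
    fun {u v} h => add_eq_one (fun e => h.1 (σ.injective e))
      (mem_closedEdge_of_mem_openEdge (fun e => h.1 (σ.injective e)) h.2).1
  -- `bend c` maps `1 / 2` to `(1 + c) / 2`; this is the coordinate of the given point if `c` is
  -- twice that coordinate minus `1`. The point is inside the edge exactly if `|c| < 1`. Edges
  -- without a suitable point are not bent.
  let c : V → V → ℝ := fun u v => if P u v then 2 * (M s(σ u, σ v)).1 (σ u) - 1 else 0
  have hc : ∀ u v, c u v = -c v u := by
    intro u v
    by_cases h : P u v
    · simp only [c]
      rw [if_pos h, if_pos (hP h), Sym2.eq_swap (a := σ v)]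
      linarith [hadd h]
    · simp only [c]
      rw [if_neg h, if_neg fun h' => h (hP h'), neg_zero]
  have hc' : ∀ u v, |c u v| < 1 := by
    intro u v
    by_cases h : P u v
    · simp only [c]
      rw [if_pos h, abs_lt]
      have h1 := (nonneg _ _).lt_of_ne' h.2.1
      have h2 := (nonneg _ _).lt_of_ne' h.2.2
      have := hadd h
      constructor <;> linarith
    · simp only [c]
      rw [if_neg h, abs_zero]
      exact one_pos
  let τ : (⊤ : SimpleGraph V) ≃g ⊤ := ⟨σ, by simp⟩
  have hτ : ∀ v, τ v = σ v := fun _ => rfl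
  obtain ⟨h, hh⟩ := exists_homeomorph hc hc' τ
  refine ⟨h, fun l hl hM => ?_⟩
  have hmap : (l.map (edgePt (edgeMid ⊤))).map (edgeMap hc hc' τ) =
      l.map fun p => edgePt M (σ p.1, σ p.2) := by
    rw [List.map_map]
    refine List.map_congr_left fun p hp => ?_
    obtain ⟨u, v⟩ := p
    by_cases huv : u = v
    · subst huv
      simp only [Function.comp_apply]
      rw [edgePt_self, edgePt_self, edgeMap_vtx, hτ]
    · have hσ : σ u ≠ σ v := fun e => huv (σ.injective e)
      have hMp := hM _ hp huv
      have hmem := edgePt_edgeMid_mem (G := ⊤) (p := (u, v)) (Or.inr huv) (u := u) (v := v) (Or.inl rfl) (Or.inr rfl)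
      simp only [Function.comp_apply]
      refine ext_of_mem hσ (edgeMap_mem hc hc' τ hmem) ?_ ?_
      · rw [edgePt_ne M hσ]
        exact (mem_closedEdge_of_mem_openEdge hσ hMp).1
      · have hPv : P v u := hP ⟨huv, hMp⟩
        rw [edgePt_ne M hσ, ← hτ v, edgeMap_apply_of_mem hc hc' τ huv hmem, edgePt_edgeMid (Or.inr huv),
          edgeCenter_apply, hτ]
        simp only [c, bend]
        rw [if_pos hPv, Sym2.eq_swap (a := σ v)]
        simp only [if_neg (Ne.symm huv), if_true]
        norm_num
        ring
  rw [graphPath_eq_edgePath fun p _ => eq_or_ne p.1 p.2, hh, image_edgeMap_polyline hc hc' τ, hmap, List.map_map, edgePath]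
  · rfl
  · rw [List.isChain_map]
    refine hl.imp fun p q hpq => ?_
    obtain ⟨u, v, huv, h1, h2, h3, h4⟩ := hpq
    exact ⟨u, v, huv, edgePt_edgeMid_mem (eq_or_ne _ _) h1 h2,
      edgePt_edgeMid_mem (eq_or_ne _ _) h3 h4⟩

theorem isChain_of_mem_k5Lists : ∀ k, ∀ l ∈ k5Lists k, l.IsChain Linked := by
  decide +kernel

/-- Every optimal cover of `K₅` without retractable members is equivalent to one of three. -/
theorem exists_coverEquiv {m : MetricSpace (GraphSpace (⊤ : SimpleGraph (Fin 5)))}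
    (hm : IsCompatible inferInstance m) {Γ : Set (Set (GraphSpace (⊤ : SimpleGraph (Fin 5))))}
    (hΓ : IsGeodesicCover m Γ) (hr : ∀ S ∈ Γ, ¬ IsRetractable inferInstance m Γ S)
    (h4 : Γ.encard = 4) : ∃ k, CoverEquiv (k5Cover k) Γ := by
  obtain ⟨k, σ, M, hM, rfl⟩ := exists_edgePath_eq hm hΓ hr h4
  obtain ⟨h, hh⟩ := exists_homeomorph_image σ M
  refine ⟨k, h, ?_⟩
  rw [k5Cover_eq]
  ext S
  constructor
  · rintro ⟨_, ⟨l, hl, rfl⟩, rfl⟩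
    exact ⟨l, hl, hh l (isChain_of_mem_k5Lists k l hl) (hM l hl)⟩
  · rintro ⟨l, hl, rfl⟩
    exact ⟨_, ⟨l, hl, rfl⟩, hh l (isChain_of_mem_k5Lists k l hl) (hM l hl)⟩

/-! ### Geodesics that are calibrated by a function. -/

section Calibrated

variable {X : Type*}

/-- The function `f` is a distance-preserving map of the set `S` onto an interval, whose ends
correspond to `a` and `b`. -/
structure Calibrated (m : MetricSpace X) (f : X → ℝ) (S : Set X) (a b : X) : Prop where
  left : a ∈ S
  right : b ∈ S
  le : f a ≤ f b
  dist_le : ∀ x ∈ S, ∀ y ∈ S, m.dist x y ≤ |f x - f y|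
  image : f '' S = Icc (f a) (f b)

variable {m : MetricSpace X} {f : X → ℝ} {S T : Set X} {a b c : X}

/-- The function increases from `a` through `b` to `c`, so the bounds on the two sides of `b` add up
by the triangle inequality. -/
theorem Calibrated.union (hS : Calibrated m f S a b) (hT : Calibrated m f T b c) :
    Calibrated m f (S ∪ T) a c where
  left := Or.inl hS.left
  right := Or.inr hT.right
  le := hS.le.trans hT.le
  dist_le := by
    have key : ∀ x ∈ S, ∀ y ∈ T, m.dist x y ≤ |f x - f y| := by
      intro x hx y hy
      have h1 := hS.dist_le x hx b hS.right
      have h2 := hT.dist_le b hT.left y hy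
      have h3 : f x ≤ f b := (hS.image ▸ mem_image_of_mem f hx : f x ∈ Icc (f a) (f b)).2
      have h4 : f b ≤ f y := (hT.image ▸ mem_image_of_mem f hy : f y ∈ Icc (f b) (f c)).1
      have h5 := m.dist_triangle x b y
      rw [abs_of_nonpos (sub_nonpos.2 h3)] at h1
      rw [abs_of_nonpos (sub_nonpos.2 h4)] at h2
      rw [abs_of_nonpos (sub_nonpos.2 (h3.trans h4))]
      linarith
    rintro x (hx | hx) y (hy | hy)
    · exact hS.dist_le x hx y hy
    · exact key x hx y hy
    · rw [m.dist_comm, abs_sub_comm]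
      exact key y hy x hx
    · exact hT.dist_le x hx y hy
  image := by rw [image_union, hS.image, hT.image, Icc_union_Icc_eq_Icc hS.le hT.le]

/-- The Lipschitz bound is the converse of `dist_le`, so `f` preserves distances on `S`; its
inverse, shifted to start at time `0`, is the parametrization. -/
theorem Calibrated.isGeodesicBetween (h : Calibrated m f S a b)
    (hf : ∀ x y, |f x - f y| ≤ m.dist x y) : IsGeodesicBetween m S a b := by
  have hd : ∀ x ∈ S, ∀ y ∈ S, m.dist x y = |f x - f y| := fun x hx y hy =>
    (h.dist_le x hx y hy).antisymm (hf x y)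
  have hinj : ∀ x ∈ S, ∀ y ∈ S, f x = f y → x = y := fun x hx y hy e => by
    have := hd x hx y hy
    rw [e, sub_self, abs_zero] at this
    exact m.eq_of_dist_eq_zero this
  have hex : ∀ t : ℝ, ∃ x, t ∈ Icc 0 (f b - f a) → x ∈ S ∧ f x = f a + t := by
    intro t
    by_cases ht : t ∈ Icc 0 (f b - f a)
    · have : f a + t ∈ f '' S := by
        rw [h.image]
        exact ⟨by linarith [ht.1], by linarith [ht.2]⟩
      obtain ⟨x, hx, e⟩ := this
      exact ⟨x, fun _ => ⟨hx, e⟩⟩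
    · exact ⟨a, fun h => absurd h ht⟩
  choose γ hγ using hex
  have h0 : 0 ≤ f b - f a := sub_nonneg.2 h.le
  refine ⟨f b - f a, γ, h0, fun s hs t ht => ?_, ?_, ?_, ?_⟩
  · rw [hd _ (hγ s hs).1 _ (hγ t ht).1, (hγ s hs).2, (hγ t ht).2, add_sub_add_left_eq_sub]
  · ext x
    constructor
    · rintro ⟨t, ht, rfl⟩
      exact (hγ t ht).1
    · intro hx
      have hfx : f x ∈ Icc (f a) (f b) := h.image ▸ mem_image_of_mem f hx
      have ht : f x - f a ∈ Icc 0 (f b - f a) :=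
        ⟨sub_nonneg.2 hfx.1, sub_le_sub_right hfx.2 _⟩
      exact ⟨_, ht, hinj _ (hγ _ ht).1 _ hx (by rw [(hγ _ ht).2]; ring)⟩
  · have ht := left_mem_Icc.2 h0
    exact hinj _ (hγ _ ht).1 _ h.left (by rw [(hγ _ ht).2]; ring)
  · have ht := right_mem_Icc.2 h0
    exact hinj _ (hγ _ ht).1 _ h.right (by rw [(hγ _ ht).2]; ring)

/-- The endpoints of a geodesic are determined by the set. -/
theorem IsGeodesicBetween.eq_or_eq {p q : X} (h : IsGeodesicBetween m S a b)
    (h' : IsGeodesicBetween m S p q) : (p = a ∨ p = b) ∧ (q = a ∨ q = b) := by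
  obtain ⟨L, γ, hL, hd, him, rfl, rfl⟩ := h
  obtain ⟨L', δ, hL', hd', him', rfl, rfl⟩ := h'
  have m0 : (0 : ℝ) ∈ Icc 0 L := left_mem_Icc.2 hL
  have m1 : L ∈ Icc 0 L := right_mem_Icc.2 hL
  have n0 : (0 : ℝ) ∈ Icc 0 L' := left_mem_Icc.2 hL'
  have n1 : L' ∈ Icc 0 L' := right_mem_Icc.2 hL'
  obtain ⟨s, hs, es⟩ : δ 0 ∈ γ '' Icc 0 L := him ▸ him' ▸ mem_image_of_mem δ n0
  obtain ⟨t, ht, et⟩ : δ L' ∈ γ '' Icc 0 L := him ▸ him' ▸ mem_image_of_mem δ n1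
  obtain ⟨s', hs', es'⟩ : γ 0 ∈ δ '' Icc 0 L' := him' ▸ him ▸ mem_image_of_mem γ m0
  obtain ⟨t', ht', et'⟩ : γ L ∈ δ '' Icc 0 L' := him' ▸ him ▸ mem_image_of_mem γ m1
  have h1 := hd s hs t ht
  rw [es, et, hd' 0 n0 L' n1, zero_sub, abs_neg, abs_of_nonneg hL'] at h1
  have h2 := hd' s' hs' t' ht'
  rw [es', et', hd 0 m0 L m1, zero_sub, abs_neg, abs_of_nonneg hL] at h2
  -- Each parametrization passes both ends of the other, so `[0, L]` contains two times at distance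
  -- `L' ≥ L`; these can only be its ends.
  have h3 : L ≤ L' := by
    rw [h2]
    exact abs_le.2 ⟨by linarith [hs'.1, ht'.2], by linarith [hs'.2, ht'.1]⟩
  have h4 : (s = 0 ∧ t = L) ∨ (s = L ∧ t = 0) := by
    rcases le_total s t with h | h
    · rw [abs_of_nonpos (sub_nonpos.2 h)] at h1
      exact Or.inl ⟨by linarith [hs.1, ht.2], by linarith [hs.1, ht.2]⟩
    · rw [abs_of_nonneg (sub_nonneg.2 h)] at h1
      exact Or.inr ⟨by linarith [ht.1, hs.2], by linarith [ht.1, hs.2]⟩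
  rw [← es, ← et]
  rcases h4 with ⟨rfl, rfl⟩ | ⟨rfl, rfl⟩ <;> simp

end Calibrated

variable {V : Type*}

open GraphSpace

theorem segment_eq_union_midpoint (x y : V → ℝ) :
    segment ℝ x y = segment ℝ x (midpoint ℝ x y) ∪ segment ℝ (midpoint ℝ x y) y := by
  have hm := midpoint_mem_segment (𝕜 := ℝ) x y
  refine Subset.antisymm ?_ (union_subset
    ((convex_segment x y).segment_subset (left_mem_segment ℝ x y) hm)
    ((convex_segment x y).segment_subset hm (right_mem_segment ℝ x y)))
  rintro _ ⟨a, b, ha, hb, hab, rfl⟩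
  rw [midpoint_eq_smul_add, invOf_eq_inv]
  rcases le_total b a with h | h
  · refine Or.inl ⟨1 - 2 * b, 2 * b, by linarith, by linarith, by ring, funext fun v => ?_⟩
    simp only [Pi.add_apply, Pi.smul_apply, smul_eq_mul]
    linear_combination (-x v) * hab
  · refine Or.inr ⟨2 * a, 1 - 2 * a, by linarith, by linarith, by ring, funext fun v => ?_⟩
    simp only [Pi.add_apply, Pi.smul_apply, smul_eq_mul]
    linear_combination (-y v) * hab

theorem segment_subset_polyline {W : Type*} {f : W → V → ℝ} {p q : W} {l : List W}
    (h : [p, q] <:+: l) : segment ℝ (f p) (f q) ⊆ polyline (l.map f) := by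
  obtain ⟨s, t, rfl⟩ := h
  induction s with
  | nil => exact subset_union_left
  | cons a s ih =>
    cases s with
    | nil => exact ih.trans subset_union_right
    | cons b s => exact ih.trans subset_union_right

/-! ### Metrics from functions that are affine on halves of edges. -/

section Coordinates

variable [Fintype V] {G : SimpleGraph V} {ι : Type*}

/-- The function with given values at the vertices and the midpoints of the edges that is affine
on the halves of edges. -/
noncomputable def piecewise (w : V → V → ℤ) (x : V → ℝ) : ℝ :=
  -- The double sum meets each edge twice, hence half of the coefficient `2 * w u v - w u u - w v
  -- v`; its terms with `u = v` vanish.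
  ∑ v, w v v * x v + ∑ u, ∑ v, (w u v - (w u u + w v v) / 2) * min (x u) (x v)

theorem piecewise_apply {w : V → V → ℤ} (hw : ∀ u v, w u v = w v u) {u v : V} (huv : u ≠ v)
    {x : GraphSpace G} (hx : x ∈ closedEdge G u v) :
    piecewise w x.1 = w u u * x.1 u + w v v * x.1 v +
      (2 * w u v - w u u - w v v) * min (x.1 u) (x.1 v) := by
  have h0 : ∀ a, a ≠ u ∧ a ≠ v → x.1 a = 0 := fun a ha =>
    not_imp_comm.1 (hx a) (not_or.2 ha)
  have h1 : ∀ a b, a ≠ u ∧ a ≠ v → min (x.1 a) (x.1 b) = 0 := fun a b ha => by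
    rw [h0 a ha, min_eq_left (nonneg x b)]
  have h2 : ∀ a b, b ≠ u ∧ b ≠ v → min (x.1 a) (x.1 b) = 0 := fun a b hb => by
    rw [min_comm, h1 b a hb]
  rw [piecewise, Fintype.sum_eq_add u v huv fun a ha => by rw [h0 a ha, mul_zero],
    Fintype.sum_eq_add u v huv fun a ha =>
      Finset.sum_eq_zero fun b _ => by rw [h1 a b ha, mul_zero],
    Fintype.sum_eq_add u v huv fun b hb => by rw [h2 u b hb, mul_zero],
    Fintype.sum_eq_add u v huv fun b hb => by rw [h2 v b hb, mul_zero], min_comm (x.1 v) (x.1 u),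
    hw v u]
  ring

theorem continuous_piecewise (w : V → V → ℤ) :
    Continuous fun x : GraphSpace G => piecewise w x.1 := by
  have := fun v => continuous_coord (G := G) v
  exact (continuous_finsetSum _ fun v _ => (this v).const_mul _).add
    (continuous_finsetSum _ fun u _ => continuous_finsetSum _ fun v _ =>
      ((this u).min (this v)).const_mul _)

/-- The coordinates of a point in a space with the maximum norm. -/
noncomputable def coords (W : ι → V → V → ℤ) (x : GraphSpace G) : ι ⊕ V → ℝ :=
  -- The coordinates of the vertices make the map injective. With the factor `2` they change by at
  -- most `1` on a half edge, which is no more than a nonconstant function with integer values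
  -- changes.
  Sum.elim (fun i => piecewise (W i) x.1) fun v => 2 * x.1 v

theorem coords_injective (W : ι → V → V → ℤ) : Function.Injective (coords (G := G) W) := by
  intro x y h
  refine Subtype.ext (funext fun v => ?_)
  have := congrFun h (Sum.inr v)
  simpa [coords] using this

end Coordinates

/-- Insert the midpoint of an edge between successive vertices. -/
def refine [DecidableEq V] : List (V × V) → List (V × V)
  | p :: q :: l =>
    if p.1 = p.2 ∧ q.1 = q.2 then p :: (p.1, q.1) :: refine (q :: l) else p :: refine (q :: l)
  | l => l

variable [DecidableEq V]

theorem refine_cons (p : V × V) (l : List (V × V)) : ∃ r, refine (p :: l) = p :: r := by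
  cases l with
  | nil => exact ⟨_, rfl⟩
  | cons q l =>
    rw [refine]
    split_ifs
    exacts [⟨_, rfl⟩, ⟨_, rfl⟩]

theorem polyline_refine (l : List (V × V)) :
    polyline ((refine l).map fun p => edgeCenter p.1 p.2) =
      polyline (l.map fun p => edgeCenter p.1 p.2) := by
  induction l with
  | nil => rfl
  | cons p l ih =>
    cases l with
    | nil => rfl
    | cons q l =>
      obtain ⟨r, hr⟩ := refine_cons q l
      rw [hr] at ih
      rw [refine, hr]
      split_ifs with h
      · simp only [List.map_cons, polyline] at ih ⊢
        rw [ih, ← union_assoc]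
        congr 1
        obtain ⟨u, u'⟩ := p
        obtain ⟨v, v'⟩ := q
        obtain ⟨h1, h2⟩ := h
        simp only at h1 h2
        subst h1 h2
        have e : ∀ v : V, edgeCenter v v = Pi.single v 1 := fun v => midpoint_self _ _
        rw [e, e]
        exact (segment_eq_union_midpoint _ _).symm
      · simp only [List.map_cons, polyline] at ih ⊢
        rw [ih]

theorem head_refine (l : List (V × V)) : (refine l).head? = l.head? := by
  cases l with
  | nil => rfl
  | cons p l =>
    obtain ⟨r, hr⟩ := refine_cons p l
    rw [hr]
    rfl

theorem getLast_refine (l : List (V × V)) : (refine l).getLast? = l.getLast? := by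
  induction l with
  | nil => rfl
  | cons p l ih =>
    cases l with
    | nil => rfl
    | cons q l =>
      obtain ⟨r, hr⟩ := refine_cons q l
      rw [hr] at ih
      rw [refine, hr]
      split_ifs
      · simpa using ih
      · simpa using ih

variable [Fintype V]

variable {G : SimpleGraph V}

variable {ι : Type*} [Fintype ι]

/-- The metric of the maximum norm. -/
noncomputable abbrev coordsMetric (W : ι → V → V → ℤ) : MetricSpace (GraphSpace G) :=
  MetricSpace.induced (coords W) (coords_injective W) inferInstance

/-- An injective continuous map from a compact space to a Hausdorff space is an embedding. -/
theorem isCompatible_coordsMetric (W : ι → V → V → ℤ) :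
    IsCompatible inferInstance (coordsMetric (G := G) W) := by
  have hc : Continuous (coords (G := G) W) := by
    refine continuous_pi fun i => ?_
    cases i with
    | inl i => exact continuous_piecewise (W i)
    | inr v => exact (continuous_coord v).const_mul 2
  exact ((hc.isClosedEmbedding (coords_injective W)).isInducing.eq_induced).symm

theorem abs_piecewise_sub_le (W : ι → V → V → ℤ) (i : ι) (x y : GraphSpace G) :
    |piecewise (W i) x.1 - piecewise (W i) y.1| ≤ (coordsMetric W).dist x y :=
  dist_le_pi_dist (coords W x) (coords W y) (Sum.inl i)

/-- A half of an edge on which no coordinate changes more than the coordinate `i`. -/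
theorem dist_le_of_half {W : ι → V → V → ℤ} (hW : ∀ i u v, W i u v = W i v u) {u v : V}
    (huv : G.Adj u v) {i : ι} (hne : W i u v ≠ W i u u)
    (hi : ∀ j, |W j u v - W j u u| ≤ |W i u v - W i u u|) :
    (∀ x ∈ seg (vtx G u) (edgeMid G s(u, v)), ∀ y ∈ seg (vtx G u) (edgeMid G s(u, v)),
      (coordsMetric W).dist x y ≤ |piecewise (W i) x.1 - piecewise (W i) y.1|) ∧
    (fun x : GraphSpace G => piecewise (W i) x.1) '' seg (vtx G u) (edgeMid G s(u, v)) =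
      uIcc (W i u u : ℝ) (W i u v) := by
  have hcl : edgeMid G s(u, v) ∈ closedEdge G u v := by
    rw [← edgePt_ne (edgeMid G) huv.ne]
    exact edgePt_edgeMid_mem (Or.inr huv) (Or.inl rfl) (Or.inr rfl)
  have hv : (edgeMid G s(u, v)).1 v = 1 / 2 := by
    rw [edgeMid_coe huv, edgeCenter_apply, if_neg huv.ne', if_pos rfl, zero_add]
  have hseg : ∀ x, x ∈ seg (vtx G u) (edgeMid G s(u, v)) ↔
      x ∈ closedEdge G u v ∧ x.1 v ∈ Icc (0 : ℝ) (1 / 2) := fun x => by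
    rw [mem_seg_iff huv.ne (vtx_mem_closedEdge_left u v) hcl (by
      rw [vtx_ne huv.ne', hv]; norm_num), vtx_ne huv.ne', hv]
  have hval : ∀ j, ∀ x ∈ seg (vtx G u) (edgeMid G s(u, v)),
      piecewise (W j) x.1 = W j u u + (2 * ((W j u v : ℝ) - W j u u)) * x.1 v := by
    intro j x hx
    obtain ⟨hx, -, h⟩ := (hseg x).1 hx
    have hadd := add_eq_one huv.ne hx
    rw [piecewise_apply (hW j) huv.ne hx, min_eq_right (by linarith)]
    linear_combination (W j u u : ℝ) * hadd
  constructor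
  · intro x hx y hy
    have hxy : ∀ j, piecewise (W j) x.1 - piecewise (W j) y.1 =
        (2 * ((W j u v : ℝ) - W j u u)) * (x.1 v - y.1 v) := fun j => by
      rw [hval j x hx, hval j y hy]
      ring
    have h2 : ∀ j, |(W j u v : ℝ) - W j u u| ≤ |(W i u v : ℝ) - W i u u| := fun j => by
      exact_mod_cast hi j
    -- Integrality of the table: the coordinate `i` changes by at least `1` and so dominates the
    -- vertex coordinates.
    have h1 : 1 ≤ |(W i u v : ℝ) - W i u u| := by
      exact_mod_cast Int.one_le_abs (sub_ne_zero.2 hne)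
    have hnn := abs_nonneg (x.1 v - y.1 v)
    have hle : 2 * |x.1 v - y.1 v| ≤ |piecewise (W i) x.1 - piecewise (W i) y.1| := by
      rw [hxy i, abs_mul, abs_mul, abs_two]
      nlinarith
    refine (dist_pi_le_iff (abs_nonneg _)).2 fun k => ?_
    cases k with
    | inl j =>
      change |piecewise (W j) x.1 - piecewise (W j) y.1| ≤ _
      rw [hxy i, hxy j, abs_mul, abs_mul, abs_mul, abs_mul]
      exact mul_le_mul_of_nonneg_right (mul_le_mul_of_nonneg_left (h2 j) (abs_nonneg _)) hnn
    | inr w =>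
      change |2 * x.1 w - 2 * y.1 w| ≤ _
      rw [← mul_sub, abs_mul, abs_two]
      have hx' := ((hseg x).1 hx).1
      have hy' := ((hseg y).1 hy).1
      by_cases hw : w = u ∨ w = v
      · rcases hw with rfl | rfl
        · have e : x.1 w - y.1 w = -(x.1 v - y.1 v) := by
            linear_combination add_eq_one huv.ne hx' - add_eq_one huv.ne hy'
          rw [e, abs_neg]
          exact hle
        · exact hle
      · rw [not_imp_comm.1 (hx' w) hw, not_imp_comm.1 (hy' w) hw]
        simp
  · have e1 : (fun x : GraphSpace G => x.1 v) '' seg (vtx G u) (edgeMid G s(u, v)) =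
        uIcc (0 : ℝ) (1 / 2) := by
      rw [uIcc_of_le (by norm_num)]
      ext t
      constructor
      · rintro ⟨x, hx, rfl⟩
        exact ((hseg x).1 hx).2
      · intro ht
        obtain ⟨x, hx, e⟩ := exists_mem_closedEdge huv ⟨ht.1, ht.2.trans (by norm_num)⟩
        exact ⟨x, (hseg x).2 ⟨hx, by rwa [e]⟩, e⟩
    have e2 : (fun x : GraphSpace G => piecewise (W i) x.1) '' seg (vtx G u) (edgeMid G s(u, v)) =
        (fun t => (W i u u : ℝ) + t) '' ((fun t => (2 * ((W i u v : ℝ) - W i u u)) * t) ''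
          ((fun x : GraphSpace G => x.1 v) '' seg (vtx G u) (edgeMid G s(u, v)))) := by
      rw [image_image, image_image]
      exact image_congr fun x hx => hval i x hx
    rw [e2, e1, image_const_mul_uIcc, image_const_add_uIcc]
    congr 1 <;> ring

variable (G) in
/-- Two points are a vertex and the midpoint of an edge at this vertex, and between them no
coordinate changes more than the coordinate `i`, which increases. -/
def IsStep (W : ι → V → V → ℤ) (i : ι) (p q : V × V) : Prop :=
  (∃ u v, G.Adj u v ∧ ((p = (u, u) ∧ (q = (u, v) ∨ q = (v, u))) ∨
    (q = (u, u) ∧ (p = (u, v) ∨ p = (v, u))))) ∧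
  W i p.1 p.2 < W i q.1 q.2 ∧ ∀ j, |W j q.1 q.2 - W j p.1 p.2| ≤ W i q.1 q.2 - W i p.1 p.2

instance [DecidableRel G.Adj] (W : ι → V → V → ℤ) (i : ι) : DecidableRel (IsStep G W i) :=
  fun _ _ => by
    unfold IsStep
    infer_instance

theorem piecewise_vtx {w : V → V → ℤ} (hw : ∀ u v, w u v = w v u) {u v : V} (h : G.Adj u v) :
    piecewise w (vtx G u).1 = w u u := by
  rw [piecewise_apply hw h.ne (vtx_mem_closedEdge_left u v), vtx_self, vtx_ne h.ne']
  simp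

theorem piecewise_edgeMid {w : V → V → ℤ} (hw : ∀ u v, w u v = w v u) {u v : V} (h : G.Adj u v) :
    piecewise w (edgeMid G s(u, v)).1 = w u v := by
  have hcl : edgeMid G s(u, v) ∈ closedEdge G u v := by
    rw [← edgePt_ne (edgeMid G) h.ne]
    exact edgePt_edgeMid_mem (Or.inr h) (Or.inl rfl) (Or.inr rfl)
  rw [piecewise_apply hw h.ne hcl, edgeMid_coe h, edgeCenter_apply, edgeCenter_apply]
  simp only [if_true, if_neg h.ne, if_neg h.ne']
  norm_num
  ring

theorem IsStep.calibrated {W : ι → V → V → ℤ} (hW : ∀ i u v, W i u v = W i v u) {i : ι}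
    {p q : V × V} (h : IsStep G W i p q) :
    Calibrated (coordsMetric W) (fun x : GraphSpace G => piecewise (W i) x.1)
      (Subtype.val ⁻¹' segment ℝ (edgeCenter p.1 p.2) (edgeCenter q.1 q.2))
      (edgePt (edgeMid G) p) (edgePt (edgeMid G) q) := by
  obtain ⟨⟨u, v, huv, h0⟩, hlt, hle⟩ := h
  have hvu : (v, u).1 = (v, u).2 ∨ G.Adj (v, u).1 (v, u).2 := Or.inr huv.symm
  have hp : ∀ {p : V × V}, p = (u, v) ∨ p = (v, u) → edgePt (edgeMid G) p = edgeMid G s(u, v) ∧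
      edgeCenter p.1 p.2 = (edgeMid G s(u, v)).1 ∧ ∀ j, W j p.1 p.2 = W j u v := by
    rintro p (rfl | rfl)
    · exact ⟨edgePt_ne _ huv.ne, (edgeMid_coe huv).symm, fun j => rfl⟩
    · rw [Sym2.eq_swap]
      exact ⟨edgePt_ne _ huv.ne', (edgeMid_coe huv.symm).symm, fun j => hW j v u⟩
  have hu : edgeCenter u u = (vtx G u).1 := midpoint_self _ _
  rcases h0 with ⟨rfl, hq⟩ | ⟨rfl, hp'⟩
  · obtain ⟨e1, e2, e3⟩ := hp hq
    simp only [e3] at hlt hle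
    obtain ⟨h1, h2⟩ := dist_le_of_half hW huv (i := i) hlt.ne'
      fun j => (hle j).trans (le_abs_self _)
    have hlt' : (W i u u : ℝ) < W i u v := by exact_mod_cast hlt
    rw [e1, e2, edgePt_self]
    simp only
    rw [hu]
    refine ⟨left_mem_seg _ _, right_mem_seg _ _, ?_, h1, ?_⟩
    · rw [piecewise_vtx (hW i) huv, piecewise_edgeMid (hW i) huv]
      exact hlt'.le
    · rw [piecewise_vtx (hW i) huv, piecewise_edgeMid (hW i) huv, ← uIcc_of_le hlt'.le]
      exact h2
  · obtain ⟨e1, e2, e3⟩ := hp hp'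
    simp only [e3] at hlt hle
    obtain ⟨h1, h2⟩ := dist_le_of_half hW huv (i := i) hlt.ne
      fun j => by
        rw [abs_sub_comm, abs_sub_comm (W i u v)]
        exact (hle j).trans (le_abs_self _)
    have hlt' : (W i u v : ℝ) < W i u u := by exact_mod_cast hlt
    rw [e1, e2, edgePt_self, segment_symm]
    simp only
    rw [hu]
    refine ⟨right_mem_seg _ _, left_mem_seg _ _, ?_, h1, ?_⟩
    · rw [piecewise_vtx (hW i) huv, piecewise_edgeMid (hW i) huv]
      exact hlt'.le
    · rw [piecewise_vtx (hW i) huv, piecewise_edgeMid (hW i) huv, ← uIcc_of_ge hlt'.le]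
      exact h2

theorem calibrated_polyline {W : ι → V → V → ℤ} (hW : ∀ i u v, W i u v = W i v u) {i : ι}
    {p q : V × V} {l : List (V × V)} (h : (p :: q :: l).IsChain (IsStep G W i)) :
    Calibrated (coordsMetric W) (fun x : GraphSpace G => piecewise (W i) x.1)
      (Subtype.val ⁻¹' polyline ((p :: q :: l).map fun p => edgeCenter p.1 p.2))
      (edgePt (edgeMid G) p) (edgePt (edgeMid G) ((q :: l).getLast (by simp))) := by
  induction l generalizing p q with
  | nil =>
    rw [List.isChain_pair] at h
    simpa [polyline] using h.calibrated hW
  | cons r l ih =>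
    rw [List.isChain_cons_cons] at h
    have := (h.1.calibrated hW).union (ih h.2)
    rw [List.getLast_cons (by simp)]
    simp only [List.map_cons, polyline, preimage_union] at this ⊢
    exact this

theorem graphPath_eq_refine (l : List (V × V)) :
    graphPath G l = Subtype.val ⁻¹' polyline ((refine l).map fun p => edgeCenter p.1 p.2) := by
  rw [polyline_refine]
  rfl

/-- A path along which the coordinate `i` changes most is a geodesic. -/
theorem isGeodesicBetween_graphPath {W : ι → V → V → ℤ} (hW : ∀ i u v, W i u v = W i v u) {i : ι}
    {l : List (V × V)} {a b : V × V} (ha : l.head? = some a) (hb : l.getLast? = some b)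
    (hl : 2 ≤ (refine l).length) (h : (refine l).IsChain (IsStep G W i)) :
    IsGeodesicBetween (coordsMetric W) (graphPath G l) (edgePt (edgeMid G) a)
      (edgePt (edgeMid G) b) := by
  rw [← head_refine] at ha
  rw [← getLast_refine] at hb
  rw [graphPath_eq_refine]
  match hr : refine l with
  | [] => simp [hr] at hl
  | [_] => simp [hr] at hl
  | p :: q :: r =>
    rw [hr] at h ha hb
    have := (calibrated_polyline hW h).isGeodesicBetween
      fun x y => abs_piecewise_sub_le W i x y
    obtain rfl : p = a := by simpa using ha
    have hb' : (q :: r).getLast (by simp) = b := by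
      rw [List.getLast?_cons_cons] at hb
      exact List.getLast_of_getLast?_eq_some hb
    rwa [hb'] at this

/-- A list of points contains a half of the edge `uv`, at the end `u`. -/
def ContainsHalf (l : List (V × V)) (u v : V) : Prop :=
  [(u, u), (u, v)] <:+: l ∨ [(u, u), (v, u)] <:+: l ∨ [(u, v), (u, u)] <:+: l ∨
    [(v, u), (u, u)] <:+: l

instance (l : List (V × V)) (u v : V) : Decidable (ContainsHalf l u v) := by
  unfold ContainsHalf
  infer_instance

theorem mem_graphPath_of_containsHalf {l : List (V × V)} {u v : V} (huv : G.Adj u v)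
    (h : ContainsHalf (refine l) u v) {x : GraphSpace G} (hx : x ∈ closedEdge G u v)
    (hle : x.1 v ≤ 1 / 2) : x ∈ graphPath G l := by
  have hmem : x.1 ∈ segment ℝ (edgeCenter u u) (edgeCenter u v) := by
    refine ⟨1 - 2 * x.1 v, 2 * x.1 v, by linarith, by linarith [nonneg x v], by ring,
      funext fun w => ?_⟩
    simp only [Pi.add_apply, Pi.smul_apply, smul_eq_mul, edgeCenter_apply]
    by_cases hw : w = u
    · subst hw
      simp only [if_true, if_neg huv.ne]
      linear_combination -add_eq_one huv.ne hx
    · by_cases hw' : w = v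
      · subst hw'
        simp only [if_true, if_neg hw]
        ring
      · rw [if_neg hw, if_neg hw', not_imp_comm.1 (hx w) (not_or.2 ⟨hw, hw'⟩)]
        ring
  have hc : edgeCenter v u = edgeCenter u v := midpoint_comm _ _
  rw [graphPath_eq_refine]
  have hs {p q : V × V} {l : List (V × V)} (h : [p, q] <:+: l) :=
    segment_subset_polyline (f := fun p : V × V => edgeCenter p.1 p.2) h
  rcases h with h | h | h | h
  · exact hs h hmem
  · exact hs h (by simp only; rwa [hc])
  · exact hs h (by simp only; rwa [segment_symm])
  · exact hs h (by simp only; rwa [hc, segment_symm])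

/-- Paths that contain all halves of edges cover the graph. -/
theorem exists_mem_graphPath {κ : Type*} {l : κ → List (V × V)} (hG : ∀ u, ∃ v, G.Adj u v)
    (h : ∀ u v, G.Adj u v → ∃ i, ContainsHalf (refine (l i)) u v) (x : GraphSpace G) :
    ∃ i, x ∈ graphPath G (l i) := by
  obtain ⟨u, v, huv, hx⟩ : ∃ u v, G.Adj u v ∧ x ∈ closedEdge G u v := by
    rcases vtx_or_openEdge x with ⟨u, rfl⟩ | ⟨u, v, huv, hx⟩
    · obtain ⟨v, huv⟩ := hG u
      exact ⟨u, v, huv, vtx_mem_closedEdge_left u v⟩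
    · exact ⟨u, v, huv, (mem_closedEdge_of_mem_openEdge huv.ne hx).1⟩
  have hadd := add_eq_one huv.ne hx
  rcases le_total (x.1 v) (1 / 2) with hle | hle
  · obtain ⟨i, hi⟩ := h u v huv
    exact ⟨i, mem_graphPath_of_containsHalf huv hi hx hle⟩
  · obtain ⟨i, hi⟩ := h v u huv.symm
    rw [closedEdge_comm] at hx
    exact ⟨i, mem_graphPath_of_containsHalf huv.symm hi hx (by linarith)⟩

/-- A family of paths that covers the graph `G`, and functions that show that there is a metric for
which they are geodesics. -/
structure IsCoverData (G : SimpleGraph V) (l : ι → List (V × V)) (W : ι → V → V → ℤ) : Prop where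
  symm : ∀ i u v, W i u v = W i v u
  two_le : ∀ i, 2 ≤ (refine (l i)).length
  isChain : ∀ i, (refine (l i)).IsChain (IsStep G W i)
  exists_adj : ∀ u, ∃ v, G.Adj u v
  covers : ∀ u v, G.Adj u v → ∃ i, ContainsHalf (refine (l i)) u v

theorem IsCoverData.isGeodesicBetween {l : ι → List (V × V)} {W : ι → V → V → ℤ}
    (h : IsCoverData G l W) {i : ι} {a b : V × V} (ha : (l i).head? = some a)
    (hb : (l i).getLast? = some b) : IsGeodesicBetween (coordsMetric W) (graphPath G (l i))
      (edgePt (edgeMid G) a) (edgePt (edgeMid G) b) :=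
  isGeodesicBetween_graphPath h.symm ha hb (h.two_le i) (h.isChain i)

theorem IsCoverData.isGeodesicCover {l : ι → List (V × V)} {W : ι → V → V → ℤ}
    (h : IsCoverData G l W) :
    IsGeodesicCover (coordsMetric W) (range fun i => graphPath G (l i)) := by
  refine ⟨finite_range _, ?_, ?_⟩
  · rintro _ ⟨i, rfl⟩
    have hne : l i ≠ [] := fun e => by
      have := h.two_le i
      simp [e, refine] at this
    exact ⟨_, _, h.isGeodesicBetween (List.head?_eq_some_head hne)
      (List.getLast?_eq_some_getLast hne)⟩
  · refine eq_univ_of_forall fun x => ?_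
    obtain ⟨i, hi⟩ := exists_mem_graphPath h.exists_adj h.covers x
    exact ⟨_, ⟨i, rfl⟩, hi⟩

theorem IsCoverData.coverNumber_le {n : ℕ} {l : Fin n → List (V × V)} {W : Fin n → V → V → ℤ}
    (h : IsCoverData G l W) : coverNumber (GraphSpace G) ≤ n := by
  have h1 : coverNumber (GraphSpace G) ≤ (range fun i => graphPath G (l i)).encard :=
    sInf_le ⟨_, isCompatible_coordsMetric W, _, h.isGeodesicCover, rfl⟩
  refine h1.trans ?_
  rw [← image_univ]
  refine (encard_image_le _ _).trans ?_
  simp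

/-! ### Intersections of paths, and ends that cannot be retracted. -/

open GraphSpace

variable {V : Type*}

theorem mem_polyline_of_mem {W : Type*} {f : W → V → ℝ} {p : W} {l : List W} (hl : 2 ≤ l.length)
    (hp : p ∈ l) : f p ∈ polyline (l.map f) := by
  induction l with
  | nil => simp at hp
  | cons a l ih =>
    cases l with
    | nil => simp at hl
    | cons b l =>
      rcases List.mem_cons.1 hp with rfl | hp
      · exact Or.inl (left_mem_segment ℝ _ _)
      · cases l with
        | nil =>
          rw [List.mem_singleton] at hp
          subst hp
          exact Or.inl (right_mem_segment ℝ _ _)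
        | cons d l => exact Or.inr (ih (by simp) hp)

variable [DecidableEq V]

/-- Two points are a vertex and the midpoint of an edge at this vertex. -/
def IsHalf (p q : V × V) : Prop :=
  ∃ u v, u ≠ v ∧ ((p = (u, u) ∧ (q = (u, v) ∨ q = (v, u))) ∨
    (q = (u, u) ∧ (p = (u, v) ∨ p = (v, u))))

instance [Fintype V] : DecidableRel (IsHalf : V × V → V × V → Prop) := fun _ _ => by
  unfold IsHalf
  infer_instance

/-- Two successive points of a path are the vertex `u` and a point of the edge `uv`. -/
def Hits (u v : V) (p q : V × V) : Prop :=
  (p = (u, u) ∧ (q.1 = v ∨ q.2 = v)) ∨ (q = (u, u) ∧ (p.1 = v ∨ p.2 = v))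

instance (u v : V) : DecidableRel (Hits u v) := fun _ _ => by
  unfold Hits
  infer_instance

/-- Two paths have a vertex or a midpoint of an edge in common. -/
def Meet (l l' : List (V × V)) : Prop :=
  ∃ p ∈ refine l, ∃ q ∈ refine l', s(p.1, p.2) = s(q.1, q.2)

instance (l l' : List (V × V)) : Decidable (Meet l l') := by
  unfold Meet
  infer_instance

theorem edgeCenter_le_half {u : V} {p : V × V} (hp : p ≠ (u, u)) : edgeCenter p.1 p.2 u ≤ 1 / 2 := by
  rw [edgeCenter_apply]
  by_cases h1 : u = p.1
  · have h2 : ¬ u = p.2 := fun h2 => hp (Prod.ext h1.symm h2.symm)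
    rw [if_pos h1, if_neg h2]
    norm_num
  · rw [if_neg h1]
    split_ifs <;> norm_num

/-- A segment of the broken line with a point whose coordinate at `u` exceeds `1 / 2` must have the
vertex `u` as an end, and the coordinate at `v` can then only come from its other end. -/
theorem notMem_polyline_of_not_hits {u v : V} (huv : u ≠ v) {l : List (V × V)}
    (hl : l.IsChain fun p q => ¬ Hits u v p q) {x : V → ℝ} (hu : 1 / 2 < x u) (hv : x v ≠ 0) :
    x ∉ polyline (l.map fun p => edgeCenter p.1 p.2) := by
  induction l with
  | nil => simp [polyline]
  | cons p l ih =>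
    cases l with
    | nil => simp [polyline]
    | cons q l =>
      rw [List.isChain_cons_cons] at hl
      rintro (⟨a, b, ha, hb, hab, rfl⟩ | hx)
      · simp only [Pi.add_apply, Pi.smul_apply, smul_eq_mul] at hu hv
        have hz : ∀ {p : V × V}, ¬ (p.1 = v ∨ p.2 = v) → edgeCenter p.1 p.2 v = 0 := by
          intro p hp
          rw [not_or] at hp
          rw [edgeCenter_apply, if_neg (Ne.symm hp.1), if_neg (Ne.symm hp.2)]
          norm_num
        have huz : edgeCenter u u v = 0 := hz (p := (u, u)) (by simp [huv])
        by_cases hp : p = (u, u)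
        · subst hp
          refine hl.1 (Or.inl ⟨rfl, ?_⟩)
          by_contra hq
          rw [huz, hz hq] at hv
          simp at hv
        · by_cases hq : q = (u, u)
          · subst hq
            refine hl.1 (Or.inr ⟨rfl, ?_⟩)
            by_contra hp
            rw [huz, hz hp] at hv
            simp at hv
          · have h1 := mul_le_mul_of_nonneg_left (edgeCenter_le_half hp) ha
            have h2 := mul_le_mul_of_nonneg_left (edgeCenter_le_half hq) hb
            linarith
      · exact ih hl.2 hx

/-- On a half edge every point but the midpoint has a coordinate above `1 / 2` at the vertex. So a
point determines the vertex or midpoint that it belongs to, which makes intersections of paths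
decidable. -/
theorem exists_of_mem_polyline {l : List (V × V)} (hl : l.IsChain IsHalf) {x : V → ℝ}
    (hx : x ∈ polyline (l.map fun p => edgeCenter p.1 p.2)) :
    ∃ p ∈ l, (p.1 = p.2 ∧ 1 / 2 < x p.1) ∨ (p.1 ≠ p.2 ∧ x p.1 = 1 / 2 ∧ x p.2 = 1 / 2) := by
  induction l with
  | nil => simp [polyline] at hx
  | cons p l ih =>
    cases l with
    | nil => simp [polyline] at hx
    | cons q l =>
      rw [List.isChain_cons_cons] at hl
      rcases hx with hx | hx
      · have key : ∀ {p q : V × V} {u v : V}, u ≠ v → p = (u, u) → q = (u, v) ∨ q = (v, u) →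
            x ∈ segment ℝ (edgeCenter p.1 p.2) (edgeCenter q.1 q.2) →
            (p.1 = p.2 ∧ 1 / 2 < x p.1) ∨ (q.1 ≠ q.2 ∧ x q.1 = 1 / 2 ∧ x q.2 = 1 / 2) := by
          rintro p q u v huv rfl hq ⟨a, b, ha, hb, hab, rfl⟩
          have hq' : edgeCenter q.1 q.2 u = 1 / 2 ∧ edgeCenter q.1 q.2 v = 1 / 2 := by
            rcases hq with rfl | rfl <;> simp [edgeCenter_apply, huv, huv.symm]
          have hu : edgeCenter u u u = 1 ∧ edgeCenter u u v = 0 := by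
            simp [edgeCenter_apply, huv.symm]
          rcases ha.eq_or_lt with rfl | ha
          · right
            rw [zero_add] at hab
            subst hab
            rcases hq with rfl | rfl <;> simp_all [eq_comm]
          · left
            simp only [Pi.add_apply, Pi.smul_apply, smul_eq_mul, hq', hu]
            exact ⟨trivial, by linarith⟩
        obtain ⟨u, v, huv, ⟨hp, hq⟩ | ⟨hq, hp⟩⟩ := hl.1
        · rcases key huv hp hq hx with h | h
          · exact ⟨p, by simp, Or.inl h⟩
          · exact ⟨q, by simp, Or.inr h⟩
        · rw [segment_symm] at hx
          rcases key huv hq hp hx with h | h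
          · exact ⟨q, by simp, Or.inl h⟩
          · exact ⟨p, by simp, Or.inr h⟩
      · obtain ⟨r, hr, h⟩ := ih hl.2 hx
        exact ⟨r, List.mem_cons_of_mem _ hr, h⟩

variable [Fintype V] {G : SimpleGraph V}

theorem edgePt_mem_graphPath {l : List (V × V)} (h2 : 2 ≤ (refine l).length) {p : V × V}
    (hp : p ∈ refine l) : edgePt (edgeMid ⊤) p ∈ graphPath (⊤ : SimpleGraph V) l := by
  have h : (edgePt (edgeMid (⊤ : SimpleGraph V)) p).1 ∈
      polyline ((refine l).map fun p => edgeCenter p.1 p.2) := by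
    have hp' : p.1 = p.2 ∨ (⊤ : SimpleGraph V).Adj p.1 p.2 := eq_or_ne _ _
    rw [edgePt_edgeMid hp']
    exact mem_polyline_of_mem (f := fun p : V × V => edgeCenter p.1 p.2) (p := p) h2 hp
  rw [graphPath_eq_refine]
  exact h

theorem inter_graphPath_nonempty_iff {l l' : List (V × V)} (hl : (refine l).IsChain IsHalf)
    (hl' : (refine l').IsChain IsHalf) (h2 : 2 ≤ (refine l).length)
    (h2' : 2 ≤ (refine l').length) :
    (graphPath (⊤ : SimpleGraph V) l ∩ graphPath ⊤ l').Nonempty ↔ Meet l l' := by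
  constructor
  · rintro ⟨x, hx, hx'⟩
    rw [graphPath_eq_refine] at hx hx'
    obtain ⟨p, hp, h⟩ := exists_of_mem_polyline hl hx
    obtain ⟨q, hq, h'⟩ := exists_of_mem_polyline hl' hx'
    refine ⟨p, hp, q, hq, ?_⟩
    -- Coordinates add up to `1`: this excludes coordinates above `1 / 2` at two vertices, or `1 /
    -- 2` at one and more at another, or `1 / 2` at three.
    have hle : ∀ a b, a ≠ b → x.1 a + x.1 b ≤ 1 := by
      intro a b hab
      rw [← sum_eq_one x, ← Finset.sum_pair hab]
      exact Finset.sum_le_univ_sum_of_nonneg fun v => nonneg x v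
    have hle3 : ∀ a b d, a ≠ b → a ≠ d → b ≠ d → x.1 a + x.1 b + x.1 d ≤ 1 := by
      intro a b d hab had hbd
      have h3 : ∑ v ∈ {a, b, d}, x.1 v = x.1 a + (x.1 b + x.1 d) := by
        rw [Finset.sum_insert (by simp [hab, had]), Finset.sum_pair hbd]
      have h4 := Finset.sum_le_univ_sum_of_nonneg (s := {a, b, d}) fun v => nonneg x v
      rw [h3, sum_eq_one] at h4
      linarith
    obtain ⟨a, b⟩ := p
    obtain ⟨c, d⟩ := q
    simp only at h h'
    rw [Sym2.eq_iff]
    rcases h with ⟨rfl, h⟩ | ⟨hab, ha, hb⟩ <;> rcases h' with ⟨rfl, h'⟩ | ⟨hcd, hc, hd⟩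
    · by_cases hac : a = c
      · exact Or.inl ⟨hac, hac⟩
      · linarith [hle a c hac]
    · have h1 : a ≠ c := by rintro rfl; linarith
      linarith [hle a c h1]
    · have h1 : a ≠ c := by rintro rfl; linarith
      linarith [hle a c h1]
    · by_cases hac : a = c
      · subst hac
        by_cases hbd : b = d
        · exact Or.inl ⟨rfl, hbd⟩
        · linarith [hle3 a b d hab hcd hbd]
      · by_cases had : a = d
        · subst had
          by_cases hbc : b = c
          · exact Or.inr ⟨rfl, hbc⟩
          · linarith [hle3 a b c hab hac hbc]
        · linarith [hle3 a c d hac had hcd]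
  · rintro ⟨p, hp, q, hq, h⟩
    refine ⟨edgePt (edgeMid ⊤) p, edgePt_mem_graphPath h2 hp, ?_⟩
    have hc : edgePt (edgeMid (⊤ : SimpleGraph V)) p = edgePt (edgeMid ⊤) q := by
      rcases Sym2.eq_iff.1 h with ⟨h1, h2⟩ | ⟨h1, h2⟩
      · rw [Prod.ext h1 h2]
      · rw [show p = q.swap from Prod.ext h1 h2, edgePt_swap]
    rw [hc]
    exact edgePt_mem_graphPath h2' hq

/-- The midpoint of an edge belongs to the closure of a half of the edge. -/
theorem edgeMid_mem_closure {u v : V} (huv : G.Adj u v) :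
    edgeMid G s(u, v) ∈ closure {x | x ∈ openEdge G u v ∧ 1 / 2 < x.1 u} := by
  have hi : Topology.IsInducing (Subtype.val : GraphSpace G → V → ℝ) := ⟨rfl⟩
  rw [hi.closure_eq_preimage_closure_image, mem_preimage, edgeMid_coe huv]
  have hsub : openSegment ℝ (edgeCenter u v) (Pi.single u 1) ⊆
      Subtype.val '' {x | x ∈ openEdge G u v ∧ 1 / 2 < x.1 u} := by
    rintro _ ⟨a, b, ha, hb, hab, rfl⟩
    obtain ⟨x, hx, e⟩ := exists_mem_closedEdge huv (t := a / 2) ⟨by linarith, by linarith⟩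
    have hadd := add_eq_one huv.ne hx
    refine ⟨x, ⟨⟨by linarith, by linarith⟩, by linarith⟩, funext fun w => ?_⟩
    simp only [Pi.add_apply, Pi.smul_apply, smul_eq_mul, edgeCenter_apply, Pi.single_apply]
    by_cases hw : w = u
    · subst hw
      simp only [if_true, if_neg huv.ne]
      linarith
    · by_cases hw' : w = v
      · subst hw'
        simp only [if_true, if_neg hw]
        linarith
      · rw [if_neg hw, if_neg hw', not_imp_comm.1 (hx w) (not_or.2 ⟨hw, hw'⟩)]
        ring
  refine closure_mono hsub ?_
  rw [closure_openSegment]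
  exact left_mem_segment ℝ _ _

variable {ι : Type*} [Fintype ι]

/-- A path is not retractable if each of its ends is in an edge of which it alone contains a
half. -/
theorem IsCoverData.not_isRetractable {l : ι → List (V × V)} {W : ι → V → V → ℤ}
    (h : IsCoverData G l W) {i : ι}
    (hfree : ∀ p, (l i).head? = some p ∨ (l i).getLast? = some p → ∃ u v, G.Adj u v ∧
      (p = (u, v) ∨ p = (v, u)) ∧ ∀ j, l j ≠ l i → (l j).IsChain fun p q => ¬ Hits u v p q) :
    ¬ IsRetractable inferInstance (coordsMetric W) (range fun i => graphPath G (l i))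
      (graphPath G (l i)) := by
  have key : ∀ p, (l i).head? = some p ∨ (l i).getLast? = some p →
      ¬ ∃ U ∈ nhds (edgePt (edgeMid G) p),
        U ⊆ ⋃₀ (range (fun i => graphPath G (l i)) \ {graphPath G (l i)}) := by
    rintro p hp ⟨U, hU, hsub⟩
    obtain ⟨u, v, huv, hpu, hj⟩ := hfree p hp
    have hpt : edgePt (edgeMid G) p = edgeMid G s(u, v) := by
      rcases hpu with rfl | rfl
      · exact edgePt_ne _ huv.ne
      · rw [edgePt_ne _ huv.ne', Sym2.eq_swap]
    rw [hpt] at hU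
    -- Every neighborhood of the end contains points of the half at `u`, and these belong to no
    -- other path.
    obtain ⟨x, hxU, hx, hxu⟩ := mem_closure_iff_nhds.1 (edgeMid_mem_closure huv) U hU
    obtain ⟨_, ⟨⟨j, rfl⟩, hne⟩, hxj⟩ := hsub hxU
    exact notMem_polyline_of_not_hits huv.ne
      (hj j fun e => hne (congrArg (graphPath G) e)) hxu hx.2 hxj
  have hne : l i ≠ [] := fun e => by
    have := h.two_le i
    simp [e, refine] at this
  have ha := List.head?_eq_some_head hne
  have hb := List.getLast?_eq_some_getLast hne
  rintro ⟨p, q, hpq, hU⟩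
  obtain ⟨h1, h2⟩ := (h.isGeodesicBetween ha hb).eq_or_eq hpq
  rcases hU with hU | hU
  · rcases h1 with rfl | rfl
    exacts [key _ (Or.inl ha) hU, key _ (Or.inr hb) hU]
  · rcases h2 with rfl | rfl
    exacts [key _ (Or.inl ha) hU, key _ (Or.inr hb) hU]

/-! ### The explicit covers and the cover numbers. -/

open GraphSpace

instance {V : Type*} [Fintype V] [DecidableEq V] {ι : Type*} [Fintype ι] {G : SimpleGraph V}
    [DecidableRel G.Adj] (l : ι → List (V × V)) (W : ι → V → V → ℤ) :
    Decidable (IsCoverData G l W) :=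
  decidable_of_iff ((∀ i u v, W i u v = W i v u) ∧ (∀ i, 2 ≤ (refine (l i)).length) ∧
    (∀ i, (refine (l i)).IsChain (IsStep G W i)) ∧ (∀ u, ∃ v, G.Adj u v) ∧
    ∀ u v, G.Adj u v → ∃ i, ContainsHalf (refine (l i)) u v)
    ⟨fun ⟨h1, h2, h3, h4, h5⟩ => ⟨h1, h2, h3, h4, h5⟩,
      fun ⟨h1, h2, h3, h4, h5⟩ => ⟨h1, h2, h3, h4, h5⟩⟩

/-- Four paths that cover `K₄`. -/
def k4Paths : Fin 4 → List (Fin 4 × Fin 4) :=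
  ![[(1, 3), (1, 1), (0, 0), (2, 2)], [(1, 3), (3, 3), (2, 2)], [(0, 0), (3, 3)], [(1, 1), (2, 2)]]

/-- The distances from the beginnings of the four paths in `K₄`. -/
def k4Dist : Fin 4 → Fin 4 → Fin 4 → ℤ :=
  ![![![3, 2, 4, 5], ![2, 1, 3, 0], ![4, 3, 5, 3], ![5, 0, 3, 2]],
    ![![3, 2, 4, 5], ![2, 1, 3, 0], ![4, 3, 5, 3], ![5, 0, 3, 2]],
    ![![0, 1, 1, 2], ![1, 2, 4, 3], ![1, 4, 2, 4], ![2, 3, 4, 5]],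
    ![![2, 1, 3, 4], ![1, 0, 2, 1], ![3, 2, 4, 4], ![4, 1, 4, 3]]]

/-- Four paths that cover `K₃,₃`, with vertices in `Fin 6`. -/
def k33Paths : Fin 4 → List (Fin 6 × Fin 6) :=
  ![[(1, 5), (5, 5), (0, 0), (4, 4), (2, 4)], [(2, 2), (4, 4), (1, 1), (1, 5)],
    [(1, 3), (3, 3), (0, 0), (5, 5), (2, 5)], [(1, 1), (3, 3), (2, 2), (2, 5)]]

/-- The distances from the beginnings of the four paths in `K₃,₃`. -/
def k33Dist : Fin 4 → Fin 6 → Fin 6 → ℤ :=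
  ![![![6, 0, 0, 7, 7, 5], ![0, 4, 0, 6, 6, 0], ![0, 0, 12, 11, 10, 8], ![7, 6, 11, 7, 0, 0], ![7, 6, 10, 0, 8, 0], ![5, 0, 8, 0, 0, 4]],
    ![![6, 0, 0, 7, 5, 7], ![0, 8, 0, 6, 6, 12], ![0, 0, 0, 1, 2, 4], ![7, 6, 1, 5, 0, 0], ![5, 6, 2, 0, 4, 0], ![7, 12, 4, 0, 0, 8]],
    ![![4, 0, 0, 3, 5, 5], ![0, 2, 0, 0, 4, 6], ![0, 0, 6, 5, 8, 10], ![3, 0, 5, 1, 0, 0], ![5, 4, 8, 0, 6, 0], ![5, 6, 10, 0, 0, 6]],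
    ![![6, 0, 0, 5, 5, 7], ![0, 0, 0, 2, 2, 4], ![0, 0, 8, 7, 6, 12], ![5, 2, 7, 3, 0, 0], ![5, 2, 6, 0, 4, 0], ![7, 4, 12, 0, 0, 8]]]

/-- Three paths that cover `K₂,₃`, with vertices in `Fin 5`. -/
def k23Paths : Fin 3 → List (Fin 5 × Fin 5) :=
  ![[(0, 4), (0, 0), (3, 3), (1, 1), (1, 2)], [(0, 4), (4, 4), (1, 1)],
    [(0, 0), (2, 2), (1, 2)]]

/-- The distances from the beginnings of the three paths in `K₂,₃`. -/
def k23Dist : Fin 3 → Fin 5 → Fin 5 → ℤ :=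
  ![![![1, 0, 4, 3, 0], ![0, 7, 9, 6, 4], ![4, 9, 6, 0, 0], ![3, 6, 0, 4, 0], ![0, 4, 0, 0, 1]],
    ![![1, 0, 4, 3, 0], ![0, 7, 9, 6, 4], ![4, 9, 6, 0, 0], ![3, 6, 0, 4, 0], ![0, 4, 0, 0, 1]],
    ![![0, 0, 3, 2, 1], ![0, 6, 8, 5, 5], ![3, 8, 5, 0, 0], ![2, 5, 0, 3, 0], ![1, 5, 0, 0, 2]]]

/-- The paths of the three covers of `K₅`. -/
def k5Paths (k : Fin 3) (i : Fin 4) : List (Fin 5 × Fin 5) := (k5Lists k).getD i []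

/-- The distances from the beginnings of the paths in `K₅`. -/
def k5Dist : Fin 3 → Fin 4 → Fin 5 → Fin 5 → ℤ :=
  ![![![![4, 3, 5, 3, 5], ![3, 2, 5, 0, 5], ![5, 5, 6, 5, 8], ![3, 0, 5, 2, 3], ![5, 5, 8, 3, 6]],
    ![![5, 6, 4, 4, 6], ![6, 7, 4, 5, 10], ![4, 4, 3, 0, 5], ![4, 5, 0, 3, 4], ![6, 10, 5, 4, 7]],
    ![![4, 3, 5, 3, 5], ![3, 2, 5, 0, 5], ![5, 5, 6, 5, 8], ![3, 0, 5, 2, 3], ![5, 5, 8, 3, 6]],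
    ![![5, 4, 6, 6, 4], ![4, 3, 6, 5, 0], ![6, 6, 7, 10, 5], ![6, 5, 10, 7, 6], ![4, 0, 5, 6, 3]]],
   ![![![4, 3, 3, 5, 5], ![3, 2, 0, 3, 5], ![3, 0, 2, 4, 3], ![5, 3, 4, 6, 9], ![5, 5, 3, 9, 6]],
    ![![4, 3, 3, 5, 5], ![3, 2, 0, 3, 5], ![3, 0, 2, 4, 3], ![5, 3, 4, 6, 9], ![5, 5, 3, 9, 6]],
    ![![5, 4, 6, 6, 4], ![4, 3, 5, 4, 0], ![6, 5, 7, 9, 6], ![6, 4, 9, 7, 6], ![4, 0, 6, 6, 3]],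
    ![![4, 5, 3, 3, 5], ![5, 6, 4, 5, 9], ![3, 4, 2, 0, 3], ![3, 5, 0, 2, 5], ![5, 9, 3, 5, 6]]],
   ![![![4, 3, 3, 5, 6], ![3, 2, 0, 5, 5], ![3, 0, 2, 3, 5], ![5, 5, 3, 6, 9], ![6, 5, 5, 9, 7]],
    ![![4, 3, 3, 5, 6], ![3, 2, 0, 5, 5], ![3, 0, 2, 3, 5], ![5, 5, 3, 6, 9], ![6, 5, 5, 9, 7]],
    ![![5, 6, 4, 6, 3], ![6, 7, 5, 10, 4], ![4, 5, 3, 4, 0], ![6, 10, 4, 7, 4], ![3, 4, 0, 4, 2]],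
    ![![5, 4, 6, 4, 7], ![4, 3, 5, 0, 6], ![6, 5, 7, 6, 10], ![4, 0, 6, 3, 6], ![7, 6, 10, 6, 8]]]]

theorem isCoverData_K4 : IsCoverData (⊤ : SimpleGraph (Fin 4)) k4Paths k4Dist := by
  decide +kernel

theorem isCoverData_K33 : IsCoverData (completeBipartiteGraph (Fin 3) (Fin 3))
    (fun i => (k33Paths i).map (Prod.map finSumFinEquiv.symm finSumFinEquiv.symm))
    (fun i u v => k33Dist i (finSumFinEquiv u) (finSumFinEquiv v)) := by
  decide +kernel

theorem isCoverData_K23 : IsCoverData (completeBipartiteGraph (Fin 2) (Fin 3))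
    (fun i => (k23Paths i).map (Prod.map finSumFinEquiv.symm finSumFinEquiv.symm))
    (fun i u v => k23Dist i (finSumFinEquiv u) (finSumFinEquiv v)) := by
  decide +kernel

theorem isCoverData_K5 : ∀ k, IsCoverData (⊤ : SimpleGraph (Fin 5)) (k5Paths k) (k5Dist k) := by
  decide +kernel

theorem coverNumber_K4 : coverNumber (GraphSpace (⊤ : SimpleGraph (Fin 4))) = 4 :=
  isCoverData_K4.coverNumber_le.antisymm four_le_coverNumber_K4

theorem coverNumber_K33 :
    coverNumber (GraphSpace (completeBipartiteGraph (Fin 3) (Fin 3))) = 4 :=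
  isCoverData_K33.coverNumber_le.antisymm four_le_coverNumber_K33

theorem coverNumber_K23 :
    coverNumber (GraphSpace (completeBipartiteGraph (Fin 2) (Fin 3))) = 3 :=
  isCoverData_K23.coverNumber_le.antisymm three_le_coverNumber_K23

theorem coverNumber_K5 : coverNumber (GraphSpace (⊤ : SimpleGraph (Fin 5))) = 4 :=
  (isCoverData_K5 0).coverNumber_le.antisymm four_le_coverNumber_K5

theorem k5Cover_eq_range (k : Fin 3) : k5Cover k = range fun i => graphPath ⊤ (k5Paths k i) := by
  ext S
  simp only [mem_range]
  fin_cases k <;> simp [k5Cover, k5Paths, k5Lists, Fin.exists_fin_succ, eq_comm]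

theorem k5Paths_free : ∀ k i, ∀ p, (k5Paths k i).head? = some p ∨
    (k5Paths k i).getLast? = some p → ∃ u v, (⊤ : SimpleGraph (Fin 5)).Adj u v ∧
      (p = (u, v) ∨ p = (v, u)) ∧ ∀ j, k5Paths k j ≠ k5Paths k i →
        (k5Paths k j).IsChain fun p q => ¬ Hits u v p q := by
  decide +kernel

/-- The three covers of `K₅` are optimal. -/
theorem isOptimalRetractedCover_k5Cover (k : Fin 3) : IsOptimalRetractedCover (k5Cover k) := by
  have h := isCoverData_K5 k
  have hm := isCompatible_coordsMetric (G := (⊤ : SimpleGraph (Fin 5))) (k5Dist k)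
  rw [k5Cover_eq_range]
  refine ⟨⟨coordsMetric (k5Dist k), hm, h.isGeodesicCover, ?_⟩, le_antisymm ?_ ?_⟩
  · rintro _ ⟨i, rfl⟩
    exact h.not_isRetractable (k5Paths_free k i)
  -- There are at most four sets, and as a cover they are at least as many as the cover number; that
  -- the four sets differ follows and needs no check.
  · rw [coverNumber_K5, ← image_univ]
    refine (encard_image_le _ _).trans ?_
    simp
  · exact sInf_le ⟨_, hm, _, h.isGeodesicCover, rfl⟩

/-- Every optimal cover of `K₅` is equivalent to one of the three covers. -/
theorem exists_coverEquiv_of_isOptimal {Γ : Set (Set (GraphSpace (⊤ : SimpleGraph (Fin 5))))}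
    (h : IsOptimalRetractedCover Γ) : ∃ k, CoverEquiv (k5Cover k) Γ := by
  obtain ⟨⟨m, hm, hΓ, hr⟩, hcard⟩ := h
  rw [coverNumber_K5] at hcard
  exact exists_coverEquiv hm hΓ hr hcard

/-! ### The three covers of `K₅` are inequivalent. -/

section Inequivalence

variable {X : Type*} [TopologicalSpace X]

theorem CoverEquiv.exists_disjoint {Γ Γ' : Set (Set X)} (h : CoverEquiv Γ Γ')
    (hΓ : ∃ S ∈ Γ, ∃ T ∈ Γ, ¬ (S ∩ T).Nonempty) : ∃ S ∈ Γ', ∃ T ∈ Γ', ¬ (S ∩ T).Nonempty := by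
  obtain ⟨f, rfl⟩ := h
  obtain ⟨S, hS, T, hT, h⟩ := hΓ
  refine ⟨_, mem_image_of_mem _ hS, _, mem_image_of_mem _ hT, ?_⟩
  rwa [← image_inter f.injective, image_nonempty]

theorem CoverEquiv.exists_meets_all {Γ Γ' : Set (Set X)} (h : CoverEquiv Γ Γ')
    (hΓ : ∃ S ∈ Γ, ∀ T ∈ Γ, (S ∩ T).Nonempty) : ∃ S ∈ Γ', ∀ T ∈ Γ', (S ∩ T).Nonempty := by
  obtain ⟨f, rfl⟩ := h
  obtain ⟨S, hS, h⟩ := hΓ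
  refine ⟨_, mem_image_of_mem _ hS, ?_⟩
  rintro _ ⟨T, hT, rfl⟩
  rw [← image_inter f.injective, image_nonempty]
  exact h T hT

end Inequivalence

theorem k5Paths_isChain_isHalf : ∀ k i, (refine (k5Paths k i)).IsChain IsHalf := by
  decide +kernel

theorem inter_k5Paths_nonempty_iff (k : Fin 3) (i j : Fin 4) :
    (graphPath (⊤ : SimpleGraph (Fin 5)) (k5Paths k i) ∩ graphPath ⊤ (k5Paths k j)).Nonempty ↔
      Meet (k5Paths k i) (k5Paths k j) :=
  inter_graphPath_nonempty_iff (k5Paths_isChain_isHalf k i) (k5Paths_isChain_isHalf k j)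
    ((isCoverData_K5 k).two_le i) ((isCoverData_K5 k).two_le j)

theorem exists_disjoint_k5Cover_iff (k : Fin 3) :
    (∃ S ∈ k5Cover k, ∃ T ∈ k5Cover k, ¬ (S ∩ T).Nonempty) ↔ k ≠ 2 := by
  rw [k5Cover_eq_range]
  simp only [mem_range, exists_exists_eq_and, inter_k5Paths_nonempty_iff]
  revert k
  decide +kernel

theorem exists_meets_all_k5Cover_iff (k : Fin 3) :
    (∃ S ∈ k5Cover k, ∀ T ∈ k5Cover k, (S ∩ T).Nonempty) ↔ k ≠ 1 := by
  rw [k5Cover_eq_range]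
  simp only [mem_range, exists_exists_eq_and, forall_exists_index, forall_apply_eq_imp_iff,
    inter_k5Paths_nonempty_iff]
  revert k
  decide +kernel

/-- Two properties are invariant under homeomorphisms: some two members are disjoint (this fails for
`2` only), and some member meets all others (this fails for `1` only). Together they tell the three
covers apart. -/
theorem eq_of_coverEquiv {j k : Fin 3} (h : CoverEquiv (k5Cover j) (k5Cover k)) : j = k := by
  have key : ∀ j k : Fin 3, (j ≠ 2 → k ≠ 2) → (j ≠ 1 → k ≠ 1) → (k ≠ 2 → j ≠ 2) →
      (k ≠ 1 → j ≠ 1) → j = k := by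
    decide
  refine key j k ?_ ?_ ?_ ?_
  · rw [← exists_disjoint_k5Cover_iff, ← exists_disjoint_k5Cover_iff]
    exact h.exists_disjoint
  · rw [← exists_meets_all_k5Cover_iff, ← exists_meets_all_k5Cover_iff]
    exact h.exists_meets_all
  · rw [← exists_disjoint_k5Cover_iff, ← exists_disjoint_k5Cover_iff]
    exact h.symm'.exists_disjoint
  · rw [← exists_meets_all_k5Cover_iff, ← exists_meets_all_k5Cover_iff]
    exact h.symm'.exists_meets_all

theorem existsUnique_coverEquiv {Γ : Set (Set (GraphSpace (⊤ : SimpleGraph (Fin 5))))}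
    (h : IsOptimalRetractedCover Γ) : ∃! k, CoverEquiv (k5Cover k) Γ := by
  obtain ⟨k, hk⟩ := exists_coverEquiv_of_isOptimal h
  exact ⟨k, hk, fun j hj => eq_of_coverEquiv (hj.trans' hk.symm')⟩

theorem card_quotient_coverSetoid :
    Nat.card (Quotient (coverSetoid (GraphSpace (⊤ : SimpleGraph (Fin 5))))) = 3 := by
  let f : Fin 3 → Quotient (coverSetoid (GraphSpace (⊤ : SimpleGraph (Fin 5)))) := fun k =>
    Quotient.mk _ ⟨k5Cover k, isOptimalRetractedCover_k5Cover k⟩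
  have hf : Function.Bijective f := by
    constructor
    · intro j k h
      exact eq_of_coverEquiv (Quotient.exact h)
    · intro q
      induction q using Quotient.inductionOn with
      | _ Γ =>
      obtain ⟨k, hk⟩ := exists_coverEquiv_of_isOptimal Γ.2
      exact ⟨k, Quotient.sound hk⟩
  rw [← Nat.card_eq_of_bijective f hf, Nat.card_fin]

end GeodesicCover

theorem mainTheorem4 :
    -- the cover numbers of `K₅`, `K₃,₃`, `K₄` and `K₂,₃`
    GeodesicCover.coverNumber (GeodesicCover.GraphSpace (⊤ : SimpleGraph (Fin 5))) = 4 ∧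
    GeodesicCover.coverNumber
      (GeodesicCover.GraphSpace (completeBipartiteGraph (Fin 3) (Fin 3))) = 4 ∧
    GeodesicCover.coverNumber (GeodesicCover.GraphSpace (⊤ : SimpleGraph (Fin 4))) = 4 ∧
    GeodesicCover.coverNumber
      (GeodesicCover.GraphSpace (completeBipartiteGraph (Fin 2) (Fin 3))) = 3 ∧
    -- `K₅` has exactly three optimal retracted covers up to homeomorphism
    Nat.card (Quotient (GeodesicCover.coverSetoid
      (GeodesicCover.GraphSpace (⊤ : SimpleGraph (Fin 5))))) = 3 ∧
    -- the three covers `k5Cover 0`, `k5Cover 1`, `k5Cover 2` represent them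
    (∀ k : Fin 3, GeodesicCover.IsOptimalRetractedCover (GeodesicCover.k5Cover k)) ∧
    (∀ Γ : Set (Set (GeodesicCover.GraphSpace (⊤ : SimpleGraph (Fin 5)))),
      GeodesicCover.IsOptimalRetractedCover Γ →
        ∃! k : Fin 3, GeodesicCover.CoverEquiv (GeodesicCover.k5Cover k) Γ) := by
  exact ⟨GeodesicCover.coverNumber_K5, GeodesicCover.coverNumber_K33, GeodesicCover.coverNumber_K4,
    GeodesicCover.coverNumber_K23, GeodesicCover.card_quotient_coverSetoid,
    GeodesicCover.isOptimalRetractedCover_k5Cover,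
    fun _ => GeodesicCover.existsUnique_coverEquiv⟩
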